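/- Let $\mathbb K$ be an algebraically closed field of characteristic $p>0$, and let $G$ be a connected reductive algebraic group over $\mathbb K$ satisfying the standard hypotheses: the derived subgroup of $G$ is simply connected, $p$ is good for $G$, and the Lie algebra $\mathfrak g$ of $G$ admits a non-degenerate $G$-invariant symmetric bilinear form. Let $T\subseteq B$ be a maximal torus and a Borel subgroup of $G$, let $X(T)$ be the character group of $T$ and $\mathfrak t=\operatorname{Lie}(T)$, let $\Pi\subseteq\Phi^+\subseteq\Phi\subseteq X(T)$ be the corresponding simple roots, positive roots and roots, write $\Phi^+=\{\gamma_1,\dots,\gamma_D\}$ and $\mathfrak n^+=\bigoplus_{\alpha\in\Phi^+}\mathfrak g_\alpha$, $\mathfrak b=\mathfrak t\oplus\mathfrak n^+$, and fix root vectors $e_\alpha\in\mathfrak g_\alpha$ $(\alpha\in\Phi)$ that belong to a Chevalley basis of $\mathfrak g$. For $\chi\in\mathfrak g^*$ let $U_\chi(\mathfrak g)$ be the quotient of $U(\mathfrak g)$ by the ideal generated by all $x^p-x^{[p]}-\chi(x)^p$, $x\in\mathfrak g$. Let $I\subseteq\Pi$ and let $\chi\in\mathfrak g^*$ be in weak standard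 Levi form for $I$: $\chi(\mathfrak b)=0$, $\chi(e_{-\alpha})\neq0$ for $\alpha\in I$ and $\chi(e_{-\alpha})=0$ for $\alpha\in\Phi^+\setminus I$. For $\psi\in\{\chi,-\chi\}$, $U_\psi(\mathfrak g)$ is $X(T)/\mathbb ZI$-graded with $e_\alpha$ in degree $\alpha+\mathbb ZI$ and $\mathfrak t$ in degree $0$; for $\lambda\in X(T)$ let $Z_\psi(\lambda)=U_\psi(\mathfrak g)\otimes_{U_\psi(\mathfrak b)}\mathbb K_\lambda$ be the baby Verma module, where $\mathfrak n^+$ acts on $\mathbb K_\lambda$ as $0$ and $\mathfrak t$ acts via $d\lambda$, with the $X(T)/\mathbb ZI$-grading in which $1\otimes1$ has degree $\lambda+\mathbb ZI$. Likewise $Z_0(\lambda)$ is an $X(T)$-graded $U_0(\mathfrak g)$-module with $1\otimes 1$ in degree $\lambda$; let $\widehat Z_0(\lambda)$ be the same module with the $X(T)/\mathbb ZI$-grading $\widehat Z_0(\lambda)_{\nu+\mathbb ZI}=\bigoplus_{\eta\in\nu+\mathbb ZI}Z_0(\lambda)_\eta$. Let $\widehat{\mathscr C}_0$ be the category of $X(T)/\mathbb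 ZI$-graded $U_0(\mathfrak g)$-modules $M$ such that each $M_{\nu+\mathbb ZI}$ is the direct sum of its $\mathfrak t$-weight spaces for the weights $d\eta$ with $\eta\in\nu+\mathbb ZI+pX(T)$; its morphisms are the $U_0(\mathfrak g)$-module homomorphisms that preserve the grading. Then for all $\lambda,\mu\in X(T)$ the $\mathfrak g$-module $Z_\chi(\lambda)\otimes Z_{-\chi}(\mu)$, with the grading $(M\otimes N)_{\xi}=\bigoplus_{\eta\in X(T)/\mathbb ZI}M_\eta\otimes N_{\xi-\eta}$, is an object of $\widehat{\mathscr C}_0$ and has a finite filtration by subobjects in $\widehat{\mathscr C}_0$ whose successive quotients are, up to isomorphism in $\widehat{\mathscr C}_0$, precisely the modules $\widehat Z_0(\lambda+\mu-a_D\gamma_D-\cdots-a_1\gamma_1)$ for $0\le a_1,\dots,a_D<p$, each appearing exactly once for each tuple $(a_1,\dots,a_D)\in[0,p)^D$. -/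

import Mathlib

open scoped TensorProduct

namespace ReducedEnveloping

noncomputable section

/-! ### Linear algebraic groups and their Lie algebras

An affine algebraic group `G` over the algebraically closed field `K` is given by its coordinate
ring `A = K[G]`, a commutative Hopf algebra. -/

section Group

variable (K : Type*) [Field K] (A : Type*) [CommRing A] [HopfAlgebra K A]

/-- The group `G(K)` of `K`-points of `G`; the product is `(x * y) f = f (x y)`. -/
abbrev Points : Type _ := WithConv (A →ₐ[K] K)

variable {K A}

/-- Right translation of functions: `(rightTranslate g f) x = f (x g)`. -/
def rightTranslate (g : Points K A) : A →ₐ[K] A :=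
  (Algebra.TensorProduct.lift (AlgHom.id K A) ((Algebra.ofId K A).comp g.ofConv)
    (fun _ _ => Commute.all _ _)).comp (Bialgebra.comulAlgHom K A)

/-- The ideal of functions vanishing on a subgroup of `G(K)`. -/
def vanishingIdeal (H : Subgroup (Points K A)) : Ideal A where
  carrier := {f | ∀ g ∈ H, g.ofConv f = 0}
  add_mem' := fun ha hb g hg => by rw [map_add, ha g hg, hb g hg, add_zero]
  zero_mem' := fun g _ => map_zero _
  smul_mem' := fun c f hf g hg => by rw [smul_eq_mul, map_mul, hf g hg, mul_zero]

/-- `H` is Zariski closed in `G(K)`. -/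
def IsZariskiClosed (H : Subgroup (Points K A)) : Prop :=
  ∀ g : Points K A, (∀ f ∈ vanishingIdeal H, g.ofConv f = 0) → g ∈ H

/-- A (closed) subgroup is connected: for algebraic groups this is the same as irreducible. -/
def IsConnectedSubgroup (H : Subgroup (Points K A)) : Prop := (vanishingIdeal H).IsPrime

/-- `g` is unipotent: right translation by `g` on `K[G]` is locally unipotent. -/
def IsUnipotentElement (g : Points K A) : Prop :=
  ∀ f : A, ∃ n : ℕ, (((rightTranslate g).toLinearMap - 1 : Module.End K A) ^ n) f = 0

variable (K A) in
/-- `G` is a connected reductive linear algebraic group: `K[G]` is a finitely generated domain, and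
every closed connected normal unipotent subgroup of `G` is trivial. -/
structure IsReductiveGroup : Prop where
  finiteType : Algebra.FiniteType K A
  isDomain : IsDomain A
  unipotentRadical_trivial : ∀ U : Subgroup (Points K A), IsZariskiClosed U → U.Normal →
    IsConnectedSubgroup U → (∀ g ∈ U, IsUnipotentElement g) → U = ⊥

/-- Borel subgroups: the maximal closed connected solvable subgroups of `G`. -/
def IsBorel (B : Subgroup (Points K A)) : Prop :=
  Maximal (fun H => IsZariskiClosed H ∧ IsConnectedSubgroup H ∧ Group.IsSolvable H) B

variable (K A) in
/-- The Lie algebra `𝔤` of `G`: the left invariant derivations of `K[G]`. -/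
def lieAlgebra : LieSubalgebra K (Derivation K A A) where
  carrier := {D | ∀ f, Coalgebra.comul (R := K) (D f) =
    (D : A →ₗ[K] A).lTensor A (Coalgebra.comul (R := K) f)}
  add_mem' := fun {a b} ha hb f => by
    rw [Derivation.add_apply, map_add, ha f, hb f, Derivation.coe_add_linearMap,
      LinearMap.lTensor_add, LinearMap.add_apply]
  zero_mem' := fun f => by
    rw [Derivation.zero_apply, map_zero, Derivation.coe_zero_linearMap, LinearMap.lTensor_zero,
      LinearMap.zero_apply]
  smul_mem' := fun c D hD f => by
    rw [Derivation.smul_apply, map_smul, hD f, Derivation.coe_smul_linearMap,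
      LinearMap.lTensor_smul, LinearMap.smul_apply]
  lie_mem' := fun {a b} ha hb f => by
    have key : ∀ (D : Derivation K A A), (∀ f, Coalgebra.comul (R := K) (D f) =
        (D : A →ₗ[K] A).lTensor A (Coalgebra.comul (R := K) f)) →
        Coalgebra.comul (R := K) ∘ₗ (D : A →ₗ[K] A) =
          (D : A →ₗ[K] A).lTensor A ∘ₗ Coalgebra.comul (R := K) :=
      fun D hD => LinearMap.ext hD
    have h : ((⁅a, b⁆ : Derivation K A A) : A →ₗ[K] A) =
        (a : A →ₗ[K] A) ∘ₗ (b : A →ₗ[K] A) - (b : A →ₗ[K] A) ∘ₗ (a : A →ₗ[K] A) := by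
      rfl
    have e : Coalgebra.comul (R := K) ∘ₗ ((⁅a, b⁆ : Derivation K A A) : A →ₗ[K] A) =
        ((⁅a, b⁆ : Derivation K A A) : A →ₗ[K] A).lTensor A ∘ₗ Coalgebra.comul (R := K) := by
      have ka := key a ha
      have kb := key b hb
      rw [h, LinearMap.lTensor_sub, LinearMap.comp_sub, LinearMap.sub_comp, LinearMap.lTensor_comp,
        LinearMap.lTensor_comp, LinearMap.comp_assoc, LinearMap.comp_assoc, ← ka, ← kb,
        ← LinearMap.comp_assoc, ← LinearMap.comp_assoc, ka, kb, LinearMap.comp_assoc,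
        LinearMap.comp_assoc, ← ka, ← kb]
    exact LinearMap.congr_fun e f

variable (K A) in
/-- The underlying type of the Lie algebra `𝔤` of `G`. -/
abbrev Lie : Type _ := ↥(lieAlgebra K A)

/-- In characteristic `p`, the `p`-th power of a derivation is a derivation. -/
theorem pow_char_leibniz (p : ℕ) [Fact p.Prime] [CharP K p] (D : Derivation K A A) (a b : A) :
    (((D : A →ₗ[K] A) : Module.End K A) ^ p) (a * b) =
      a • (((D : A →ₗ[K] A) : Module.End K A) ^ p) b +
        b • (((D : A →ₗ[K] A) : Module.End K A) ^ p) a := by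
  cases subsingleton_or_nontrivial A
  · exact Subsingleton.elim _ _
  set d : Module.End K A := (D : A →ₗ[K] A) with hd
  set l := LinearMap.mulLeft K d with hl
  set r := LinearMap.mulRight K d with hr
  have hpow : (l - r) ^ p = l ^ p - r ^ p := by
    have : CharP (Module.End K (Module.End K A)) p := charP_of_injective_algebraMap
      (algebraMap K (Module.End K (Module.End K A))).injective p
    have hc : Commute l r := LinearMap.commute_mulLeft_right d d
    exact sub_pow_char_of_commute (R := Module.End K (Module.End K A)) p hc
  have hstep : ∀ (n : ℕ) (c : A), ((l - r) ^ n) (LinearMap.mulLeft K c) =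
      LinearMap.mulLeft K ((d ^ n) c) := by
    intro n
    induction n with
    | zero => intro c; simp
    | succ n ih =>
      intro c
      have h1 : (l - r) (LinearMap.mulLeft K c) = LinearMap.mulLeft K (d c) := by
        ext x
        simp [hl, hr, hd, mul_comm]
      rw [pow_succ, Module.End.mul_apply, h1, ih, pow_succ, Module.End.mul_apply]
  have h := LinearMap.congr_fun (hstep p a) b
  rw [hpow, LinearMap.sub_apply, hl, hr, LinearMap.pow_mulLeft, LinearMap.pow_mulRight] at h
  simp only [LinearMap.sub_apply, LinearMap.mulLeft_apply, LinearMap.mulRight_apply,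
    Module.End.mul_apply] at h
  rw [sub_eq_iff_eq_add] at h
  rw [h, smul_eq_mul, smul_eq_mul, add_comm, mul_comm b]

theorem pow_leftInvariant (d : Module.End K A)
    (hd : Coalgebra.comul (R := K) ∘ₗ d = d.lTensor A ∘ₗ Coalgebra.comul (R := K)) (n : ℕ) :
    Coalgebra.comul (R := K) ∘ₗ (d ^ n) = (d ^ n).lTensor A ∘ₗ Coalgebra.comul (R := K) := by
  induction n with
  | zero =>
    rw [pow_zero, Module.End.one_eq_id, LinearMap.lTensor_id, LinearMap.comp_id, LinearMap.id_comp]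
  | succ n ih =>
    rw [pow_succ, Module.End.mul_eq_comp, ← LinearMap.comp_assoc, ih, LinearMap.comp_assoc, hd,
      LinearMap.lTensor_comp, LinearMap.comp_assoc]

/-- The `[p]`-map of `𝔤`: the `p`-th power of a left invariant derivation. -/
def pPow (p : ℕ) [Fact p.Prime] [CharP K p] (x : Lie K A) : Lie K A :=
  ⟨Derivation.mk' (((x : Derivation K A A) : A →ₗ[K] A) ^ p : Module.End K A)
      (pow_char_leibniz p (x : Derivation K A A)), fun f =>
    LinearMap.congr_fun (pow_leftInvariant ((x : Derivation K A A) : A →ₗ[K] A)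
      (LinearMap.ext x.2) p) f⟩

/-- `x' = Ad(g) x`. -/
def IsAd (g : Points K A) (x x' : Lie K A) : Prop :=
  ∀ f, rightTranslate g ((x : Derivation K A A) f) =
    (x' : Derivation K A A) (rightTranslate g f)

/-- The Lie algebra of a closed subgroup, as a subspace of `𝔤`. -/
def lieOfSubgroup (H : Subgroup (Points K A)) : Submodule K (Lie K A) where
  carrier := {x | ∀ f ∈ vanishingIdeal H, (x : Derivation K A A) f ∈ vanishingIdeal H}
  add_mem' := fun ha hb f hf => (vanishingIdeal H).add_mem (ha f hf) (hb f hf)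
  zero_mem' := fun _ _ => (vanishingIdeal H).zero_mem
  smul_mem' := fun c x hx f hf => by
    have := (vanishingIdeal H).mul_mem_left (algebraMap K A c) (hx f hf)
    rwa [← Algebra.smul_def] at this

end Group

/-! ### Tori, roots, Chevalley systems -/

section Torus

/-- A closed subtorus `T` of `G` with character group `X = X(T)`: the coordinate ring of the torus
with character group `X` is the group algebra `K[X]`, and a closed embedding `T → G` is a surjective
homomorphism of Hopf algebras `K[G] → K[X]`. -/
structure ClosedTorus (K : Type*) [Field K] (A : Type*) [CommRing A] [HopfAlgebra K A]
    (X : Type*) [AddCommGroup X] where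
  res : A →ₐc[K] AddMonoidAlgebra K X
  surjective : Function.Surjective res

variable {K : Type*} [Field K] {A : Type*} [CommRing A] [HopfAlgebra K A]
  {X : Type*} [AddCommGroup X]

namespace ClosedTorus

variable (T : ClosedTorus K A X)

/-- `T` is a maximal torus: no torus of `G` properly contains it. -/
def IsMaximalTorus : Prop :=
  ∀ (n : ℕ) (T' : ClosedTorus K A (Fin n → ℤ)),
    (∀ f, T'.res f = 0 → T.res f = 0) → ∀ f, T.res f = 0 → T'.res f = 0

/-- A `K`-point of `T`, as a `K`-point of `G`. -/
def point (t : AddMonoidAlgebra K X →ₐ[K] K) : Points K A :=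
  WithConv.toConv (t.comp (T.res : A →ₐ[K] AddMonoidAlgebra K X))

/-- The value `ν(t)` of the character `ν` at a `K`-point of `T`. -/
def charValue (ν : X) (t : AddMonoidAlgebra K X →ₐ[K] K) : K := t (AddMonoidAlgebra.single ν 1)

/-- The weight space `𝔤_ν = {x ∈ 𝔤 | Ad(t) x = ν(t) x for all t ∈ T}`. -/
def weightSpace (ν : X) : Submodule K (Lie K A) where
  carrier := {x | ∀ t : AddMonoidAlgebra K X →ₐ[K] K, IsAd (T.point t) x (charValue ν t • x)}
  add_mem' := fun {a b} ha hb t f => by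
    have h1 : rightTranslate (T.point t) ((a : Derivation K A A) f) =
      charValue ν t • (a : Derivation K A A) (rightTranslate (T.point t) f) := ha t f
    have h2 : rightTranslate (T.point t) ((b : Derivation K A A) f) =
      charValue ν t • (b : Derivation K A A) (rightTranslate (T.point t) f) := hb t f
    change rightTranslate (T.point t) ((a : Derivation K A A) f + (b : Derivation K A A) f) =
      charValue ν t • ((a : Derivation K A A) (rightTranslate (T.point t) f) +
        (b : Derivation K A A) (rightTranslate (T.point t) f))
    rw [map_add, h1, h2, smul_add]
  zero_mem' := fun t f => by
    change rightTranslate (T.point t) (0 : A) = charValue ν t • (0 : A)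
    rw [map_zero, smul_zero]
  smul_mem' := fun c a ha t f => by
    have h1 : rightTranslate (T.point t) ((a : Derivation K A A) f) =
      charValue ν t • (a : Derivation K A A) (rightTranslate (T.point t) f) := ha t f
    change rightTranslate (T.point t) (c • (a : Derivation K A A) f) =
      charValue ν t • (c • (a : Derivation K A A) (rightTranslate (T.point t) f))
    rw [map_smul, h1, smul_comm]

/-- The Lie algebra `𝔱` of `T`, inside `𝔤`: the derivations preserving the ideal of `T`. -/
def lie : Submodule K (Lie K A) where
  carrier := {x | ∀ f, T.res f = 0 → T.res ((x : Derivation K A A) f) = 0}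
  add_mem' := fun {a b} ha hb f hf => by
    change T.res ((a : Derivation K A A) f + (b : Derivation K A A) f) = 0
    rw [map_add, ha f hf, hb f hf, add_zero]
  zero_mem' := fun f _ => map_zero T.res
  smul_mem' := fun c x hx f hf => by
    change T.res (c • (x : Derivation K A A) f) = 0
    rw [map_smul, hx f hf, smul_zero]

/-- The differential `dν : 𝔱 → K` of a character `ν`: the derivative of `ν` at the identity along
`h`. The value does not depend on the function on `G` chosen to extend `ν`. -/
def differential (ν : X) : T.lie →ₗ[K] K where
  toFun h := Coalgebra.counit (R := K)
    (((h : Lie K A) : Derivation K A A)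
      (Function.surjInv T.surjective (AddMonoidAlgebra.single ν 1)))
  map_add' := fun a b => by simp
  map_smul' := fun c a => by simp

variable {ι Y : Type*} [AddCommGroup Y]

/-- `P` is the root datum of `(G, T)`: the roots are the nonzero weights of `T` on `𝔤`, and the
coroots are such that each reflection `s_α(ν) = ν - ⟨ν, α^∨⟩ α` of `X(T)` is induced by an element
of `G(K)` normalising `T`. -/
structure IsRootDatum (P : RootDatum ι X Y) : Prop where
  reduced : P.IsReduced
  range_root : Set.range P.root = {ν | ν ≠ 0 ∧ T.weightSpace ν ≠ ⊥}
  reflection : ∀ i, ∃ g : Points K A, ∀ t : AddMonoidAlgebra K X →ₐ[K] K,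
    ∃ t' : AddMonoidAlgebra K X →ₐ[K] K, g * T.point t = T.point t' * g ∧
      ∀ ν, charValue ν t' = charValue (P.reflection i ν) t

/-- The root vectors `e_α` (`α ∈ Φ`) satisfy the Chevalley basis relations, and together with `𝔱`
they span `𝔤`. -/
structure IsChevalleySystem [Finite ι] (P : RootDatum ι X Y) (e : ι → Lie K A) : Prop where
  mem : ∀ i, e i ∈ T.weightSpace (P.root i)
  ne_zero : ∀ i, e i ≠ 0
  span : T.lie ⊔ Submodule.span K (Set.range e) = ⊤
  /-- `[e_α, e_{-α}] = h_α` is the element of `𝔱` defined by the coroot `α^∨`. -/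
  lie_neg : ∀ i j, P.root j = - P.root i → ∃ h : T.lie, ⁅e i, e j⁆ = (h : Lie K A) ∧
    ∀ ν, T.differential ν h = ((P.toLinearMap ν (P.coroot i) : ℤ) : K)
  /-- `[e_α, e_β] = ± (r + 1) e_{α + β}`, with `r` maximal such that `β - r α` is a root. -/
  lie_add : ∀ i j k, P.root k = P.root i + P.root j →
    ⁅e i, e j⁆ = (P.chainBotCoeff i j + 1) • e k ∨ ⁅e i, e j⁆ = - ((P.chainBotCoeff i j + 1) • e k)
  lie_eq_zero : ∀ i j, P.root i + P.root j ≠ 0 → P.root i + P.root j ∉ Set.range P.root →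
    ⁅e i, e j⁆ = 0

/-- `Π` is the set of simple roots attached to the Borel subgroup `B ⊇ T`: the positive roots are
those whose root space lies in the Lie algebra of `B`. -/
structure IsBaseOfBorel (B : Subgroup (Points K A)) {P : RootDatum ι X Y} (b : P.Base) : Prop where
  borel : IsBorel B
  torus_le : ∀ t, T.point t ∈ B
  isPos_iff : ∀ i, b.IsPos i ↔ T.weightSpace (P.root i) ≤ lieOfSubgroup B

/-- `χ` is in weak standard Levi form with respect to `I ⊆ Π`. -/
structure IsWeakStandardLevi {P : RootDatum ι X Y} (b : P.Base) (e : ι → Lie K A) (I : Set ι)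
    (χ : Module.Dual K (Lie K A)) : Prop where
  subset : I ⊆ b.support
  cartan : ∀ h ∈ T.lie, χ h = 0
  pos : ∀ i, b.IsPos i → ∀ x ∈ T.weightSpace (P.root i), χ x = 0
  neg_of_notMem : ∀ i j, b.IsPos i → i ∉ I → P.root j = - P.root i → χ (e j) = 0
  neg_of_mem : ∀ i j, i ∈ I → P.root j = - P.root i → χ (e j) ≠ 0

end ClosedTorus

variable (K A) in
/-- The standard hypotheses on `G`: (A) the derived group is simply connected, i.e. the coroot
lattice is saturated in the cocharacter group; (B) `p` is good, i.e. `p` divides no nonzero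
coefficient of a root in terms of the simple roots; (C) there is a non-degenerate `G`-invariant
symmetric bilinear form on `𝔤`. -/
structure StandardHypotheses {ι Y : Type*} [AddCommGroup Y] (p : ℕ) {P : RootDatum ι X Y} (b : P.Base) : Prop where
  simplyConnected : ∀ (n : ℤ) (y : Y), n ≠ 0 →
    n • y ∈ Submodule.span ℤ (Set.range P.coroot) → y ∈ Submodule.span ℤ (Set.range P.coroot)
  good : ∀ (i : ι) (c : ι → ℤ), P.root i = ∑ j ∈ b.support, c j • P.root j →
    ∀ j ∈ b.support, (p : ℤ) ∣ c j → c j = 0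
  form : ∃ F : LinearMap.BilinForm K (Lie K A), F.IsSymm ∧ F.Nondegenerate ∧
    ∀ (g : Points K A) (x y x' y' : Lie K A), IsAd g x x' → IsAd g y y' → F x' y' = F x y

end Torus

/-! ### Reduced enveloping algebras and baby Verma modules -/

section Modules

variable {K : Type*} [Field K] {A : Type*} [CommRing A] [HopfAlgebra K A]
  (p : ℕ) [Fact p.Prime] [CharP K p]

/-- The reduced enveloping algebra
`U_χ(𝔤) = U(𝔤) / ⟨x ^ p - x^[p] - χ(x) ^ p | x ∈ 𝔤⟩`. -/
abbrev RedEnv (χ : Module.Dual K (Lie K A)) : Type _ :=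
  RingQuot (fun u v : UniversalEnvelopingAlgebra K (Lie K A) =>
    ∃ x : Lie K A, u = UniversalEnvelopingAlgebra.ι K x ^ p ∧
      v = UniversalEnvelopingAlgebra.ι K (pPow p x) + algebraMap K _ (χ x ^ p))

attribute [local instance 100] LieRing.ofAssociativeRing

/-- The canonical homomorphism `𝔤 → U_χ(𝔤)`. -/
def toRedEnv (χ : Module.Dual K (Lie K A)) : Lie K A →ₗ⁅K⁆ RedEnv p χ :=
  ((RingQuot.mkAlgHom K _ : UniversalEnvelopingAlgebra K (Lie K A) →ₐ[K] RedEnv p χ) :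
    UniversalEnvelopingAlgebra K (Lie K A) →ₗ⁅K⁆ RedEnv p χ).comp
      (UniversalEnvelopingAlgebra.ι K)

variable {X : Type*} [AddCommGroup X] (T : ClosedTorus K A X)
  {ι Y : Type*} [AddCommGroup Y] {P : RootDatum ι X Y} (b : P.Base)
  {Q : Type*} [AddCommGroup Q] (q : X →+ Q)

/-- The component of degree `ξ` of the `Q`-grading of `U_χ(𝔤)` in which `𝔤_ν` has degree `q(ν)`
(so that `𝔱` has degree `0`): the span of the products of weight vectors of total degree `ξ`. -/
def redEnvDegree (χ : Module.Dual K (Lie K A)) (ξ : Q) : Submodule K (RedEnv p χ) :=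
  Submodule.span K {u | ∃ l : List (Lie K A × X), (∀ y ∈ l, y.1 ∈ T.weightSpace y.2) ∧
    q (l.map Prod.snd).sum = ξ ∧ u = (l.map fun y => toRedEnv p χ y.1).prod}

/-- The left ideal of `U_χ(𝔤)` generated by the kernel of the action of `U_χ(𝔟)` on `K_ν`,
that is, by `𝔫⁺` and the `h - dν(h)` for `h ∈ 𝔱`. -/
def babyVermaIdeal (χ : Module.Dual K (Lie K A)) (ν : X) : Ideal (RedEnv p χ) :=
  Ideal.span ({u | ∃ i, b.IsPos i ∧ ∃ x ∈ T.weightSpace (P.root i), u = toRedEnv p χ x} ∪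
    {u | ∃ h : T.lie, u = toRedEnv p χ (h : Lie K A) - algebraMap K _ (T.differential ν h)})

/-- The baby Verma module `Z_χ(ν) = U_χ(𝔤) ⊗_{U_χ(𝔟)} K_ν`. As `K_ν` is the quotient of `U_χ(𝔟)` by
a left ideal, it is the quotient of `U_χ(𝔤)` by the left ideal generated by the latter. -/
def BabyVerma (χ : Module.Dual K (Lie K A)) (ν : X) : Type _ :=
  RedEnv p χ ⧸ babyVermaIdeal p T b χ ν

variable (χ : Module.Dual K (Lie K A)) (ν : X)

instance : AddCommGroup (BabyVerma p T b χ ν) :=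
  inferInstanceAs (AddCommGroup (RedEnv p χ ⧸ babyVermaIdeal p T b χ ν))

instance : Module (RedEnv p χ) (BabyVerma p T b χ ν) :=
  inferInstanceAs (Module (RedEnv p χ) (RedEnv p χ ⧸ babyVermaIdeal p T b χ ν))

instance : Module K (BabyVerma p T b χ ν) :=
  inferInstanceAs (Module K (RedEnv p χ ⧸ babyVermaIdeal p T b χ ν))

instance : IsScalarTower K (RedEnv p χ) (BabyVerma p T b χ ν) :=
  inferInstanceAs (IsScalarTower K (RedEnv p χ) (RedEnv p χ ⧸ babyVermaIdeal p T b χ ν))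

/-- `x ∈ 𝔤` acts on `Z_χ(ν)` as its image in `U_χ(𝔤)`. -/
instance : LieRingModule (Lie K A) (BabyVerma p T b χ ν) where
  bracket x z := toRedEnv p χ x • z
  add_lie x y z := by
    change toRedEnv p χ (x + y) • z = toRedEnv p χ x • z + toRedEnv p χ y • z
    rw [map_add, add_smul]
  lie_add x y z := smul_add _ _ _
  leibniz_lie x y z := by
    change toRedEnv p χ x • toRedEnv p χ y • z =
      toRedEnv p χ ⁅x, y⁆ • z + toRedEnv p χ y • toRedEnv p χ x • z
    rw [LieHom.map_lie, LieRing.of_associative_ring_bracket, sub_smul, mul_smul, mul_smul,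
      sub_add_cancel]

instance : LieModule K (Lie K A) (BabyVerma p T b χ ν) where
  smul_lie c x z := by
    change toRedEnv p χ (c • x) • z = c • toRedEnv p χ x • z
    rw [map_smul, smul_assoc]
  lie_smul c x z := smul_algebra_smul_comm c (toRedEnv p χ x) z

/-- The `Q`-grading of `Z_χ(ν)` induced by putting `1 ⊗ 1` in degree `q(ν)`. -/
def babyVermaDegree (ξ : Q) : Submodule K (BabyVerma p T b χ ν) :=
  (redEnvDegree p T q χ (ξ - q ν)).map ((babyVermaIdeal p T b χ ν).mkQ.restrictScalars K)

end Modules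

/-! ### Graded modules

`U_χ(𝔤)`-modules are the same as `𝔤`-modules on which `x ^ p - x^[p]` acts as `χ(x) ^ p`. -/

section Graded

variable {K : Type*} [Field K] {A : Type*} [CommRing A] [HopfAlgebra K A]
  (p : ℕ) [Fact p.Prime] [CharP K p]
  {X : Type*} [AddCommGroup X] (T : ClosedTorus K A X)
  {Q : Type*} [AddCommGroup Q] (q : X →+ Q)

/-- The subspace `M^{dν}` of `M` on which `𝔱` acts via `dν`. -/
def cartanWeightSpace (M : Type*) [AddCommGroup M] [Module K M] [LieRingModule (Lie K A) M]
    [LieModule K (Lie K A) M] (ν : X) : Submodule K M where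
  carrier := {m | ∀ h : T.lie, ⁅(h : Lie K A), m⁆ = T.differential ν h • m}
  add_mem' := fun ha hb h => by rw [lie_add, ha h, hb h, smul_add]
  zero_mem' := fun h => by rw [lie_zero, smul_zero]
  smul_mem' := fun c m hm h => by rw [lie_smul, hm h, smul_comm]

/-- `M`, with the components `deg ξ` (`ξ ∈ Q`), is a `Q`-graded `U_χ(𝔤)`-module with property (X).
Here `𝔤_ν` has degree `q(ν)`. For `q : X → X / ℤI` these are the objects of `𝒞_χ`, and, for `χ = 0`,
those of `𝒞̂_0`; for `χ = 0` and `q = id` they are the objects of `𝒞_0`. -/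
structure IsGradedModule (χ : Module.Dual K (Lie K A)) (M : Type*) [AddCommGroup M] [Module K M]
    [LieRingModule (Lie K A) M] [LieModule K (Lie K A) M] (deg : Q → Submodule K M) : Prop where
  /-- `M` is a `U_χ(𝔤)`-module. -/
  pCharacter : ∀ (x : Lie K A) (m : M),
    ((LieModule.toEnd K (Lie K A) M x) ^ p) m = ⁅pPow p x, m⁆ + χ x ^ p • m
  /-- `M` is the direct sum of the `deg ξ`. -/
  independent : iSupIndep deg
  iSup_eq_top : ⨆ ξ, deg ξ = ⊤
  lie_mem : ∀ (ν : X) (ξ : Q), ∀ x ∈ T.weightSpace ν, ∀ m ∈ deg ξ, ⁅x, m⁆ ∈ deg (q ν + ξ)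
  /-- Property (X): each `deg ξ` is the sum (automatically direct) of its `𝔱`-weight spaces for the
  weights `dν` with `ν ∈ ξ + pX`. -/
  propertyX : ∀ ξ : Q, deg ξ =
    ⨆ ν : {ν : X // ∃ κ : X, q ν = ξ + q (p • κ)}, deg ξ ⊓ cartanWeightSpace T M ν

/-- An isomorphism of graded modules. -/
def GradedIso {M N : Type*} [AddCommGroup M] [Module K M] [LieRingModule (Lie K A) M]
    [AddCommGroup N] [Module K N] [LieRingModule (Lie K A) N]
    (degM : Q → Submodule K M) (degN : Q → Submodule K N) : Prop :=
  ∃ f : M ≃ₗ⁅K, Lie K A⁆ N, ∀ ξ, (degM ξ).map (f : M →ₗ[K] N) = degN ξ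

/-- The grading `(M ⊗ N)_ξ = ⨁_η M_η ⊗ N_{ξ - η}` of a tensor product. -/
def tensorDegree {M N : Type*} [AddCommGroup M] [Module K M] [AddCommGroup N] [Module K N]
    (degM : Q → Submodule K M) (degN : Q → Submodule K N) (ξ : Q) : Submodule K (M ⊗[K] N) :=
  ⨆ η : Q, LinearMap.range (TensorProduct.map (degM η).subtype (degN (ξ - η)).subtype)

/-- The `Q`-grading `M_ξ = ⨁_{q(η) = ξ} M_η` obtained from an `X`-grading. -/
def coarsen {M : Type*} [AddCommGroup M] [Module K M] (deg : X → Submodule K M) (ξ : Q) :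
    Submodule K M :=
  ⨆ η : {η : X // q η = ξ}, deg η

section Sub

variable {M : Type*} [AddCommGroup M] [Module K M] [LieRingModule (Lie K A) M]
  [LieModule K (Lie K A) M] (deg : Q → Submodule K M)

/-- `N` is a graded submodule of `M`. -/
def IsGradedSubmodule (N : LieSubmodule K (Lie K A) M) : Prop :=
  (N : Submodule K M) = ⨆ ξ, (N : Submodule K M) ⊓ deg ξ

/-- The quotient `N' / N` of two submodules `N ⊆ N'` of `M`. -/
abbrev Subquotient (N N' : LieSubmodule K (Lie K A) M) : Type _ := ↥N' ⧸ N.comap N'.incl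

/-- The grading of `N' / N` induced by that of `M`. -/
def subquotientDegree (N N' : LieSubmodule K (Lie K A) M) (ξ : Q) :
    Submodule K (Subquotient N N') :=
  ((deg ξ).comap (N'.incl : ↥N' →ₗ[K] M)).map
    (LieSubmodule.Quotient.mk' (N.comap N'.incl) : ↥N' →ₗ[K] Subquotient N N')

end Sub

end Graded

/-! ### The graded modules `Z_χ(λ) ⊗ Z_{-χ}(μ)` and `Ẑ_0(ν)` -/

section Objects

variable {K : Type*} [Field K] {A : Type*} [CommRing A] [HopfAlgebra K A]
  (p : ℕ) [Fact p.Prime] [CharP K p] {X : Type*} [AddCommGroup X] (T : ClosedTorus K A X)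
  {ι Y : Type*} [AddCommGroup Y] {P : RootDatum ι X Y} (b : P.Base)

/-- The group of degrees `X(T) / ℤI`. -/
abbrev DegreeGroup (P : RootDatum ι X Y) (I : Set ι) : Type _ :=
  X ⧸ AddSubgroup.closure (P.root '' I)

/-- The projection `X(T) → X(T) / ℤI`. -/
abbrev toDegree (P : RootDatum ι X Y) (I : Set ι) : X →+ DegreeGroup P I :=
  QuotientAddGroup.mk' (AddSubgroup.closure (P.root '' I))

/-- The `𝔤`-module `Z_χ(λ) ⊗ Z_{-χ}(μ)`, with `x (m ⊗ n) = (x m) ⊗ n + m ⊗ (x n)`. -/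
abbrev BabyVermaTensor (χ : Module.Dual K (Lie K A)) (lam mu : X) : Type _ :=
  BabyVerma p T b χ lam ⊗[K] BabyVerma p T b (-χ) mu

/-- The `X(T) / ℤI`-grading of `Z_χ(λ) ⊗ Z_{-χ}(μ)`. -/
def babyVermaTensorDegree (I : Set ι) (χ : Module.Dual K (Lie K A)) (lam mu : X) :
    DegreeGroup P I → Submodule K (BabyVermaTensor p T b χ lam mu) :=
  tensorDegree (babyVermaDegree p T b (toDegree P I) χ lam)
    (babyVermaDegree p T b (toDegree P I) (-χ) mu)

/-- The `X(T) / ℤI`-grading of `Ẑ_0(ν)`, obtained from the `X(T)`-grading of `Z_0(ν)`. -/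
def hatBabyVermaDegree (I : Set ι) (ν : X) : DegreeGroup P I → Submodule K (BabyVerma p T b 0 ν) :=
  coarsen (toDegree P I) (babyVermaDegree p T b (AddMonoidHom.id X) 0 ν)

end Objects

end

end ReducedEnveloping

/-! Let v be the generator 1 ⊗ 1 of Z_χ(λ), and let f^c ⊗ 1 be the restricted ordered monomials in
Z_{-χ}(μ). The vectors v ⊗ (f^c ⊗ 1) generate the tensor product over 𝔤 (`tensorFiltration_last`).
List the exponents c by decreasing height of the weight of f^c ⊗ 1, and let F_i be the submodule
generated by the first i of these vectors. A positive root vector kills v and sends f^c ⊗ 1 to a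
combination of monomials of strictly greater height, which occur earlier in the list
(`lie_generator_mem_tensorFiltration`). In F_{i+1} / F_i the new generator is therefore killed by
𝔫⁺, and 𝔱 acts on it through the weight λ + μ - Σ c_j γ_j. Since χ and -χ add up to 0, the layer is
a quotient of the baby Verma module Z_0 of that weight (`exists_surjective_layer`).

Each of the p^D layers thus has dimension at most p^D, while the whole space has dimension p^D ·
p^D. So every surjection is bijective (`eq_add_of_le_add`, `gradedIso_layer`). The generators are
homogeneous, so these isomorphisms respect the grading.

All this needs the monomials f^a ⊗ 1 to form a basis of Z_ψ(ν). They span by straightening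
(`prod_mem_restrictedMonomials`). Here f_j^p is the scalar ψ(f_j)^p, which may be nonzero, so
shortening a word can change its weight in X(T). This only happens when γ_j has degree 0, so the
degree is kept and the height goes up. The relation `weightLe` records exactly this, and it suffices
both for the grading and for the filtration.

Independence is a PBW theorem for U_ψ(𝔤) (`linearIndependent_monomials`). Choose F in K[G] with
differential ψ at the identity and let x in 𝔤 act by a ↦ x a + (x F) a. By the formula (D + φ)^p =
D^p + D^{p-1} φ + φ^p this gives a U_ψ(𝔤)-module structure on the functions on the Frobenius kernel.
On monomials in local coordinates at the identity, words in a basis of 𝔤 act to leading order as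
partial derivatives. Exponents below p are then told apart by products of factorials, which are
nonzero in K.

Weight spaces, the action of 𝔱 and the vanishing of e_α^[p] are read off from the weight
decomposition of K[G] under right translation by T, which rests on the linear independence of
characters. -/

namespace ReducedEnveloping

noncomputable section

/-! ### Left invariant operators on the coordinate ring -/

section Convolution

variable {K : Type*} [Field K] {A : Type*} [CommRing A] [HopfAlgebra K A]

/-- The left invariant operator `f ↦ (id ⊗ φ)(Δ f)` attached to a linear form `φ` on `K[G]`. -/
def rightConv (φ : Module.Dual K A) : Module.End K A :=
  (TensorProduct.rid K A).toLinearMap ∘ₗ φ.lTensor A ∘ₗ Coalgebra.comul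

theorem rightTranslate_eq_rightConv (g : Points K A) (f : A) :
    rightTranslate g f = rightConv g.ofConv.toLinearMap f := by
  simp only [rightTranslate, rightConv, AlgHom.comp_apply, LinearMap.comp_apply,
    LinearEquiv.coe_coe, Bialgebra.comulAlgHom_apply]
  generalize Coalgebra.comul (R := K) f = w
  induction w with
  | zero => simp
  | add a b ha hb => simp only [map_add, ha, hb]
  | tmul a b => simp [Algebra.smul_def, mul_comm, Algebra.ofId_apply]

/-- Apply id ⊗ ε to the identity expressing left invariance; the counit axiom turns the left-hand
side into x f. So x is convolution with its tangent vector at the identity. -/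
theorem derivation_eq_rightConv (x : Lie K A) (f : A) :
    (x : Derivation K A A) f =
      rightConv (Coalgebra.counit ∘ₗ ((x : Derivation K A A) : A →ₗ[K] A)) f := by
  have h := x.2 f
  have h2 := congrArg (fun w => TensorProduct.rid K A (Coalgebra.counit.lTensor A w)) h
  simp only [Coalgebra.lTensor_counit_comul, TensorProduct.rid_tmul, one_smul] at h2
  rw [h2, rightConv, LinearMap.lTensor_comp]
  rfl

/-- A left invariant derivation is determined by its value at the identity. -/
theorem lie_ext_counit {x y : Lie K A}
    (h : ∀ f, Coalgebra.counit (R := K) ((x : Derivation K A A) f) =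
      Coalgebra.counit (R := K) ((y : Derivation K A A) f)) : x = y := by
  refine Subtype.ext (Derivation.ext fun f => ?_)
  rw [derivation_eq_rightConv, derivation_eq_rightConv]
  congr 1
  congr 1
  exact LinearMap.ext h

end Convolution

/-! ### Linear independence of the characters of a torus. -/

namespace ClosedTorus

section Characters

variable {K : Type*} [Field K] {X : Type*} [AddCommGroup X]

/-- An algebraically closed field is infinite, so it has an element other than 0 and 1; a root of it
of order |k| will do. -/
theorem exists_unit_zpow_ne_one [IsAlgClosed K] {k : ℤ} (hk : k ≠ 0) : ∃ a : Kˣ, a ^ k ≠ 1 := by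
  classical
  have : Infinite K := IsAlgClosed.instInfinite
  obtain ⟨x, hx⟩ := Infinite.exists_notMem_finset ({0, 1} : Finset K)
  simp only [Finset.mem_insert, Finset.mem_singleton, not_or] at hx
  obtain ⟨z, hz⟩ := IsAlgClosed.exists_pow_nat_eq x (n := k.natAbs) (by omega)
  have hz0 : z ≠ 0 := by
    rintro rfl
    rw [zero_pow (by omega)] at hz
    exact hx.1 hz.symm
  have key : (Units.mk0 z hz0) ^ k.natAbs ≠ 1 := by
    intro h
    have := congrArg Units.val h
    simp only [Units.val_pow_eq_pow_val, Units.val_mk0, Units.val_one, hz] at this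
    exact hx.2 this
  refine ⟨Units.mk0 z hz0, fun h => key ?_⟩
  rcases Int.natAbs_eq k with h' | h' <;> rw [h'] at h
  · simpa using h
  · rw [zpow_neg, inv_eq_one] at h
    simpa using h

/-- The characters of a torus separate into linearly independent functions on its points. -/
theorem eq_zero_of_sum_charValue [IsAlgClosed K] [Module.Free ℤ X]
    {V : Type*} [AddCommGroup V] [Module K V] (g : X →₀ V)
    (h : ∀ t : AddMonoidAlgebra K X →ₐ[K] K, (g.sum fun μ a => charValue μ t • a) = 0) :
    g = 0 := by
  classical
  -- Distinct characters differ in some coordinate of a basis of X; a point of the torus supported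
  -- on that coordinate separates them.
  have hinj : Function.Injective (fun ν : X =>
      (MonoidHom.eval (Multiplicative.ofAdd ν) : (Multiplicative X →* K) →* K)) := by
    intro ν μ hνμ
    by_contra hne
    let B := Module.Free.chooseBasis ℤ X
    have : B.repr (ν - μ) ≠ 0 := by
      simpa [sub_eq_zero] using hne
    obtain ⟨j, hj⟩ := Finsupp.ne_iff.1 this
    rw [Finsupp.zero_apply] at hj
    obtain ⟨a, ha⟩ := exists_unit_zpow_ne_one (K := K) hj
    let φ : Multiplicative X →* Kˣ :=
      (zpowersHom Kˣ a).comp (AddMonoidHom.toMultiplicative (B.coord j).toAddMonoidHom)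
    have hφ : ∀ κ : X, φ (Multiplicative.ofAdd κ) = a ^ (B.repr κ j) := fun κ => rfl
    have h1 := DFunLike.congr_fun hνμ ((Units.coeHom K).comp φ)
    simp only [MonoidHom.eval_apply_apply, MonoidHom.comp_apply, Units.coeHom_apply] at h1
    have h2 := Units.ext h1
    rw [hφ, hφ] at h2
    apply ha
    rw [map_sub, Finsupp.sub_apply, zpow_sub, h2, mul_inv_cancel]
  have hli := (linearIndependent_monoidHom (Multiplicative X →* K) K).comp _ hinj
  ext ν
  -- Dedekind's theorem concerns scalar coefficients, so the coefficients in V are tested against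
  -- every linear form.
  rw [Finsupp.zero_apply, ← Module.forall_dual_apply_eq_zero_iff K]
  intro ψ
  have := linearIndependent_iff.1 hli (g.mapRange ψ (map_zero ψ)) (by
    ext φ
    have h1 := congrArg ψ (h (AddMonoidAlgebra.lift K K X φ))
    rw [map_zero, Finsupp.sum, map_sum] at h1
    rw [Finsupp.linearCombination_apply, Finsupp.sum_mapRange_index (by simp), Finsupp.sum,
      Finset.sum_apply, Pi.zero_apply, ← h1]
    refine Finset.sum_congr rfl fun κ _ => ?_
    rw [map_smul, charValue, AddMonoidAlgebra.lift_single]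
    simp [mul_comm])
  simpa using DFunLike.congr_fun this ν

theorem charValue_add (μ ν : X) (t : AddMonoidAlgebra K X →ₐ[K] K) :
    charValue (μ + ν) t = charValue μ t * charValue ν t := by
  rw [charValue, charValue, charValue, ← map_mul, AddMonoidAlgebra.single_mul_single, one_mul]

theorem charValue_zero (t : AddMonoidAlgebra K X →ₐ[K] K) : charValue (0 : X) t = 1 := by
  rw [charValue, ← AddMonoidAlgebra.one_def, map_one]

theorem charValue_ne_zero (ν : X) (t : AddMonoidAlgebra K X →ₐ[K] K) : charValue ν t ≠ 0 := by
  intro h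
  have := charValue_add ν (-ν) t
  rw [add_neg_cancel, charValue_zero, h, zero_mul] at this
  exact one_ne_zero this

end Characters

end ClosedTorus

/-! ### The weight decomposition of the coordinate ring under a torus -/

section Convolution

variable {K : Type*} [Field K] {A : Type*} [CommRing A] [HopfAlgebra K A]

/-- This is coassociativity: the form on the right is the convolution product of φ and ψ. -/
theorem rightConv_rightConv (φ ψ : Module.Dual K A) (f : A) :
    rightConv φ (rightConv ψ f) = rightConv (φ ∘ₗ rightConv ψ) f := by
  have h := Coalgebra.coassoc_apply (R := K) f
  have h2 := congrArg (fun w => TensorProduct.rid K A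
    ((TensorProduct.lid K K).toLinearMap.lTensor A ((TensorProduct.map φ ψ).lTensor A w))) h
  refine Eq.trans ?_ (h2.trans ?_)
  · simp only [rightConv, LinearMap.comp_apply, LinearEquiv.coe_coe]
    generalize Coalgebra.comul (R := K) f = w
    induction w with
    | zero => simp
    | add a b ha hb => simp only [map_add, ha, hb]
    | tmul a b =>
      simp only [LinearMap.lTensor_tmul, TensorProduct.rid_tmul, LinearMap.rTensor_tmul, map_smul]
      generalize Coalgebra.comul (R := K) a = v
      induction v with
      | zero => simp
      | add a b ha hb => simp only [map_add, TensorProduct.add_tmul, smul_add, ha, hb]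
      | tmul c d => simp [smul_smul, mul_comm]
  · simp only [rightConv, LinearMap.comp_apply, LinearEquiv.coe_coe]
    generalize Coalgebra.comul (R := K) f = w
    induction w with
    | zero => simp
    | add a b ha hb => simp only [map_add, ha, hb]
    | tmul a b =>
      simp only [LinearMap.lTensor_tmul, TensorProduct.rid_tmul, LinearMap.comp_apply,
        LinearEquiv.coe_coe]
      congr 1
      generalize Coalgebra.comul (R := K) b = v
      induction v with
      | zero => simp
      | add a b ha hb => simp only [map_add, ha, hb]
      | tmul c d => simp [mul_comm]

theorem rightConv_counit (f : A) : rightConv (Coalgebra.counit (R := K)) f = f := by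
  simp [rightConv]

end Convolution

namespace ClosedTorus

variable {K : Type*} [Field K] {A : Type*} [CommRing A] [HopfAlgebra K A]
  {X : Type*} [AddCommGroup X] (T : ClosedTorus K A X)

/-- Restriction of functions to `T`, as a linear map. -/
def resLinear : A →ₗ[K] AddMonoidAlgebra K X := (T.res : A →ₐ[K] AddMonoidAlgebra K X).toLinearMap

theorem resLinear_apply (f : A) : T.resLinear f = T.res f := rfl

theorem counit_res (f : A) : Coalgebra.counit (R := K) (T.res f) = Coalgebra.counit (R := K) f :=
  CoalgHomClass.counit_comp_apply T.res f

theorem res_rightConv (φ : Module.Dual K (AddMonoidAlgebra K X)) (f : A) :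
    T.res (rightConv (φ ∘ₗ T.resLinear) f) = rightConv φ (T.res f) := by
  rw [rightConv, rightConv, LinearMap.comp_apply, LinearMap.comp_apply, LinearMap.comp_apply,
    LinearMap.comp_apply, ← CoalgHomClass.map_comp_comul_apply T.res f]
  generalize Coalgebra.comul (R := K) f = w
  induction w with
  | zero => simp
  | add a b ha hb => simp only [map_add, ha, hb]
  | tmul a b => simp [resLinear_apply]

theorem rightConv_single (φ : Module.Dual K (AddMonoidAlgebra K X)) (μ : X) :
    rightConv φ (AddMonoidAlgebra.single μ 1) =
      φ (AddMonoidAlgebra.single μ 1) • (AddMonoidAlgebra.single μ 1 : AddMonoidAlgebra K X) := by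
  simp [rightConv]

/-- The coaction (id ⊗ res)(Δ f) lies in K[G] ⊗ K[X], so it is a finite sum of terms g(μ) ⊗ μ. The
coefficients g(μ) will be the weight components of f. -/
theorem exists_expansion (f : A) : ∃ g : X →₀ A, ∀ φ : Module.Dual K (AddMonoidAlgebra K X),
    rightConv (φ ∘ₗ T.resLinear) f = g.sum fun μ a => φ (AddMonoidAlgebra.single μ 1) • a := by
  simp only [rightConv, LinearMap.comp_apply, LinearEquiv.coe_coe]
  generalize Coalgebra.comul (R := K) f = w
  induction w with
  | zero => exact ⟨0, by simp⟩
  | add a b ha hb =>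
    obtain ⟨g, hg⟩ := ha
    obtain ⟨g', hg'⟩ := hb
    refine ⟨g + g', fun φ => ?_⟩
    rw [map_add, map_add, hg, hg', Finsupp.sum_add_index' (by simp) (by simp)]
  | tmul a b =>
    refine ⟨(T.res b).coeff.mapRange (fun c => c • a) (by simp), fun φ => ?_⟩
    rw [Finsupp.sum_mapRange_index (by simp), LinearMap.lTensor_tmul, TensorProduct.rid_tmul,
      LinearMap.comp_apply, resLinear_apply]
    conv_lhs => rw [← AddMonoidAlgebra.sum_coeff_single (T.res b)]
    rw [Finsupp.sum, map_sum, Finset.sum_smul, Finsupp.sum]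
    refine Finset.sum_congr rfl fun κ _ => ?_
    rw [smul_smul]
    congr 1
    have : AddMonoidAlgebra.single κ ((T.res b).coeff κ) =
        (T.res b).coeff κ • (AddMonoidAlgebra.single κ 1 : AddMonoidAlgebra K X) := by
      rw [AddMonoidAlgebra.smul_single, smul_eq_mul, mul_one]
    rw [this, map_smul, smul_eq_mul, mul_comm]

theorem rightTranslate_point (t : AddMonoidAlgebra K X →ₐ[K] K) (f : A) :
    rightTranslate (T.point t) f = rightConv (t.toLinearMap ∘ₗ T.resLinear) f :=
  rightTranslate_eq_rightConv _ _

/-- The functions on `G` of weight `μ` under right translation by `T`. -/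
def funWeight (μ : X) : Submodule K A where
  carrier := {f | ∀ t : AddMonoidAlgebra K X →ₐ[K] K,
    rightTranslate (T.point t) f = charValue μ t • f}
  add_mem' := fun ha hb t => by rw [map_add, ha t, hb t, smul_add]
  zero_mem' := fun t => by rw [map_zero, smul_zero]
  smul_mem' := fun c f hf t => by rw [map_smul, hf t, smul_comm]

theorem mul_mem_funWeight {μ ν : X} {f g : A} (hf : f ∈ T.funWeight μ) (hg : g ∈ T.funWeight ν) :
    f * g ∈ T.funWeight (μ + ν) := fun t => by
  rw [map_mul, hf t, hg t, charValue_add, smul_mul_smul_comm]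

variable [IsAlgClosed K] [Module.Free ℤ X]

/-- Translate f by t and then by s, in two ways: by the expansion for the product of the points, and
by translating each coefficient by s. Independence of characters in the variable t lets one compare
coefficients. -/
theorem expansion_mem {f : A} {g : X →₀ A} (hg : ∀ φ : Module.Dual K (AddMonoidAlgebra K X),
    rightConv (φ ∘ₗ T.resLinear) f = g.sum fun μ a => φ (AddMonoidAlgebra.single μ 1) • a) (μ : X) :
    g μ ∈ T.funWeight μ := by
  intro s
  have key : ∀ t : AddMonoidAlgebra K X →ₐ[K] K,
      (g.sum fun κ a => charValue κ t • (rightTranslate (T.point s) a - charValue κ s • a)) = 0 := by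
    intro t
    have h1 : rightTranslate (T.point s) (rightTranslate (T.point t) f) =
        g.sum fun κ a => (charValue κ t * charValue κ s) • a := by
      rw [rightTranslate_point, rightTranslate_point, rightConv_rightConv]
      have : (s.toLinearMap ∘ₗ T.resLinear) ∘ₗ rightConv (t.toLinearMap ∘ₗ T.resLinear) =
          (s.toLinearMap ∘ₗ rightConv t.toLinearMap) ∘ₗ T.resLinear := by
        ext a
        simp only [LinearMap.comp_apply, resLinear_apply, res_rightConv]
      rw [this, hg]
      refine Finsupp.sum_congr fun κ _ => ?_
      rw [LinearMap.comp_apply, rightConv_single, map_smul, smul_eq_mul]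
      rfl
    rw [rightTranslate_point T t, hg, Finsupp.sum, map_sum] at h1
    rw [Finsupp.sum] at h1 ⊢
    rw [← sub_eq_zero, ← Finset.sum_sub_distrib] at h1
    rw [← h1]
    refine Finset.sum_congr rfl fun κ _ => ?_
    rw [smul_sub, map_smul, smul_smul]
    rfl
  have h2 := eq_zero_of_sum_charValue (K := K) (Finsupp.onFinset g.support
    (fun κ => rightTranslate (T.point s) (g κ) - charValue κ s • g κ) (fun κ h => by
      rw [Finsupp.mem_support_iff]
      rintro h0
      rw [h0, map_zero, smul_zero, sub_zero] at h
      exact h rfl)) (fun t => by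
      rw [Finsupp.onFinset_sum _ (fun κ => by simp), ← key t]
      rfl)
  exact sub_eq_zero.1 (DFunLike.congr_fun h2 μ)

/-- Weight functions are defined by the K-points of T alone. As characters are independent on
points, the whole coaction of such an f is f ⊗ μ, which also covers forms φ that are not points,
such as tangent vectors. -/
theorem rightConv_of_mem_funWeight {μ : X} {f : A} (hf : f ∈ T.funWeight μ)
    (φ : Module.Dual K (AddMonoidAlgebra K X)) :
    rightConv (φ ∘ₗ T.resLinear) f = φ (AddMonoidAlgebra.single μ 1) • f := by
  obtain ⟨g, hg⟩ := T.exists_expansion f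
  have : g = Finsupp.single μ f := by
    rw [← sub_eq_zero]
    refine eq_zero_of_sum_charValue (K := K) _ fun t => ?_
    have h1 := hg t.toLinearMap
    rw [← rightTranslate_point, hf t] at h1
    rw [Finsupp.sum_sub_index (by simp [smul_sub]), Finsupp.sum_single_index (by simp), h1]
    exact sub_self _
  rw [hg, this, Finsupp.sum_single_index (by simp)]

/-- The counit takes the value 1 on every character, so the coefficients of the expansion of f add
up to f. -/
theorem iSup_funWeight : ⨆ μ, T.funWeight μ = ⊤ := by
  rw [eq_top_iff]
  intro f _
  obtain ⟨g, hg⟩ := T.exists_expansion f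
  have h1 := hg Coalgebra.counit
  have : Coalgebra.counit (R := K) ∘ₗ T.resLinear = Coalgebra.counit (R := K) (A := A) := by
    ext a
    exact T.counit_res a
  rw [this, rightConv_counit] at h1
  rw [h1]
  exact Submodule.sum_mem _ fun μ _ => Submodule.smul_mem _ _
    (Submodule.mem_iSup_of_mem μ (T.expansion_mem hg μ))

/-- Lift the character μ to G and take the weight component of weight μ, cut out by the coefficient
form of μ. -/
theorem exists_mem_funWeight_res (μ : X) :
    ∃ f ∈ T.funWeight μ, T.res f = AddMonoidAlgebra.single μ 1 := by
  classical
  obtain ⟨f, hf⟩ := T.surjective (AddMonoidAlgebra.single μ 1)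
  obtain ⟨g, hg⟩ := T.exists_expansion f
  let φ : Module.Dual K (AddMonoidAlgebra K X) :=
    { toFun := fun a => a.coeff μ
      map_add' := fun a b => by simp
      map_smul' := fun c a => by simp }
  have hφ : ∀ κ, φ (AddMonoidAlgebra.single κ 1) = if κ = μ then 1 else 0 := fun κ => by
    change (AddMonoidAlgebra.single κ (1 : K)).coeff μ = _
    rw [AddMonoidAlgebra.coeff_single, Finsupp.single_apply]
  have h1 := hg φ
  have h2 : (g.sum fun κ a => φ (AddMonoidAlgebra.single κ 1) • a) = g μ := by
    simp only [hφ]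
    simp only [Finsupp.sum, ite_smul, one_smul, zero_smul, Finset.sum_ite_eq',
      Finsupp.mem_support_iff]
    split_ifs with h
    · rfl
    · exact (not_not.1 h).symm
  refine ⟨g μ, T.expansion_mem hg μ, ?_⟩
  rw [← h2, ← h1, res_rightConv, hf, rightConv_single, hφ, if_pos rfl, one_smul]

/-- Two left invariant derivations which agree on weight functions are equal. -/
theorem lie_ext_funWeight {x y : Lie K A}
    (h : ∀ μ, ∀ f ∈ T.funWeight μ, (x : Derivation K A A) f = (y : Derivation K A A) f) :
    x = y := by
  refine Subtype.ext (Derivation.ext fun f => ?_)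
  have hf : f ∈ ⨆ μ, T.funWeight μ := by rw [iSup_funWeight]; trivial
  induction hf using Submodule.iSup_induction' with
  | mem μ f hf => exact h μ f hf
  | zero => rw [map_zero, map_zero]
  | add a b _ _ ha hb => rw [map_add, map_add, ha, hb]

end ClosedTorus

/-! ### The weight decomposition of the Lie algebra -/

namespace ClosedTorus

variable {K : Type*} [Field K] {A : Type*} [CommRing A] [HopfAlgebra K A]
  {X : Type*} [AddCommGroup X] (T : ClosedTorus K A X)

theorem apply_mem_funWeight {μ ν : X} {x : Lie K A} (hx : x ∈ T.weightSpace ν) {f : A}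
    (hf : f ∈ T.funWeight μ) : (x : Derivation K A A) f ∈ T.funWeight (μ + ν) := fun t => by
  have h := hx t f
  rw [hf t] at h
  rw [h, charValue_add]
  change (charValue ν t • (x : Derivation K A A)) (charValue μ t • f) = _
  rw [Derivation.smul_apply, Derivation.map_smul, smul_smul, mul_comm]

section PPow

variable (p : ℕ) [Fact p.Prime] [CharP K p]

theorem pPow_apply (x : Lie K A) (f : A) : ((pPow p x : Lie K A) : Derivation K A A) f =
    (((x : Derivation K A A) : A →ₗ[K] A) ^ p : Module.End K A) f := rfl

theorem pPow_mem_lie {h : Lie K A} (hh : h ∈ T.lie) : pPow p h ∈ T.lie := fun f hf => by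
  rw [pPow_apply]
  generalize p = n
  induction n with
  | zero => simpa using hf
  | succ n ih =>
    rw [pow_succ', Module.End.mul_apply]
    exact hh _ ih

end PPow

variable [IsAlgClosed K] [Module.Free ℤ X]

theorem mem_weightSpace_of_funWeight {ν : X} {x : Lie K A}
    (h : ∀ μ, ∀ f ∈ T.funWeight μ, (x : Derivation K A A) f ∈ T.funWeight (μ + ν)) :
    x ∈ T.weightSpace ν := fun t f => by
  change _ = charValue ν t • (x : Derivation K A A) (rightTranslate (T.point t) f)
  have hf : f ∈ ⨆ μ, T.funWeight μ := by rw [iSup_funWeight]; trivial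
  induction hf using Submodule.iSup_induction' with
  | mem μ f hf => rw [h μ f hf t, hf t, Derivation.map_smul, charValue_add, smul_smul, mul_comm]
  | zero => simp only [map_zero, smul_zero]
  | add a b _ _ ha hb => rw [map_add, map_add, ha, hb, map_add, map_add, smul_add]

/-- Since h preserves the ideal of T, its tangent vector factors through restriction to T. So h is
convolution with a form on K[X], which acts on functions of weight μ by a scalar. -/
theorem cartan_apply {μ : X} (h : T.lie) {f : A} (hf : f ∈ T.funWeight μ) :
    ((h : Lie K A) : Derivation K A A) f = T.differential μ h • f := by
  set δ : Module.Dual K A := Coalgebra.counit ∘ₗ (((h : Lie K A) : Derivation K A A) : A →ₗ[K] A)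
    with hδ
  have hker : ∀ a b, T.res a = T.res b → δ a = δ b := by
    intro a b hab
    rw [← sub_eq_zero, ← map_sub] at hab ⊢
    have h1 := h.2 _ hab
    rw [hδ, LinearMap.comp_apply, ← T.counit_res, Derivation.coeFn_coe, h1, map_zero]
  obtain ⟨s, hs⟩ := T.resLinear.exists_rightInverse_of_surjective
    (LinearMap.range_eq_top.2 T.surjective)
  have hs' : ∀ a, T.res (s a) = a := fun a => LinearMap.congr_fun hs a
  have hφ : (δ ∘ₗ s) ∘ₗ T.resLinear = δ := by
    ext a
    exact hker _ _ (hs' _)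
  rw [derivation_eq_rightConv, ← hδ, ← hφ, T.rightConv_of_mem_funWeight hf]
  congr 1
  exact hker _ _ ((hs' _).trans (Function.surjInv_eq T.surjective _).symm)

theorem exists_funWeight_ne_zero (μ : X) : ∃ f ∈ T.funWeight μ, f ≠ 0 := by
  obtain ⟨f, hf, h⟩ := T.exists_mem_funWeight_res μ
  refine ⟨f, hf, ?_⟩
  rintro rfl
  rw [map_zero, eq_comm, AddMonoidAlgebra.single_eq_zero] at h
  exact one_ne_zero h

theorem differential_eq_of_apply {μ : X} {h : T.lie} {c : K}
    (hc : ∀ f ∈ T.funWeight μ, ((h : Lie K A) : Derivation K A A) f = c • f) :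
    T.differential μ h = c := by
  obtain ⟨f, hf, h0⟩ := T.exists_funWeight_ne_zero μ
  have h1 := hc f hf
  rw [T.cartan_apply h hf] at h1
  exact smul_left_injective K h0 h1

/-- Apply the Leibniz rule to a product of weight functions restricting to the characters μ and ν;
the product is nonzero because its restriction to T is a character. -/
theorem differential_add (μ ν : X) :
    T.differential (μ + ν) = T.differential μ + T.differential ν := by
  ext h
  obtain ⟨f, hf, hf'⟩ := T.exists_mem_funWeight_res μ
  obtain ⟨g, hg, hg'⟩ := T.exists_mem_funWeight_res ν
  have h1 := T.cartan_apply h (T.mul_mem_funWeight hf hg)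
  rw [Derivation.leibniz, T.cartan_apply h hf, T.cartan_apply h hg] at h1
  have h0 : f * g ≠ 0 := by
    intro h0
    have := congrArg T.res h0
    rw [map_mul, hf', hg', AddMonoidAlgebra.single_mul_single, map_zero, mul_one,
      AddMonoidAlgebra.single_eq_zero] at this
    exact one_ne_zero this
  refine smul_left_injective K h0 (h1.symm.trans ?_)
  simp only [LinearMap.add_apply, smul_eq_mul, add_smul, mul_smul_comm, mul_comm g f]
  rw [add_comm]

/-- The differential of characters as an additive map. -/
def differentialHom : X →+ Module.Dual K T.lie := AddMonoidHom.mk' T.differential T.differential_add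

theorem differentialHom_apply (μ : X) : T.differentialHom μ = T.differential μ := rfl

theorem lie_le_weightSpace_zero : T.lie ≤ T.weightSpace 0 := fun h hh =>
  T.mem_weightSpace_of_funWeight fun μ f hf => by
    rw [T.cartan_apply ⟨h, hh⟩ hf, add_zero]
    exact Submodule.smul_mem _ _ hf

theorem lie_mem_weightSpace {μ ν : X} {x y : Lie K A} (hx : x ∈ T.weightSpace μ)
    (hy : y ∈ T.weightSpace ν) : ⁅x, y⁆ ∈ T.weightSpace (μ + ν) :=
  T.mem_weightSpace_of_funWeight fun κ f hf => by
    change (⁅(x : Derivation K A A), (y : Derivation K A A)⁆ : Derivation K A A) f ∈ _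
    rw [Derivation.commutator_apply]
    refine Submodule.sub_mem _ ?_ ?_
    · have := T.apply_mem_funWeight hx (T.apply_mem_funWeight hy hf)
      rwa [add_assoc, add_comm ν] at this
    · have := T.apply_mem_funWeight hy (T.apply_mem_funWeight hx hf)
      rwa [add_assoc] at this

theorem cartan_lie (h : T.lie) {ν : X} {x : Lie K A} (hx : x ∈ T.weightSpace ν) :
    ⁅(h : Lie K A), x⁆ = T.differential ν h • x :=
  T.lie_ext_funWeight fun μ f hf => by
    change (⁅((h : Lie K A) : Derivation K A A), (x : Derivation K A A)⁆ : Derivation K A A) f =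
      T.differential ν h • (x : Derivation K A A) f
    rw [Derivation.commutator_apply, T.cartan_apply h hf,
      T.cartan_apply h (T.apply_mem_funWeight hx hf), Derivation.map_smul, differential_add,
      LinearMap.add_apply, add_smul, add_sub_cancel_left]

section PPow

variable (p : ℕ) [Fact p.Prime] [CharP K p]

theorem pPow_mem_weightSpace {ν : X} {x : Lie K A} (hx : x ∈ T.weightSpace ν) :
    pPow p x ∈ T.weightSpace (p • ν) :=
  T.mem_weightSpace_of_funWeight fun μ f hf => by
    rw [pPow_apply]
    have : ∀ n : ℕ, ((((x : Derivation K A A) : A →ₗ[K] A) ^ n : Module.End K A)) f ∈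
        T.funWeight (μ + n • ν) := by
      intro n
      induction n with
      | zero => simpa using hf
      | succ n ih =>
        rw [pow_succ', Module.End.mul_apply, succ_nsmul, ← add_assoc]
        exact T.apply_mem_funWeight hx ih
    exact this p

theorem differential_pPow (h : T.lie) (ν : X) :
    T.differential ν ⟨pPow p h, T.pPow_mem_lie p h.2⟩ = T.differential ν h ^ p :=
  T.differential_eq_of_apply fun f hf => by
    rw [pPow_apply]
    generalize p = n
    induction n with
    | zero => simp
    | succ n ih =>
      rw [pow_succ', Module.End.mul_apply, ih, map_smul, Derivation.coeFn_coe, T.cartan_apply h hf,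
        smul_smul, pow_succ]

end PPow

/-- Vectors of different weights are linearly independent. -/
theorem eq_zero_of_sum_weightSpace (g : X →₀ Lie K A) (hg : ∀ ν, g ν ∈ T.weightSpace ν)
    (h : (g.sum fun _ x => x) = 0) : g = 0 := by
  ext1 ν
  refine T.lie_ext_funWeight fun μ f hf => ?_
  have h1 := eq_zero_of_sum_charValue (K := K)
    (g.mapRange (fun x : Lie K A => (x : Derivation K A A) f) rfl) (fun t => by
      rw [Finsupp.sum_mapRange_index (by simp)]
      have h2 : ((g.sum fun _ x => x : Lie K A) : Derivation K A A) f = 0 := by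
        rw [h]
        rfl
      have h3 : (g.sum fun _ x => (x : Derivation K A A) f) = 0 := by
        rw [← h2, Finsupp.sum, Finsupp.sum, AddSubmonoidClass.coe_finsetSum,
          ← Derivation.coeFnAddMonoidHom_apply, map_sum,
          Finset.sum_apply]
        rfl
      have h4 := congrArg (rightTranslate (T.point t)) h3
      rw [map_zero, Finsupp.sum, map_sum] at h4
      have h5 : charValue μ t • (g.sum fun κ x => charValue κ t • (x : Derivation K A A) f) = 0 := by
        rw [← h4, Finsupp.sum, Finset.smul_sum]
        refine Finset.sum_congr rfl fun κ _ => ?_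
        rw [T.apply_mem_funWeight (hg κ) hf t, charValue_add, smul_smul]
      exact (smul_eq_zero.1 h5).resolve_left (charValue_ne_zero _ _))
  exact DFunLike.congr_fun h1 ν

/-- An element of 𝔱 acts on weight functions through the dμ, so it is determined by the values of dμ
for μ in a finite basis of X. -/
theorem finiteDimensional_lie [Module.Finite ℤ X] : FiniteDimensional K T.lie := by
  let B := Module.Free.chooseBasis ℤ X
  let F : T.lie →ₗ[K] (Module.Free.ChooseBasisIndex ℤ X → K) :=
    LinearMap.pi fun i => T.differential (B i)
  refine FiniteDimensional.of_injective F ?_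
  rw [injective_iff_map_eq_zero]
  intro h hh
  have h0 : ∀ μ, T.differential μ h = 0 := by
    intro μ
    have h1 : ((LinearMap.applyₗ h).toAddMonoidHom.comp T.differentialHom).toIntLinearMap = 0 :=
      B.ext fun i => congrFun hh i
    exact LinearMap.congr_fun h1 μ
  refine Subtype.ext (T.lie_ext_funWeight fun μ f hf => ?_)
  rw [T.cartan_apply h hf, h0, zero_smul]
  rfl

end ClosedTorus

/-! ### Heights -/

section Height

theorem isAddTorsionFree_of_free (X : Type*) [AddCommGroup X] [Module.Free ℤ X] :
    IsAddTorsionFree X where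
  nsmul_right_injective n hn x y hxy := by
    have h : (n : ℤ) • x = (n : ℤ) • y := by simpa using hxy
    have B := Module.Free.chooseBasis ℤ X
    refine B.ext_elem fun i => ?_
    have h1 := DFunLike.congr_fun (congrArg B.repr h) i
    simp only [map_smul, Finsupp.smul_apply, smul_eq_mul] at h1
    exact mul_left_cancel₀ (by exact_mod_cast hn) h1

/-- Embed X in a rational vector space, where the family stays independent and a prescribed linear
form extends. Values lie in ℚ because the family need not be part of a ℤ-basis of X. -/
theorem exists_addMonoidHom_eq_one {X : Type*} [AddCommGroup X] [Module.Free ℤ X] {σ : Type*}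
    {v : σ → X} (hv : LinearIndependent ℤ v) : ∃ ht : X →+ ℚ, ∀ s, ht (v s) = 1 := by
  let B := Module.Free.chooseBasis ℤ X
  let F : X →ₗ[ℤ] (Module.Free.ChooseBasisIndex ℤ X →₀ ℚ) :=
    Finsupp.mapRange.linearMap (Int.castAddHom ℚ).toIntLinearMap ∘ₗ B.repr.toLinearMap
  have hF : Function.Injective F := by
    refine Function.Injective.comp (g := Finsupp.mapRange.linearMap _) ?_ B.repr.injective
    exact Finsupp.mapRange_injective _ (map_zero _) Int.cast_injective
  have h1 : LinearIndependent ℚ (F ∘ v) :=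
    (LinearIndependent.iff_fractionRing ℤ ℚ).1 (hv.map' F (LinearMap.ker_eq_bot.2 hF))
  obtain ⟨g, hg⟩ := LinearMap.exists_extend ((Module.Basis.span h1).constr ℚ fun _ => (1 : ℚ))
  refine ⟨g.toAddMonoidHom.comp F.toAddMonoidHom, fun s => ?_⟩
  have h2 := LinearMap.congr_fun hg (Module.Basis.span h1 s)
  rw [Module.Basis.constr_basis, LinearMap.comp_apply, Submodule.subtype_apply,
    Module.Basis.span_apply] at h2
  exact h2

theorem exists_height {X Y ι : Type*} [AddCommGroup X] [Module.Free ℤ X] [AddCommGroup Y]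
    {P : RootDatum ι X Y} (b : P.Base) :
    ∃ ht : X →+ ℚ, ∀ i, ht (P.root i) = b.height i := by
  obtain ⟨ht, hht⟩ := exists_addMonoidHom_eq_one b.linearIndepOn_root
  refine ⟨ht, fun i => ?_⟩
  obtain ⟨f, -, -, hf⟩ := b.exists_root_eq_sum_int i
  rw [RootPairing.Base.height_eq_sum hf, hf, map_sum, Int.cast_sum]
  refine Finset.sum_congr rfl fun j hj => ?_
  rw [map_zsmul, hht ⟨j, hj⟩]
  simp

end Height

/-! ### Triangular decomposition -/

namespace ClosedTorus

variable {K : Type*} [Field K] {A : Type*} [CommRing A] [HopfAlgebra K A]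
  {X : Type*} [AddCommGroup X] (T : ClosedTorus K A X)
  {ι Y : Type*} [AddCommGroup Y] {P : RootDatum ι X Y}

/-- Root vectors `e_γ ∈ 𝔤_γ` and `f_γ ∈ 𝔤_{-γ}` for the positive roots `γ`, which together with
`𝔱` decompose `𝔤`, and an additive height function. -/
structure TriangularData (p : ℕ) [Fact p.Prime] [CharP K p] (b : P.Base) (D : ℕ) where
  γ : Fin D ≃ {i : ι // b.IsPos i}
  r : ℕ
  h : Module.Basis (Fin r) K T.lie
  e : Fin D → Lie K A
  f : Fin D → Lie K A
  ht : X →+ ℚ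
  e_mem : ∀ j, e j ∈ T.weightSpace (P.root (γ j))
  f_mem : ∀ j, f j ∈ T.weightSpace (-P.root (γ j))
  ht_pos : ∀ j, 0 < ht (P.root (γ j))
  pPow_e : ∀ j, pPow p (e j) = 0
  pPow_f : ∀ j, pPow p (f j) = 0
  mem_weightSpace : ∀ ν, ∀ x ∈ T.weightSpace ν, x = 0 ∨ (ν = 0 ∧ x ∈ T.lie) ∨
    (∃ j, ν = P.root (γ j) ∧ ∃ c : K, x = c • e j) ∨ ∃ j, ν = -P.root (γ j) ∧ ∃ c : K, x = c • f j
  linearIndependent : LinearIndependent K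
    (Sum.elim f (Sum.elim (fun k => (h k : Lie K A)) e))
  iSup_weightSpace : ⨆ ν, T.weightSpace ν = ⊤

theorem exists_eq_sum [Finite ι] {e : ι → Lie K A} (he : T.IsChevalleySystem P e) (x : Lie K A) :
    ∃ h ∈ T.lie, ∃ c : ι →₀ K, x = h + c.sum fun i a => a • e i := by
  have hx : x ∈ T.lie ⊔ Submodule.span K (Set.range e) := by rw [he.span]; trivial
  obtain ⟨h, hh, y, hy, rfl⟩ := Submodule.mem_sup.1 hx
  obtain ⟨c, rfl⟩ := (Finsupp.mem_span_range_iff_exists_finsupp).1 hy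
  exact ⟨h, hh, c, rfl⟩

theorem root_ne_zero (hP : T.IsRootDatum P) (i : ι) : P.root i ≠ 0 := by
  have : P.root i ∈ Set.range P.root := ⟨i, rfl⟩
  rw [hP.range_root] at this
  exact this.1

variable [IsAlgClosed K] [Module.Free ℤ X]

/-- Any relation splits into its weight components, so it is enough to exclude relations among
vectors of one weight. -/
theorem linearIndependent_of_weights {σ : Type*} [Fintype σ] (x : σ → Lie K A) (w : σ → X)
    (hx : ∀ s, x s ∈ T.weightSpace (w s))
    (h : ∀ ν (c : σ → K), (∀ s, w s ≠ ν → c s = 0) → ∑ s, c s • x s = 0 → ∀ s, c s = 0) :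
    LinearIndependent K x := by
  classical
  rw [Fintype.linearIndependent_iff]
  intro c hc s
  let g : X →₀ Lie K A := ∑ s, Finsupp.single (w s) (c s • x s)
  have hg0 : g = 0 := by
    refine T.eq_zero_of_sum_weightSpace g (fun ν => ?_) ?_
    · rw [Finsupp.finsetSum_apply]
      refine Submodule.sum_mem _ fun s _ => ?_
      rw [Finsupp.single_apply]
      split_ifs with hs
      · exact hs ▸ Submodule.smul_mem _ _ (hx s)
      · exact Submodule.zero_mem _
    · rw [← Finsupp.sum_finsetSum_index (by simp) (by simp), ← hc]
      exact Finset.sum_congr rfl fun s _ => Finsupp.sum_single_index rfl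
  have h1 := DFunLike.congr_fun hg0 (w s)
  rw [Finsupp.finsetSum_apply, Finsupp.zero_apply] at h1
  have h2 := h (w s) (fun s' => if w s' = w s then c s' else 0) (fun s' hs' => if_neg hs') (by
    rw [← h1]
    refine Finset.sum_congr rfl fun s' _ => ?_
    rw [Finsupp.single_apply, ite_smul, zero_smul]) s
  simpa using h2

/-- The vector x^[p] has weight pα. This is nonzero because X is torsion-free and not a root because
the root system is reduced, so its weight space vanishes. -/
theorem pPow_rootVector (p : ℕ) [Fact p.Prime] [CharP K p] (hP : T.IsRootDatum P)
    {x : Lie K A} {i : ι} (hx : x ∈ T.weightSpace (P.root i)) : pPow p x = 0 := by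
  have := isAddTorsionFree_of_free X
  have := hP.reduced
  have hp := (Fact.out : p.Prime)
  by_contra h0
  have h1 := T.pPow_mem_weightSpace p hx
  have : p.AtLeastTwo := ⟨hp.two_le⟩
  apply RootPairing.nsmul_notMem_range_root P (n := p) (i := i)
  rw [hP.range_root]
  refine ⟨?_, fun h => h0 ?_⟩
  · rw [Ne, smul_eq_zero_iff_right hp.ne_zero]
    exact T.root_ne_zero hP i
  · exact (Submodule.mem_bot K).1 (h ▸ h1)

section Chevalley

variable [Finite ι]

/-- Expand x in 𝔱 and the root vectors and compare weight components. In weight ν only 𝔱 (for ν = 0)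
or a single root vector contributes, as distinct indices have distinct nonzero roots. -/
theorem mem_weightSpace_cases (hP : T.IsRootDatum P) {e : ι → Lie K A}
    (he : T.IsChevalleySystem P e) {ν : X} {x : Lie K A} (hx : x ∈ T.weightSpace ν) :
    x = 0 ∨ (ν = 0 ∧ x ∈ T.lie) ∨ ∃ i, ν = P.root i ∧ ∃ c : K, x = c • e i := by
  classical
  by_cases h0 : x = 0
  · exact Or.inl h0
  right
  obtain ⟨h, hh, c, hc⟩ := T.exists_eq_sum he x
  let g : X →₀ Lie K A := Finsupp.single 0 h +
    (c.sum fun i a => Finsupp.single (P.root i) (a • e i)) - Finsupp.single ν x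
  have hs : ∀ (μ κ : X) (y : Lie K A), y ∈ T.weightSpace μ →
      Finsupp.single μ y κ ∈ T.weightSpace κ := fun μ κ y hy => by
    rw [Finsupp.single_apply]
    split_ifs with hs
    · exact hs ▸ hy
    · exact Submodule.zero_mem _
  have hg0 : g = 0 := by
    refine T.eq_zero_of_sum_weightSpace g (fun κ => ?_) ?_
    · rw [Finsupp.sub_apply, Finsupp.add_apply, Finsupp.sum, Finsupp.finsetSum_apply]
      refine Submodule.sub_mem _ (Submodule.add_mem _ (hs _ _ _ (T.lie_le_weightSpace_zero hh))
        (Submodule.sum_mem _ fun i _ => hs _ _ _ (Submodule.smul_mem _ _ (he.mem i)))) (hs _ _ _ hx)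
    · rw [Finsupp.sum_sub_index (by simp), Finsupp.sum_add_index' (by simp) (by simp),
        Finsupp.sum_single_index rfl, Finsupp.sum_single_index rfl,
        Finsupp.sum_sum_index (by simp) (by simp)]
      simp only [Finsupp.sum_single_index]
      rw [← hc, sub_self]
  have h1 := DFunLike.congr_fun hg0 ν
  rw [Finsupp.sub_apply, Finsupp.add_apply, Finsupp.single_eq_same, Finsupp.zero_apply,
    Finsupp.sum, Finsupp.finsetSum_apply, sub_eq_zero] at h1
  by_cases hν : ν = 0
  · refine Or.inl ⟨hν, ?_⟩
    subst hν
    rw [Finsupp.single_eq_same, Finset.sum_eq_zero, add_zero] at h1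
    · rwa [← h1]
    · intro i _
      rw [Finsupp.single_apply, if_neg (T.root_ne_zero hP i)]
  · right
    rw [Finsupp.single_apply, if_neg (Ne.symm hν), zero_add] at h1
    by_cases hi : ∃ i, P.root i = ν
    · obtain ⟨i, rfl⟩ := hi
      refine ⟨i, rfl, c i, ?_⟩
      rw [← h1, Finset.sum_eq_single i]
      · rw [Finsupp.single_eq_same]
      · intro j _ hj
        rw [Finsupp.single_apply, if_neg (fun h => hj (P.root.injective h))]
      · intro hi
        rw [Finsupp.notMem_support_iff.1 hi, zero_smul, Finsupp.single_zero, Finsupp.zero_apply]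
    · push Not at hi
      refine absurd ?_ h0
      rw [← h1]
      exact Finset.sum_eq_zero fun i _ => by rw [Finsupp.single_apply, if_neg (hi i)]

theorem exists_triangularData (p : ℕ) [Fact p.Prime] [CharP K p] [Module.Finite ℤ X]
    (hP : T.IsRootDatum P) (b : P.Base)
    {e : ι → Lie K A} (he : T.IsChevalleySystem P e) {D : ℕ} (γ : Fin D ≃ {i : ι // b.IsPos i}) :
    ∃ d : T.TriangularData p b D, d.γ = γ ∧
      ∀ j, ∃ i, P.root i = -P.root (γ j) ∧ d.f j = e i := by
  classical
  let := P.indexNeg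
  have hneg : ∀ i, P.root (-i) = -P.root i := fun i => by simp
  obtain ⟨ht, hht⟩ := exists_height b
  have := T.finiteDimensional_lie
  refine ⟨
    { γ := γ
      r := _
      h := Module.finBasis K T.lie
      e := fun j => e (γ j)
      f := fun j => e (-(γ j).1)
      ht := ht
      e_mem := ?_
      f_mem := ?_
      ht_pos := ?_
      pPow_e := ?_
      pPow_f := ?_
      mem_weightSpace := ?_
      linearIndependent := ?_
      iSup_weightSpace := ?_ }, rfl, ?_⟩
  · exact fun j => he.mem _
  · exact fun j => hneg (γ j) ▸ he.mem _
  · intro j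
    rw [hht]
    exact_mod_cast (γ j).2
  · exact fun j => T.pPow_rootVector p hP (he.mem _)
  · exact fun j => T.pPow_rootVector p hP (he.mem _)
  · intro ν x hx
    rcases T.mem_weightSpace_cases hP he hx with h | h | ⟨i, rfl, c, rfl⟩
    · exact Or.inl h
    · exact Or.inr (Or.inl h)
    · rcases RootPairing.Base.IsPos.or_neg b i with hi | hi
      · refine Or.inr (Or.inr (Or.inl ⟨γ.symm ⟨i, hi⟩, ?_, c, ?_⟩)) <;> simp
      · refine Or.inr (Or.inr (Or.inr ⟨γ.symm ⟨-i, hi⟩, ?_, c, ?_⟩))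
        · rw [Equiv.apply_symm_apply, hneg, neg_neg]
        · rw [Equiv.apply_symm_apply, neg_neg]
  · have hw : ∀ s, (Sum.elim (fun j => e (-(γ j).1)) (Sum.elim
        (fun k => (Module.finBasis K T.lie k : Lie K A)) (fun j => e (γ j)))) s ∈
        T.weightSpace ((Sum.elim (fun j => P.root (-(γ j).1)) (Sum.elim (fun _ => 0)
          (fun j => P.root (γ j)))) s) := by
      rintro (j | k | j)
      · exact he.mem _
      · exact T.lie_le_weightSpace_zero (Module.finBasis K T.lie k).2
      · exact he.mem _
    refine T.linearIndependent_of_weights _ _ hw fun ν c hc hs => ?_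
    -- Negative and positive roots have heights of opposite sign.
    have h2 : ∀ i j, P.root (-(γ i).1) ≠ P.root (γ j) := by
      intro i j h
      have h1 := congrArg ht h
      rw [hneg, map_neg, hht, hht] at h1
      have h3 : 0 < b.height (γ i) := (γ i).2
      have h4 : 0 < b.height (γ j) := (γ j).2
      have : (-(b.height (γ i) : ℚ)) < 0 := by
        rw [neg_lt_zero]
        exact_mod_cast h3
      rw [h1] at this
      exact absurd (by exact_mod_cast h4) (not_lt.2 this.le)
    by_cases hν : ν = 0
    · subst hν
      have hf : ∀ j, c (Sum.inl j) = 0 := fun j => hc _ (T.root_ne_zero hP _)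
      have he' : ∀ j, c (Sum.inr (Sum.inr j)) = 0 := fun j => hc _ (T.root_ne_zero hP _)
      rw [Fintype.sum_sum_type, Fintype.sum_sum_type] at hs
      simp only [Sum.elim_inl, Sum.elim_inr, hf, he', zero_smul, Finset.sum_const_zero, zero_add,
        add_zero] at hs
      have h5 := Fintype.linearIndependent_iff.1 (Module.finBasis K T.lie).linearIndependent
        (fun k => c (Sum.inr (Sum.inl k))) (Subtype.ext (by
          rw [AddSubmonoidClass.coe_finsetSum]
          exact hs))
      rintro (j | k | j)
      · exact hf j
      · exact h5 k
      · exact he' j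
    -- For ν ≠ 0 at most one vector of the family has weight ν, so the relation has a single nonzero
    -- term.
    · by_cases hex : ∃ s, c s ≠ 0
      · obtain ⟨s, hs0⟩ := hex
        have huniq : ∀ s', s' ≠ s → c s' = 0 := by
          intro s' hs'
          by_contra hne
          have e1 := not_imp_comm.1 (hc s) hs0
          have e2 := not_imp_comm.1 (hc s') hne
          rcases s with j | k | j <;> rcases s' with j' | k' | j' <;>
            simp only [Sum.elim_inl, Sum.elim_inr] at e1 e2
          · rw [← e1, EmbeddingLike.apply_eq_iff_eq, neg_inj, ← Subtype.ext_iff,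
              EmbeddingLike.apply_eq_iff_eq] at e2
            exact hs' (by rw [e2])
          · exact hν e2.symm
          · exact h2 _ _ (e1.trans e2.symm)
          · exact hν e1.symm
          · exact hν e1.symm
          · exact hν e1.symm
          · exact h2 _ _ (e2.trans e1.symm)
          · exact hν e2.symm
          · rw [← e1, EmbeddingLike.apply_eq_iff_eq, ← Subtype.ext_iff,
              EmbeddingLike.apply_eq_iff_eq] at e2
            exact hs' (by rw [e2])
        rw [Finset.sum_eq_single s (fun s' _ h => by rw [huniq s' h, zero_smul])
          (fun h => absurd (Finset.mem_univ s) h)] at hs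
        refine absurd hs (smul_ne_zero hs0 ?_)
        rcases s with j | k | j
        · exact he.ne_zero _
        · exact absurd (not_imp_comm.1 (hc _) hs0).symm hν
        · exact he.ne_zero _
      · push Not at hex
        exact hex
  · rw [eq_top_iff]
    intro x _
    obtain ⟨h, hh, c, rfl⟩ := T.exists_eq_sum he x
    exact Submodule.add_mem _ (Submodule.mem_iSup_of_mem 0 (T.lie_le_weightSpace_zero hh))
      (Submodule.sum_mem _ fun i _ => Submodule.smul_mem _ _
        (Submodule.mem_iSup_of_mem _ (he.mem i)))
  · exact fun j => ⟨_, hneg _, rfl⟩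

end Chevalley

end ClosedTorus

/-! ### Straightening of words into restricted ordered monomials -/

section Straightening

variable {σ : Type*}

/-- The word in which the letters occur in the order of `l`, the letter `s` with multiplicity
`a s`. -/
def ordWord (l : List σ) (a : σ → ℕ) : List σ := l.flatMap fun s => List.replicate (a s) s

theorem ordWord_append (l l' : List σ) (a : σ → ℕ) :
    ordWord (l ++ l') a = ordWord l a ++ ordWord l' a := List.flatMap_append

theorem ordWord_map {τ : Type*} (g : τ → σ) (l : List τ) (a : σ → ℕ) :
    ordWord (l.map g) a = (ordWord l (a ∘ g)).map g := by
  simp [ordWord, List.flatMap_map, List.map_flatMap]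

theorem count_ordWord [DecidableEq σ] {l : List σ} (hl : l.Nodup) (hl' : ∀ s, s ∈ l) (a : σ → ℕ)
    (s : σ) : (ordWord l a).count s = a s := by
  have key : ∀ l : List σ, l.Nodup → (ordWord l a).count s = if s ∈ l then a s else 0 := by
    intro l
    induction l with
    | nil => intro _; simp [ordWord]
    | cons t l ih =>
      intro h
      rw [List.nodup_cons] at h
      have h1 : ordWord (t :: l) a = List.replicate (a t) t ++ ordWord l a := by
        simp [ordWord]
      rw [h1, List.count_append, ih h.2, List.count_replicate]
      by_cases hst : t = s
      · subst hst
        simp [h.1]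
      · simp [hst, Ne.symm hst]
  rw [key l hl, if_pos (hl' s)]

theorem length_ordWord [Fintype σ] {l : List σ} (hl : l.Nodup) (hl' : ∀ s, s ∈ l) (a : σ → ℕ) :
    (ordWord l a).length = ∑ s, a s := by
  classical
  rw [← List.sum_toFinset_count_eq_length]
  simp only [count_ordWord hl hl']
  refine Finset.sum_subset (Finset.subset_univ _) fun s _ hs => ?_
  rw [← count_ordWord hl hl' a s]
  exact List.count_eq_zero.2 (by simpa using hs)

theorem sum_map_ordWord [Fintype σ] {M : Type*} [AddCommMonoid M] {l : List σ} (hl : l.Nodup)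
    (hl' : ∀ s, s ∈ l) (a : σ → ℕ) (wt : σ → M) :
    ((ordWord l a).map wt).sum = ∑ s, a s • wt s := by
  classical
  rw [Finset.sum_list_map_count]
  simp only [count_ordWord hl hl']
  refine Finset.sum_subset (Finset.subset_univ _) fun s _ hs => ?_
  rw [← count_ordWord hl hl' a s, List.count_eq_zero.2 (by simpa using hs), zero_smul]

variable (K : Type*) [Field K] {U : Type*} [Ring U] [Algebra K U] {M : Type*} [AddCommMonoid M]
  (x : σ → U) (wt : σ → M) (le : M → M → Prop)

/-- The span of the words of length less than `n` and of weight at most `m`. -/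
def shortWords (n : ℕ) (m : M) : Submodule K U :=
  Submodule.span K {u | ∃ w : List σ, w.length < n ∧ le (w.map wt).sum m ∧ u = (w.map x).prod}

/-- The span of the restricted ordered monomials of weight at most `m`. -/
def restrictedMonomials (l : List σ) (p : ℕ) (m : M) : Submodule K U :=
  Submodule.span K {u | ∃ a : σ → ℕ, (∀ s, a s < p) ∧ le ((ordWord l a).map wt).sum m ∧
    u = ((ordWord l a).map x).prod}

/-- An additive preorder. -/
structure IsAddPreorder : Prop where
  refl : ∀ a, le a a
  trans : ∀ a b c, le a b → le b c → le a c
  add_left : ∀ a b c, le a b → le (c + a) (c + b)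

variable {le} (hle : IsAddPreorder le) {K x wt}
include hle

theorem mul_mem_shortWords {n : ℕ} {m : M} {u : U} (hu : u ∈ shortWords K x wt le n m)
    (v : List σ) : (v.map x).prod * u ∈ shortWords K x wt le (n + v.length) ((v.map wt).sum + m) := by
  induction hu using Submodule.span_induction with
  | mem u hu =>
    obtain ⟨w, h1, h2, rfl⟩ := hu
    refine Submodule.subset_span ⟨v ++ w, ?_, ?_, ?_⟩
    · rw [List.length_append]; omega
    · rw [List.map_append, List.sum_append]; exact hle.add_left _ _ _ h2
    · rw [List.map_append, List.prod_append]
  | zero => rw [mul_zero]; exact Submodule.zero_mem _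
  | add a b _ _ ha hb => rw [mul_add]; exact Submodule.add_mem _ ha hb
  | smul c a _ ha => rw [mul_smul_comm]; exact Submodule.smul_mem _ _ ha

theorem shortWords_mul_mem {n : ℕ} {m : M} {u : U} (hu : u ∈ shortWords K x wt le n m)
    (v : List σ) : u * (v.map x).prod ∈ shortWords K x wt le (n + v.length) (m + (v.map wt).sum) := by
  induction hu using Submodule.span_induction with
  | mem u hu =>
    obtain ⟨w, h1, h2, rfl⟩ := hu
    refine Submodule.subset_span ⟨w ++ v, ?_, ?_, ?_⟩
    · rw [List.length_append]; omega
    · rw [List.map_append, List.sum_append, add_comm, add_comm m]; exact hle.add_left _ _ _ h2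
    · rw [List.map_append, List.prod_append]
  | zero => rw [zero_mul]; exact Submodule.zero_mem _
  | add a b _ _ ha hb => rw [add_mul]; exact Submodule.add_mem _ ha hb
  | smul c a _ ha => rw [smul_mul_assoc]; exact Submodule.smul_mem _ _ ha

/-- Adjacent transpositions generate all rearrangements, and each of them replaces two letters by
their commutator, hence by shorter words. -/
theorem prod_sub_prod_mem_of_perm
    (hcomm : ∀ s t, x s * x t - x t * x s ∈ shortWords K x wt le 2 (wt s + wt t))
    {w w' : List σ} (h : w.Perm w') :
    (w.map x).prod - (w'.map x).prod ∈ shortWords K x wt le w.length (w.map wt).sum := by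
  induction h with
  | nil => rw [sub_self]; exact Submodule.zero_mem _
  | cons s _ ih =>
    have := mul_mem_shortWords hle ih [s]
    simpa [mul_sub] using this
  | swap s t w =>
    have := shortWords_mul_mem hle (hcomm t s) w
    simpa [sub_mul, mul_assoc, add_assoc, add_comm, add_left_comm] using this
  | trans h1 _ ih1 ih2 =>
    rw [← h1.length_eq, ← (h1.map wt).sum_eq] at ih2
    have := Submodule.add_mem _ ih1 ih2
    rwa [sub_add_sub_cancel] at this

theorem restrictedMonomials_mono (l : List σ) (p : ℕ) {m m' : M} (h : le m m') :
    restrictedMonomials K x wt le l p m ≤ restrictedMonomials K x wt le l p m' :=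
  Submodule.span_mono fun _ ⟨a, h1, h2, h3⟩ => ⟨a, h1, hle.trans _ _ _ h2 h, h3⟩

/-- Each word is a combination of restricted ordered monomials of no larger weight, if commutators
and `p`-th powers of letters are combinations of shorter words of no larger weight. -/
theorem prod_mem_restrictedMonomials {l : List σ} (hl : l.Nodup) (hl' : ∀ s, s ∈ l) {p : ℕ}
    (hcomm : ∀ s t, x s * x t - x t * x s ∈ shortWords K x wt le 2 (wt s + wt t))
    (hpow : ∀ s, x s ^ p ∈ shortWords K x wt le p (p • wt s)) (w : List σ) :
    (w.map x).prod ∈ restrictedMonomials K x wt le l p (w.map wt).sum := by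
  classical
  induction hn : w.length using Nat.strong_induction_on generalizing w with
  | _ n ih =>
    subst hn
    have hL : ∀ m, shortWords K x wt le w.length m ≤ restrictedMonomials K x wt le l p m := by
      intro m
      refine Submodule.span_le.2 ?_
      rintro _ ⟨v, h1, h2, rfl⟩
      exact restrictedMonomials_mono hle l p h2 (ih _ h1 v rfl)
    -- If no letter occurs p times, sorting the word yields a restricted monomial. Otherwise p
    -- copies of some letter are moved to the front and their power is rewritten by `hpow`; both
    -- moves cost only shorter words.
    by_cases ha : ∀ s, w.count s < p
    · have hperm : w.Perm (ordWord l fun s => w.count s) :=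
        List.perm_iff_count.2 fun s => (count_ordWord hl hl' (fun s => w.count s) s).symm
      have h1 := hL _ (prod_sub_prod_mem_of_perm hle hcomm hperm)
      refine (Submodule.sub_mem_iff_left _ ?_).1 h1
      refine Submodule.subset_span ⟨_, ha, ?_, rfl⟩
      rw [(hperm.map wt).sum_eq]
      exact hle.refl _
    · push Not at ha
      obtain ⟨s, hs⟩ := ha
      obtain ⟨v, hv⟩ := (List.replicate_sublist_iff.2 hs).exists_perm_append
      have h1 := hL _ (prod_sub_prod_mem_of_perm hle hcomm hv)
      refine (Submodule.sub_mem_iff_left _ ?_).1 h1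
      have h2 := shortWords_mul_mem hle (hpow s) v
      have h3 : ((List.replicate p s ++ v).map x).prod = x s ^ p * (v.map x).prod := by simp
      rw [h3, hv.length_eq] at *
      refine hL _ ?_
      rw [(hv.map wt).sum_eq]
      simpa using h2

end Straightening

/-! ### The `p`-th power of a first order differential operator -/

section PthPower

variable (K : Type*) [Field K] (p : ℕ) [Fact p.Prime] [CharP K p]

/-- Left and right multiplication by L commute, so the p-th power of their difference is the
difference of their p-th powers: ad(L)^p = ad(L^p). -/
theorem ad_pow_char {E : Type*} [Ring E] [Algebra K E] (L y : E) :
    ((LinearMap.mulLeft K L - LinearMap.mulRight K L) ^ p) y = L ^ p * y - y * L ^ p := by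
  cases subsingleton_or_nontrivial E
  · exact Subsingleton.elim _ _
  have : CharP (Module.End K E) p :=
    charP_of_injective_algebraMap (algebraMap K (Module.End K E)).injective p
  have hc : Commute (LinearMap.mulLeft K L) (LinearMap.mulRight K L) :=
    LinearMap.commute_mulLeft_right L L
  rw [sub_pow_char_of_commute (R := Module.End K E) p hc, LinearMap.pow_mulLeft,
    LinearMap.pow_mulRight]
  rfl

theorem ad_pow_of_commutator {E : Type*} [Ring E] [Algebra K E] {A : Type*} (L : E) (d : A → A)
    (m : A → E) (h : ∀ a, L * m a - m a * L = m (d a)) (n : ℕ) (a : A) :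
    ((LinearMap.mulLeft K L - LinearMap.mulRight K L) ^ n) (m a) = m (d^[n] a) := by
  induction n generalizing a with
  | zero => rfl
  | succ n ih =>
    have h1 : (LinearMap.mulLeft K L - LinearMap.mulRight K L) (m a) = m (d a) := h a
    rw [pow_succ, Module.End.mul_apply, h1, ih, Function.iterate_succ_apply]

variable {K} {A : Type*} [CommRing A] [Algebra K A]

/-- The operator `D + φ` for a derivation `D` and a function `φ`. -/
def derivationAdd (D : Derivation K A A) (φ : A) : Module.End K A :=
  (D : A →ₗ[K] A) + LinearMap.mulLeft K φ

theorem derivationAdd_apply (D : Derivation K A A) (φ a : A) :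
    derivationAdd D φ a = D a + φ * a := rfl

/-- The operator `D + tφ` on sequences, viewed as power series in `t`. -/
def seriesOperator (D : Derivation K A A) (φ : A) : Module.End K (ℕ → A) where
  toFun u k := D (u k) + φ * (if k = 0 then 0 else u (k - 1))
  map_add' u v := by
    ext k
    by_cases hk : k = 0
    · simp [hk]
    · simp only [Pi.add_apply, map_add, if_neg hk]
      ring
  map_smul' c u := by
    ext k
    by_cases hk : k = 0 <;> simp [hk]

/-- The derivative with respect to `t`. -/
def seriesDeriv : Module.End K (ℕ → A) where
  toFun u k := ((k : K) + 1) • u (k + 1)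
  map_add' u v := by
    ext k
    simp
  map_smul' c u := by
    ext k
    simp [smul_comm c]

/-- The series (D + tφ)^n 1 is a polynomial in t of degree at most n with coefficient φ^n at t^n,
and setting t = 1 gives (D + φ)^n 1. -/
theorem seriesOperator_pow_apply (D : Derivation K A A) (φ : A) (n : ℕ) :
    (∀ k, n < k → (seriesOperator D φ ^ n) (Pi.single 0 1) k = 0) ∧
      (seriesOperator D φ ^ n) (Pi.single 0 1) n = φ ^ n ∧
      ∑ k ∈ Finset.range (n + 1), (seriesOperator D φ ^ n) (Pi.single 0 1) k =
        (derivationAdd D φ ^ n) 1 := by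
  induction n with
  | zero =>
    refine ⟨fun k hk => ?_, ?_, ?_⟩
    · simp [hk.ne']
    · simp
    · simp
  | succ n ih =>
    obtain ⟨h1, h2, h3⟩ := ih
    set u := (seriesOperator D φ ^ n) (Pi.single 0 1) with hu
    have hs : ∀ k, (seriesOperator D φ ^ (n + 1)) (Pi.single 0 1) k =
        D (u k) + φ * (if k = 0 then 0 else u (k - 1)) := by
      intro k
      rw [pow_succ', Module.End.mul_apply]
      rfl
    refine ⟨fun k hk => ?_, ?_, ?_⟩
    · rw [hs, h1 k (by omega), if_neg (by omega), h1 (k - 1) (by omega)]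
      simp
    · rw [hs, h1 (n + 1) (by omega), if_neg (by omega), Nat.add_sub_cancel, h2, map_zero, zero_add,
        pow_succ']
    · simp only [hs]
      rw [Finset.sum_add_distrib, ← Finset.mul_sum, Finset.sum_range_succ, h1 (n + 1) (by omega),
        map_zero, add_zero, ← map_sum, h3, Finset.sum_range_succ']
      simp only [Nat.add_eq_zero_iff, one_ne_zero, and_false, if_false, Nat.add_sub_cancel, if_true,
        add_zero]
      rw [h3, pow_succ', Module.End.mul_apply, derivationAdd_apply]

/-- Put Δ = D + tφ. From [Δ, d/dt] = -φ and ad(Δ)^p = ad(Δ^p) one gets d/dt (Δ^p 1) = D^{p-1} φ.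
Hence the coefficient of t is D^{p-1} φ and those of t^k for 1 < k < p vanish, k being invertible.
The constant term is D^p 1 = 0 and the coefficient of t^p is φ^p; now set t = 1. -/
theorem derivationAdd_pow_char_one (D : Derivation K A A) (φ : A) :
    (derivationAdd D φ ^ p) 1 = D^[p - 1] φ + φ ^ p := by
  have hp := (Fact.out : p.Prime)
  set Δ := seriesOperator D φ with hΔ
  let m : A → Module.End K (ℕ → A) := fun a =>
    { toFun := fun u k => a * u k
      map_add' := fun u v => by ext k; simp [mul_add]
      map_smul' := fun c u => by ext k; simp }
  have hm : ∀ a, Δ * m a - m a * Δ = m (D a) := by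
    intro a
    ext u k
    by_cases hk : k = 0 <;> simp [m, hΔ, seriesOperator, hk] <;> ring
  have hd : Δ * seriesDeriv - seriesDeriv * Δ = -m φ := by
    ext u k
    rcases k with _ | k
    · simp [m, hΔ, seriesOperator, seriesDeriv]
    · simp only [LinearMap.sub_apply, Module.End.mul_apply, Pi.sub_apply, LinearMap.neg_apply,
        Pi.neg_apply]
      change D (((↑(k + 1) : K) + 1) • u (k + 1 + 1)) + φ * (((↑k : K) + 1) • u (k + 1)) -
        ((↑(k + 1) : K) + 1) • (D (u (k + 1 + 1)) + φ * u (k + 1)) = -(φ * u (k + 1))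
      rw [Derivation.map_smul, smul_add, mul_smul_comm, Nat.cast_add, Nat.cast_one,
          add_smul ((k : K) + 1) 1 (φ * u (k + 1)), one_smul]
      abel
  have h1 := ad_pow_char K p Δ (seriesDeriv : Module.End K (ℕ → A))
  have hsucc : p = (p - 1) + 1 := (Nat.succ_pred_eq_of_pos hp.pos).symm
  have h2 : ((LinearMap.mulLeft K Δ - LinearMap.mulRight K Δ) ^ p)
      (seriesDeriv : Module.End K (ℕ → A)) = -m (D^[p - 1] φ) := by
    conv_lhs => rw [hsucc]
    rw [pow_succ, Module.End.mul_apply]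
    have : (LinearMap.mulLeft K Δ - LinearMap.mulRight K Δ) seriesDeriv = -m φ := hd
    rw [this, map_neg, ad_pow_of_commutator K Δ D m hm]
  rw [h1] at h2
  set w := (Δ ^ p) (Pi.single 0 1) with hw
  have h3 : ∀ k : ℕ, ((k : K) + 1) • w (k + 1) = if k = 0 then D^[p - 1] φ else 0 := by
    intro k
    have h4 := congrFun (LinearMap.congr_fun h2 (Pi.single 0 1)) k
    simp only [LinearMap.sub_apply, Module.End.mul_apply, Pi.sub_apply, LinearMap.neg_apply,
      Pi.neg_apply] at h4
    have h5 : (seriesDeriv : Module.End K (ℕ → A)) (Pi.single 0 1) = 0 := by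
      ext k
      simp [seriesDeriv]
    rw [h5, map_zero, Pi.zero_apply, zero_sub, neg_inj] at h4
    refine h4.trans ?_
    change D^[p - 1] φ * (Pi.single 0 1 : ℕ → A) k = _
    rw [Pi.single_apply]
    split_ifs <;> simp
  obtain ⟨-, h5, h6⟩ := seriesOperator_pow_apply D φ p
  have h7 : w 0 = 0 := by
    have : ∀ n, (Δ ^ n) (Pi.single 0 1) 0 = D^[n] (1 : A) := by
      intro n
      induction n with
      | zero => simp
      | succ n ih =>
        rw [pow_succ', Module.End.mul_apply, Function.iterate_succ_apply', ← ih]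
        simp [hΔ, seriesOperator]
    rw [hw, this, hsucc, Function.iterate_succ_apply, Derivation.map_one_eq_zero]
    exact iterate_map_zero D _
  rw [← h6]
  have h8 : ∀ k, k < p → k ≠ 1 → w k = 0 := by
    intro k hk hk1
    rcases k with _ | k
    · exact h7
    · have h9 := h3 k
      rw [if_neg (by omega)] at h9
      refine (smul_eq_zero.1 h9).resolve_left ?_
      have : ((k + 1 : ℕ) : K) ≠ 0 := by
        rw [Ne, CharP.cast_eq_zero_iff K p]
        exact Nat.not_dvd_of_pos_of_lt (by omega) hk
      exact_mod_cast this
  rw [Finset.sum_range_succ, h5, Finset.sum_eq_single 1]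
  · have h9 := h3 0
    simpa using h9
  · intro k hk hk1
    exact h8 k (Finset.mem_range.1 hk) hk1
  · intro h
    exact absurd (Finset.mem_range.2 hp.one_lt) h

/-- `(D + φ) ^ p = D ^ p + D ^ (p - 1) φ + φ ^ p` in characteristic `p`. -/
theorem derivationAdd_pow_char (D : Derivation K A A) (φ a : A) :
    (derivationAdd D φ ^ p) a = D^[p] a + (D^[p - 1] φ + φ ^ p) * a := by
  have hm : ∀ a, derivationAdd D φ * LinearMap.mulLeft K a - LinearMap.mulLeft K a *
      derivationAdd D φ = LinearMap.mulLeft K (D a) := by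
    intro a
    ext b
    simp only [LinearMap.sub_apply, Module.End.mul_apply, LinearMap.mulLeft_apply,
      derivationAdd_apply, Derivation.leibniz, smul_eq_mul]
    ring
  -- The commutator of D + φ with multiplication by a is multiplication by D a. Hence (D + φ)^p a -
  -- a (D + φ)^p 1 = D^p a, which leaves only the value at 1.
  have h1 := ad_pow_char K p (derivationAdd D φ) (LinearMap.mulLeft K a)
  rw [ad_pow_of_commutator K _ D (fun a => LinearMap.mulLeft K a) hm] at h1
  have h2 := LinearMap.congr_fun h1 1
  simp only [LinearMap.sub_apply, Module.End.mul_apply, LinearMap.mulLeft_apply, mul_one] at h2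
  rw [derivationAdd_pow_char_one, eq_sub_iff_add_eq] at h2
  rw [← h2, mul_comm a]

end PthPower

attribute [local instance 100] LieRing.ofAssociativeRing

/-! ### Reduced enveloping algebras -/

section RedEnv

variable {K : Type*} [Field K] {A : Type*} [CommRing A] [HopfAlgebra K A]
  (p : ℕ) [Fact p.Prime] [CharP K p]

/-- The universal property of `U_χ(𝔤)`. -/
def liftRedEnv {E : Type*} [Ring E] [Algebra K E] (χ : Module.Dual K (Lie K A))
    (ρ : Lie K A →ₗ⁅K⁆ E) (h : ∀ x, ρ x ^ p = ρ (pPow p x) + algebraMap K E (χ x ^ p)) :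
    RedEnv p χ →ₐ[K] E :=
  RingQuot.liftAlgHom K ⟨UniversalEnvelopingAlgebra.lift K ρ, by
    rintro _ _ ⟨x, rfl, rfl⟩
    rw [map_pow, map_add, UniversalEnvelopingAlgebra.lift_ι_apply,
      UniversalEnvelopingAlgebra.lift_ι_apply, AlgHom.commutes, h]⟩

theorem liftRedEnv_toRedEnv {E : Type*} [Ring E] [Algebra K E] (χ : Module.Dual K (Lie K A))
    (ρ : Lie K A →ₗ⁅K⁆ E) (h : ∀ x, ρ x ^ p = ρ (pPow p x) + algebraMap K E (χ x ^ p))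
    (x : Lie K A) : liftRedEnv p χ ρ h (toRedEnv p χ x) = ρ x := by
  change RingQuot.liftAlgHom K _ (RingQuot.mkAlgHom K _ (UniversalEnvelopingAlgebra.ι K x)) = _
  rw [RingQuot.liftAlgHom_mkAlgHom_apply, UniversalEnvelopingAlgebra.lift_ι_apply]

theorem toRedEnv_pow (χ : Module.Dual K (Lie K A)) (x : Lie K A) :
    toRedEnv p χ x ^ p = toRedEnv p χ (pPow p x) + algebraMap K _ (χ x ^ p) := by
  change (RingQuot.mkAlgHom K _ (UniversalEnvelopingAlgebra.ι K x)) ^ p =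
    RingQuot.mkAlgHom K _ (UniversalEnvelopingAlgebra.ι K (pPow p x)) + _
  rw [← map_pow, ← AlgHom.commutes (RingQuot.mkAlgHom K _), ← map_add]
  exact RingQuot.mkAlgHom_rel K ⟨x, rfl, rfl⟩

/-- The map from 𝔤 into the subalgebra it generates extends to U_χ(𝔤); composed with the inclusion
it is the identity by the universal property. -/
theorem adjoin_range_toRedEnv (χ : Module.Dual K (Lie K A)) :
    Algebra.adjoin K (Set.range (toRedEnv p χ)) = ⊤ := by
  set S := Algebra.adjoin K (Set.range (toRedEnv p χ)) with hS
  let ρ : Lie K A →ₗ⁅K⁆ S :=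
    { toFun := fun x => ⟨toRedEnv p χ x, Algebra.subset_adjoin ⟨x, rfl⟩⟩
      map_add' := fun x y => Subtype.ext (map_add _ _ _)
      map_smul' := fun c x => Subtype.ext (map_smul _ _ _)
      map_lie' := fun {x y} => Subtype.ext (LieHom.map_lie _ _ _) }
  have h : S.val.comp (liftRedEnv p χ ρ fun x => Subtype.ext (toRedEnv_pow p χ x)) =
      AlgHom.id K _ := by
    apply RingQuot.ringQuot_ext'
    refine UniversalEnvelopingAlgebra.hom_ext K (LieHom.ext fun x => ?_)
    exact congrArg Subtype.val (liftRedEnv_toRedEnv p χ ρ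
      (fun x => Subtype.ext (toRedEnv_pow p χ x)) x)
  rw [eq_top_iff]
  intro u _
  have := AlgHom.congr_fun h u
  rw [AlgHom.id_apply] at this
  rw [← this]
  exact Subtype.property _

/-- A subspace of a `U_χ(𝔤)`-module which is stable under `𝔤` is a submodule. -/
theorem smul_mem_of_toRedEnv {χ : Module.Dual K (Lie K A)} {M : Type*} [AddCommGroup M]
    [Module K M] [Module (RedEnv p χ) M] [IsScalarTower K (RedEnv p χ) M] (N : Submodule K M)
    (h : ∀ x : Lie K A, ∀ m ∈ N, toRedEnv p χ x • m ∈ N) (u : RedEnv p χ) {m : M} (hm : m ∈ N) :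
    u • m ∈ N := by
  have hu : u ∈ Algebra.adjoin K (Set.range (toRedEnv p χ)) := by
    rw [adjoin_range_toRedEnv]; trivial
  induction hu using Algebra.adjoin_induction generalizing m with
  | mem u hu =>
    obtain ⟨x, rfl⟩ := hu
    exact h x m hm
  | algebraMap c => rw [algebraMap_smul]; exact N.smul_mem c hm
  | add u v _ _ hu hv => rw [add_smul]; exact N.add_mem (hu hm) (hv hm)
  | mul u v _ _ hu hv => rw [mul_smul]; exact hu (hv hm)

end RedEnv

/-! ### The action of `U_χ(𝔤)` on the functions on the Frobenius kernel -/

section Twisted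

variable {K : Type*} [Field K] {A : Type*} [CommRing A] [HopfAlgebra K A]

/-- The twisted action `a ↦ x a + (x F) a` of `x ∈ 𝔤` on `K[G]`. -/
def twisted (F : A) (x : Lie K A) : Module.End K A :=
  derivationAdd (x : Derivation K A A) ((x : Derivation K A A) F)

theorem twisted_apply (F : A) (x : Lie K A) (a : A) :
    twisted F x a = (x : Derivation K A A) a + (x : Derivation K A A) F * a := rfl

variable (K A) in
/-- The ideal of functions vanishing at the identity. -/
def augmentation : Ideal A := RingHom.ker (Bialgebra.counitAlgHom K A)

variable (K A) in
/-- The ideal of the Frobenius kernel of `G`. -/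
def frobeniusIdeal (p : ℕ) : Ideal A := Ideal.span {a | ∃ f ∈ augmentation K A, a = f ^ p}

theorem mem_augmentation {f : A} : f ∈ augmentation K A ↔ Coalgebra.counit (R := K) f = 0 := Iff.rfl

theorem sub_counit_mem_augmentation (f : A) :
    f - algebraMap K A (Coalgebra.counit (R := K) f) ∈ augmentation K A := by
  rw [mem_augmentation, map_sub, Bialgebra.counit_algebraMap, sub_self]

variable (p : ℕ) [Fact p.Prime] [CharP K p]

omit [CharP K p] in
theorem counit_eq_zero_of_mem_frobeniusIdeal {a : A} (ha : a ∈ frobeniusIdeal K A p) :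
    Coalgebra.counit (R := K) a = 0 := by
  have : frobeniusIdeal K A p ≤ augmentation K A := by
    refine Ideal.span_le.2 ?_
    rintro _ ⟨f, hf, rfl⟩
    exact Ideal.pow_mem_of_mem _ hf p (Fact.out : p.Prime).pos
  exact this ha

include K in
theorem nontrivial_of_hopfAlgebra : Nontrivial A := by
  refine ⟨1, 0, fun h => ?_⟩
  have := congrArg (Coalgebra.counit (R := K)) h
  rw [Bialgebra.counit_one, map_zero] at this
  exact one_ne_zero this

omit [Fact p.Prime] in
include K in
theorem charP_of_hopfAlgebra : CharP A p :=
  have := nontrivial_of_hopfAlgebra (K := K) (A := A)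
  charP_of_injective_algebraMap (algebraMap K A).injective p

omit [Fact p.Prime] in
theorem derivation_pow_char (D : Derivation K A A) (f : A) : D (f ^ p) = 0 := by
  have := charP_of_hopfAlgebra (K := K) (A := A) p
  rw [Derivation.leibniz_pow, ← Nat.cast_smul_eq_nsmul A, CharP.cast_eq_zero, zero_smul]

-- A derivation kills p-th powers, so it preserves every ideal generated by them.
omit [Fact p.Prime] in
theorem twisted_mem_frobeniusIdeal (F : A) (x : Lie K A) {a : A} (ha : a ∈ frobeniusIdeal K A p) :
    twisted F x a ∈ frobeniusIdeal K A p := by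
  rw [twisted_apply]
  refine Ideal.add_mem _ ?_ (Ideal.mul_mem_left _ _ ha)
  induction ha using Submodule.span_induction with
  | mem a ha =>
    obtain ⟨f, -, rfl⟩ := ha
    rw [derivation_pow_char]
    exact Ideal.zero_mem _
  | zero => rw [map_zero]; exact Ideal.zero_mem _
  | add a b _ _ ha hb => rw [map_add]; exact Ideal.add_mem _ ha hb
  | smul c a h ha =>
    rw [smul_eq_mul, Derivation.leibniz, smul_eq_mul, smul_eq_mul]
    exact Ideal.add_mem _ (Ideal.mul_mem_left _ _ ha) (Ideal.mul_mem_right _ _ h)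

/-- The zeroth order term x ↦ x F is a coboundary, so twisting by it does not disturb the bracket;
formally the twist is conjugation by exp F. -/
theorem twisted_lie (F : A) (x y : Lie K A) (a : A) :
    twisted F ⁅x, y⁆ a = twisted F x (twisted F y a) - twisted F y (twisted F x a) := by
  simp only [twisted_apply]
  have h : ∀ b, ((⁅x, y⁆ : Lie K A) : Derivation K A A) b =
      (x : Derivation K A A) ((y : Derivation K A A) b) -
        (y : Derivation K A A) ((x : Derivation K A A) b) := fun b =>
    Derivation.commutator_apply (D1 := (x : Derivation K A A)) (D2 := (y : Derivation K A A)) b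
  rw [h, h]
  simp only [map_add, Derivation.leibniz, smul_eq_mul]
  ring

/-- In the formula for (D + φ)^p with D = x and φ = x F, the middle term D^{p-1} φ is x^[p] F, so it
is the twist of x^[p]. -/
theorem twisted_pow (F : A) (x : Lie K A) (a : A) :
    (twisted F x ^ p) a = twisted F (pPow p x) a + ((x : Derivation K A A) F) ^ p * a := by
  have hp : p = (p - 1) + 1 := (Nat.succ_pred_eq_of_pos (Fact.out : p.Prime).pos).symm
  have h : ∀ b, ((pPow p x : Lie K A) : Derivation K A A) b = (x : Derivation K A A)^[p] b := by
    intro b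
    change (((x : Derivation K A A) : A →ₗ[K] A) ^ p : Module.End K A) b = _
    rw [Module.End.pow_apply]
    rfl
  rw [twisted, derivationAdd_pow_char, twisted_apply, h, h]
  conv_rhs => rw [hp]
  rw [← hp, hp, Function.iterate_succ_apply (x : Derivation K A A) (p - 1) F, ← hp]
  ring

variable (K A) in
/-- The functions on the Frobenius kernel. -/
abbrev FrobeniusKernel : Type _ := A ⧸ (frobeniusIdeal K A p).restrictScalars K

/-- Restriction of functions to the Frobenius kernel. -/
def frobMk : A →ₗ[K] FrobeniusKernel K A p := Submodule.mkQ _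

omit [Fact p.Prime] [CharP K p] in
theorem frobMk_surjective : Function.Surjective (frobMk (K := K) (A := A) p) :=
  Submodule.mkQ_surjective _

omit [Fact p.Prime] [CharP K p] in
theorem frobMk_eq {a b : A} (h : a - b ∈ frobeniusIdeal K A p) :
    frobMk (K := K) p a = frobMk p b :=
  (Submodule.Quotient.eq _).2 h

/-- The twisted action of `x ∈ 𝔤` on the functions on the Frobenius kernel. -/
def twistedQuot (F : A) (x : Lie K A) : Module.End K (FrobeniusKernel K A p) :=
  ((frobeniusIdeal K A p).restrictScalars K).mapQ _ (twisted F x)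
    fun _ ha => twisted_mem_frobeniusIdeal p F x ha

omit [Fact p.Prime] in
theorem twistedQuot_frobMk (F : A) (x : Lie K A) (a : A) :
    twistedQuot p F x (frobMk p a) = frobMk p (twisted F x a) := rfl

/-- The twisted representation of `𝔤` on the functions on the Frobenius kernel. -/
def twistedRep (F : A) : Lie K A →ₗ⁅K⁆ Module.End K (FrobeniusKernel K A p) where
  toFun := twistedQuot p F
  map_add' x y := by
    refine LinearMap.ext fun m => ?_
    obtain ⟨a, rfl⟩ := frobMk_surjective p m
    rw [LinearMap.add_apply, twistedQuot_frobMk, twistedQuot_frobMk, twistedQuot_frobMk, ← map_add]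
    congr 1
    change (x : Derivation K A A) a + (y : Derivation K A A) a +
      ((x : Derivation K A A) F + (y : Derivation K A A) F) * a = _
    rw [twisted_apply, twisted_apply]
    ring
  map_smul' c x := by
    refine LinearMap.ext fun m => ?_
    obtain ⟨a, rfl⟩ := frobMk_surjective p m
    rw [RingHom.id_apply, LinearMap.smul_apply, twistedQuot_frobMk, twistedQuot_frobMk, ← map_smul]
    congr 1
    change c • (x : Derivation K A A) a + (c • (x : Derivation K A A) F) * a = _
    rw [twisted_apply, smul_add, smul_mul_assoc]
  map_lie' {x y} := by
    refine LinearMap.ext fun m => ?_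
    obtain ⟨a, rfl⟩ := frobMk_surjective p m
    rw [LieRing.of_associative_ring_bracket, LinearMap.sub_apply, Module.End.mul_apply,
      Module.End.mul_apply]
    simp only [twistedQuot_frobMk]
    rw [← map_sub, twisted_lie]

omit [Fact p.Prime] in
theorem twistedRep_frobMk (F : A) (x : Lie K A) (a : A) :
    twistedRep p F x (frobMk p a) = frobMk p (twisted F x a) := rfl

/-- On the Frobenius kernel the p-th power of a function equals the p-th power of its value at the
identity. For x F this value is χ(x), so the action has p-character χ. -/
theorem twistedRep_pow {F : A} {χ : Module.Dual K (Lie K A)}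
    (hF : ∀ x : Lie K A, χ x = Coalgebra.counit (R := K) ((x : Derivation K A A) F))
    (x : Lie K A) : twistedRep p F x ^ p =
      twistedRep p F (pPow p x) + algebraMap K (Module.End K (FrobeniusKernel K A p)) (χ x ^ p) := by
  have := charP_of_hopfAlgebra (K := K) (A := A) p
  refine LinearMap.ext fun m => ?_
  obtain ⟨a, rfl⟩ := frobMk_surjective p m
  have h : ∀ n : ℕ, (twistedRep p F x ^ n) (frobMk p a) = frobMk p ((twisted F x ^ n) a) := by
    intro n
    induction n with
    | zero => rfl
    | succ n ih => rw [pow_succ', pow_succ', Module.End.mul_apply, ih, twistedRep_frobMk]; rfl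
  rw [h, twisted_pow, LinearMap.add_apply, Module.algebraMap_end_apply, twistedRep_frobMk,
    ← map_smul, ← map_add]
  refine frobMk_eq p ?_
  rw [add_sub_add_left_eq_sub, Algebra.smul_def, ← sub_mul, hF, map_pow, ← sub_pow_char]
  exact Ideal.mul_mem_right _ _ (Ideal.subset_span ⟨_, sub_counit_mem_augmentation _, rfl⟩)

/-- Evaluation at the identity on the Frobenius kernel. -/
def evalOne : FrobeniusKernel K A p →ₗ[K] K :=
  ((frobeniusIdeal K A p).restrictScalars K).liftQ (Coalgebra.counit (R := K) (A := A))
    fun _ ha => counit_eq_zero_of_mem_frobeniusIdeal p ha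

end Twisted

/-! ### Linear independence of the restricted ordered monomials -/

section Dual

/-- If v ↦ (δ_i(v)) were not onto, a linear form vanishing on its image would be a relation among
the δ_i. Here V may have infinite dimension. -/
theorem exists_dual_vectors {K V σ : Type*} [Field K] [AddCommGroup V] [Module K V] [Fintype σ]
    [DecidableEq σ] {δ : σ → Module.Dual K V} (hδ : LinearIndependent K δ) :
    ∃ y : σ → V, ∀ i j, δ i (y j) = if i = j then 1 else 0 := by
  have hs : Function.Surjective (LinearMap.pi δ) := by
    rw [← LinearMap.range_eq_top]
    by_contra h
    obtain ⟨g, hg, hg'⟩ := Submodule.exists_le_ker_of_lt_top _ (lt_top_iff_ne_top.2 h)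
    refine hg ?_
    have h1 := Fintype.linearIndependent_iff.1 hδ (fun i => g (Pi.single i 1)) (by
      ext v
      have h2 : g (LinearMap.pi δ v) = 0 := hg' ⟨v, rfl⟩
      rw [LinearMap.sum_apply, LinearMap.zero_apply, ← h2]
      conv_rhs => rw [pi_eq_sum_univ' (LinearMap.pi δ v), map_sum]
      refine Finset.sum_congr rfl fun i _ => ?_
      rw [LinearMap.smul_apply, map_smul, smul_eq_mul, smul_eq_mul, mul_comm]
      congr 1)
    refine LinearMap.pi_ext' fun i => LinearMap.ext_ring ?_
    simpa using h1 i
  choose y hy using fun j => hs (Pi.single j 1)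
  refine ⟨y, fun i j => ?_⟩
  have := congrFun (hy j) i
  rw [LinearMap.pi_apply] at this
  rw [this, Pi.single_apply]

variable {K : Type*} [Field K] {A : Type*} [CommRing A] [HopfAlgebra K A]

variable (K A) in
/-- Tangent vectors as linear forms on `K[G]`. -/
def lieToDual : Lie K A →ₗ[K] Module.Dual K A where
  toFun x := Coalgebra.counit ∘ₗ ((x : Derivation K A A) : A →ₗ[K] A)
  map_add' x y := by
    refine LinearMap.ext fun f => ?_
    exact map_add (Coalgebra.counit (R := K)) ((x : Derivation K A A) f) ((y : Derivation K A A) f)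
  map_smul' c x := by
    refine LinearMap.ext fun f => ?_
    exact map_smul (Coalgebra.counit (R := K)) c ((x : Derivation K A A) f)

theorem lieToDual_apply (x : Lie K A) (f : A) :
    lieToDual K A x f = Coalgebra.counit (R := K) ((x : Derivation K A A) f) := rfl

theorem lieToDual_injective : Function.Injective (lieToDual K A) := fun _ _ h =>
  lie_ext_counit fun f => LinearMap.congr_fun h f

/-- Local coordinates at the identity, dual to a linearly independent family in `𝔤`. -/
theorem exists_coordinates {σ : Type*} [Fintype σ] [DecidableEq σ] {x : σ → Lie K A}
    (hx : LinearIndependent K x) : ∃ y : σ → A, (∀ j, y j ∈ augmentation K A) ∧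
      ∀ i j, Coalgebra.counit (R := K) ((x i : Derivation K A A) (y j)) = if i = j then 1 else 0 := by
  obtain ⟨y, hy⟩ := exists_dual_vectors
    (hx.map' (lieToDual K A) (LinearMap.ker_eq_bot.2 lieToDual_injective))
  refine ⟨fun j => y j - algebraMap K A (Coalgebra.counit (R := K) (y j)),
    fun j => sub_counit_mem_augmentation _, fun i j => ?_⟩
  rw [map_sub, Derivation.map_algebraMap, sub_zero]
  exact hy i j

/-- A combination of local coordinates dual to the basis has any prescribed differential at the
identity. -/
theorem exists_potential {σ : Type*} [Fintype σ] (x : Module.Basis σ K (Lie K A))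
    (χ : Module.Dual K (Lie K A)) :
    ∃ F : A, ∀ z : Lie K A, χ z = Coalgebra.counit (R := K) ((z : Derivation K A A) F) := by
  classical
  obtain ⟨y, -, hy⟩ := exists_coordinates x.linearIndependent
  refine ⟨∑ j, χ (x j) • y j, fun z => ?_⟩
  have : χ = LinearMap.applyₗ (∑ j, χ (x j) • y j) ∘ₗ lieToDual K A := by
    refine x.ext fun i => ?_
    rw [LinearMap.comp_apply, LinearMap.applyₗ_apply_apply, lieToDual_apply, map_sum, map_sum]
    simp only [Derivation.map_smul, map_smul, hy, smul_eq_mul, mul_ite, mul_one, mul_zero,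
      Finset.sum_ite_eq, Finset.mem_univ, if_true]
  exact LinearMap.congr_fun this z

end Dual

/-! ### Leading terms of operators along powers of the augmentation ideal. -/

section Monomials

variable {K : Type*} [Field K] {A : Type*} [CommRing A] [HopfAlgebra K A] {σ : Type*}

theorem derivation_aeval [Fintype σ] (D : Derivation K A A) (y : σ → A) (P : MvPolynomial σ K) :
    D (MvPolynomial.aeval y P) =
      ∑ j, MvPolynomial.aeval y (MvPolynomial.pderiv j P) * D (y j) := by
  classical
  induction P using MvPolynomial.induction_on with
  | C a => simp
  | add P Q hP hQ => simp only [map_add, hP, hQ, add_mul, Finset.sum_add_distrib]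
  | mul_X P i hP =>
    simp only [map_mul, MvPolynomial.aeval_X, Derivation.leibniz, hP, smul_eq_mul, map_add,
      MvPolynomial.pderiv_X, add_mul, Finset.sum_add_distrib, Finset.mul_sum]
    congr 1
    · rw [Finset.sum_eq_single i]
      · simp
      · intro j _ hj
        simp [hj.symm]
      · simp
    · exact Finset.sum_congr rfl fun j _ => by ring

theorem aeval_monomial_mem {y : σ → A} (hy : ∀ j, y j ∈ augmentation K A) (b : σ →₀ ℕ) (c : K) :
    MvPolynomial.aeval y (MvPolynomial.monomial b c) ∈ augmentation K A ^ b.degree := by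
  rw [MvPolynomial.aeval_monomial]
  refine Ideal.mul_mem_left _ _ ?_
  rw [Finsupp.degree_apply, ← Finset.prod_pow_eq_pow_sum]
  exact Ideal.prod_mem_prod fun j _ => Ideal.pow_mem_pow (hy j) _

theorem derivation_mem_pow {I : Ideal A} (D : Derivation K A A) {n : ℕ} {a : A}
    (ha : a ∈ I ^ (n + 1)) : D a ∈ I ^ n := by
  induction n generalizing a with
  | zero => simp
  | succ n ih =>
    rw [pow_succ'] at ha
    induction ha using Submodule.mul_induction_on' with
    | mem_mul_mem u hu v hv =>
      rw [Derivation.leibniz, smul_eq_mul, smul_eq_mul]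
      refine Ideal.add_mem _ ?_ (Ideal.mul_mem_right _ _ hv)
      rw [pow_succ']
      exact Ideal.mul_mem_mul hu (ih hv)
    | add u _ v _ hu hv => rw [map_add]; exact Ideal.add_mem _ hu hv

/-- The operator `x + x F - c`. -/
def shiftedTwisted (F : A) (x : Lie K A) (c : K) : Module.End K A := twisted F x - algebraMap K _ c

theorem shiftedTwisted_apply (F : A) (x : Lie K A) (c : K) (a : A) :
    shiftedTwisted F x c a =
      (x : Derivation K A A) a + ((x : Derivation K A A) F - algebraMap K A c) * a := by
  rw [shiftedTwisted, LinearMap.sub_apply, twisted_apply, Module.algebraMap_end_apply,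
    Algebra.smul_def]
  ring

theorem shiftedTwisted_mem {I : Ideal A} (F : A) (x : Lie K A) (c : K) {n : ℕ} {a : A}
    (ha : a ∈ I ^ (n + 1)) : shiftedTwisted F x c a ∈ I ^ n := by
  rw [shiftedTwisted_apply]
  exact Ideal.add_mem _ (derivation_mem_pow _ ha)
    (Ideal.mul_mem_left _ _ (Ideal.pow_le_pow_right (Nat.le_succ n) ha))

theorem prod_shiftedTwisted_mem {I : Ideal A} (F : A) (x : σ → Lie K A) (c : σ → K) (w : List σ)
    {n : ℕ} {a : A} (ha : a ∈ I ^ (n + w.length)) :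
    (w.map fun s => shiftedTwisted F (x s) (c s)).prod a ∈ I ^ n := by
  induction w generalizing n with
  | nil => simpa using ha
  | cons s w ih =>
    rw [List.map_cons, List.prod_cons, Module.End.mul_apply]
    refine shiftedTwisted_mem F _ _ (ih ?_)
    rwa [List.length_cons, ← add_assoc, add_right_comm] at ha

variable [Fintype σ] {F : A} {x : σ → Lie K A} {c : σ → K} {y : σ → A}

/-- To leading order the operator is the partial derivative in the s-th coordinate: x_s(y_j) is
δ_{sj} modulo the augmentation ideal, and the zeroth order part does not lower the order of
vanishing. -/
theorem shiftedTwisted_monomial [DecidableEq σ] (hy : ∀ j, y j ∈ augmentation K A)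
    (hxy : ∀ i j, Coalgebra.counit (R := K) ((x i : Derivation K A A) (y j)) = if i = j then 1 else 0)
    (s : σ) (b : σ →₀ ℕ) (r : K) :
    shiftedTwisted F (x s) (c s) (MvPolynomial.aeval y (MvPolynomial.monomial b r)) -
      MvPolynomial.aeval y (MvPolynomial.monomial (b - Finsupp.single s 1) (r * b s)) ∈
        augmentation K A ^ b.degree := by
  have h1 : MvPolynomial.aeval y (MvPolynomial.monomial (b - Finsupp.single s 1) (r * b s)) =
      ∑ j, MvPolynomial.aeval y (MvPolynomial.pderiv j (MvPolynomial.monomial b r)) *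
        algebraMap K A (if s = j then 1 else 0) := by
    rw [Finset.sum_eq_single s]
    · simp [MvPolynomial.pderiv_monomial]
    · intro j _ hj
      rw [if_neg hj.symm, map_zero, mul_zero]
    · simp
  rw [shiftedTwisted_apply, derivation_aeval, h1, add_sub_right_comm, ← Finset.sum_sub_distrib]
  refine Ideal.add_mem _ (Ideal.sum_mem _ fun j _ => ?_)
    (Ideal.mul_mem_left _ _ (aeval_monomial_mem hy b r))
  rw [← mul_sub]
  have h2 : (x s : Derivation K A A) (y j) - algebraMap K A (if s = j then 1 else 0) ∈
      augmentation K A := by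
    rw [← hxy s j]
    exact sub_counit_mem_augmentation _
  rw [MvPolynomial.pderiv_monomial]
  by_cases hb : b j = 0
  · rw [hb, Nat.cast_zero, mul_zero, MvPolynomial.monomial_zero, map_zero, zero_mul]
    exact Ideal.zero_mem _
  · have h3 : b = (b - Finsupp.single j 1) + Finsupp.single j 1 :=
      (tsub_add_cancel_of_le (Finsupp.single_le_iff.2 (Nat.one_le_iff_ne_zero.2 hb))).symm
    have h4 : b.degree = (b - Finsupp.single j 1).degree + 1 := by
      conv_lhs => rw [h3, map_add, Finsupp.degree_single]
    rw [h4, pow_succ]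
    exact Ideal.mul_mem_mul (aeval_monomial_mem hy _ _) h2

/-- A word as long as the degree of the monomial only sees leading terms, so it acts as an iterated
partial derivative. The error terms end up in the augmentation ideal and are killed by the counit.
-/
theorem counit_prod_shiftedTwisted_monomial [DecidableEq σ] (hy : ∀ j, y j ∈ augmentation K A)
    (hxy : ∀ i j, Coalgebra.counit (R := K) ((x i : Derivation K A A) (y j)) = if i = j then 1 else 0)
    (w : List σ) (b : σ →₀ ℕ) (r : K) (hb : b.degree = w.length) :
    Coalgebra.counit (R := K) ((w.map fun s => shiftedTwisted F (x s) (c s)).prod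
      (MvPolynomial.aeval y (MvPolynomial.monomial b r))) =
      if ∀ s, w.count s = b s then r * ∏ s, ((b s).factorial : K) else 0 := by
  induction w using List.reverseRecOn generalizing b r with
  | nil =>
    rw [List.length_nil, Finsupp.degree_eq_zero_iff] at hb
    subst hb
    simp
  | append_singleton w s ih =>
    rw [List.length_append, List.length_singleton] at hb
    rw [List.map_append, List.prod_append, Module.End.mul_apply, List.map_singleton,
      List.prod_singleton]
    have h1 := prod_shiftedTwisted_mem F x c w (n := 1) (by
      have := shiftedTwisted_monomial (F := F) (c := c) hy hxy s b r
      rwa [hb, add_comm] at this)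
    rw [pow_one, map_sub, mem_augmentation, map_sub, sub_eq_zero] at h1
    rw [h1]
    by_cases hbs : b s = 0
    · rw [hbs, Nat.cast_zero, mul_zero, MvPolynomial.monomial_zero, map_zero, map_zero, map_zero,
        if_neg]
      intro h
      have := h s
      simp [hbs] at this
    · have h3 : (b - Finsupp.single s 1) + Finsupp.single s 1 = b :=
        tsub_add_cancel_of_le (Finsupp.single_le_iff.2 (Nat.one_le_iff_ne_zero.2 hbs))
      set b' := b - Finsupp.single s 1 with hb'
      have h4 : b'.degree = w.length := by
        have := congrArg Finsupp.degree h3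
        rw [map_add, Finsupp.degree_single] at this
        omega
      rw [ih b' _ h4]
      have h5 : ∀ t, b t = b' t + if t = s then 1 else 0 := fun t => by
        rw [← h3, Finsupp.add_apply, Finsupp.single_apply]
        simp only [eq_comm]
      have h6 : (∀ t, (w ++ [s]).count t = b t) ↔ ∀ t, w.count t = b' t := by
        refine forall_congr' fun t => ?_
        rw [h5, List.count_append, List.count_singleton]
        by_cases hts : t = s
        · simp [hts]
        · simp [hts, Ne.symm hts]
      have h7 : ∏ t, ((b t).factorial : K) = (b s : K) * ∏ t, ((b' t).factorial : K) := by
        rw [← Finset.mul_prod_erase _ _ (Finset.mem_univ s),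
          ← Finset.mul_prod_erase _ (fun t => ((b' t).factorial : K)) (Finset.mem_univ s),
          ← mul_assoc]
        congr 1
        · rw [h5 s, if_pos rfl, Nat.factorial_succ, Nat.cast_mul]
        · refine Finset.prod_congr rfl fun t ht => ?_
          rw [h5 t, if_neg (Finset.ne_of_mem_erase ht), add_zero]
      simp only [h6, h7, mul_assoc]

end Monomials

section Independence

variable {K : Type*} [Field K] {A : Type*} [CommRing A] [HopfAlgebra K A] {σ : Type*} [Fintype σ]
  (p : ℕ) [Fact p.Prime] [CharP K p]

/-- The restricted ordered monomials in a basis of `𝔤`, shifted by scalars, are linearly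
independent in `U_χ(𝔤)`. -/
theorem linearIndependent_monomials (x : Module.Basis σ K (Lie K A)) (χ : Module.Dual K (Lie K A))
    (c : σ → K) {l : List σ} (hl : l.Nodup) (hl' : ∀ s, s ∈ l) :
    LinearIndependent K (fun a : σ → Fin p => ((ordWord l fun s => (a s : ℕ)).map fun s =>
      toRedEnv p χ (x s) - algebraMap K _ (c s)).prod) := by
  classical
  obtain ⟨F, hF⟩ := exists_potential x χ
  obtain ⟨y, hy, hxy⟩ := exists_coordinates x.linearIndependent
  set Φ := liftRedEnv p χ (twistedRep p F) (twistedRep_pow p hF) with hΦ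
  have hΦ1 : ∀ (w : List σ) (a : A),
      Φ (w.map fun s => toRedEnv p χ (x s) - algebraMap K _ (c s)).prod (frobMk p a) =
        frobMk p ((w.map fun s => shiftedTwisted F (x s) (c s)).prod a) := by
    intro w a
    induction w with
    | nil => simp
    | cons s w ih =>
      rw [List.map_cons, List.prod_cons, map_mul, Module.End.mul_apply, ih, map_sub,
        AlgHom.commutes, liftRedEnv_toRedEnv, LinearMap.sub_apply, twistedRep_frobMk,
        Module.algebraMap_end_apply, ← map_smul, ← map_sub, List.map_cons, List.prod_cons]
      rfl
  have hev : ∀ a : A, evalOne p (frobMk (K := K) p a) = Coalgebra.counit (R := K) a := fun a => rfl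
  rw [Fintype.linearIndependent_iff]
  intro k hk
  by_contra! hne
  -- Test the relation on the coordinate monomial with exponents a₀, of maximal total degree among
  -- the terms that occur. Shorter words leave it in the augmentation ideal, and other words of the
  -- same length have the wrong letter counts.
  obtain ⟨a₀, h0, hmax⟩ := Finset.exists_max_image
    (Finset.univ.filter fun a : σ → Fin p => k a ≠ 0) (fun a => ∑ s, (a s : ℕ))
    (by obtain ⟨a, ha⟩ := hne; exact ⟨a, by simp [ha]⟩)
  rw [Finset.mem_filter] at h0
  let b : σ →₀ ℕ := Finsupp.equivFunOnFinite.symm fun s => (a₀ s : ℕ)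
  have hb : ∀ s, b s = a₀ s := fun s => rfl
  have hbd : b.degree = ∑ s, (a₀ s : ℕ) := by
    rw [Finsupp.degree_eq_sum]
    exact Finset.sum_congr rfl fun s _ => hb s
  have h1 := congrArg (fun u => evalOne p (Φ u
    (frobMk p (MvPolynomial.aeval y (MvPolynomial.monomial b (1 : K)))))) hk
  simp only [map_sum, map_smul, LinearMap.sum_apply, LinearMap.smul_apply, hΦ1, hev, map_zero,
    LinearMap.zero_apply] at h1
  rw [Finset.sum_eq_single a₀] at h1
  · rw [counit_prod_shiftedTwisted_monomial hy hxy _ _ _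
      (by rw [length_ordWord hl hl', hbd]), if_pos (fun s => by rw [count_ordWord hl hl', hb]),
      one_mul, smul_eq_mul] at h1
    refine (mul_ne_zero h0.2 (Finset.prod_ne_zero_iff.2 fun s _ => ?_)) h1
    -- This is where restriction of the exponents enters: factorials of numbers below p are nonzero
    -- in K.
    rw [Ne, CharP.cast_eq_zero_iff K p, (Fact.out : p.Prime).dvd_factorial, not_le, hb]
    exact (a₀ s).2
  · intro a _ ha
    by_cases hka : k a = 0
    · rw [hka, zero_smul]
    have hle := hmax a (by simp [hka])
    rcases hle.lt_or_eq with hlt | heq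
    · have h2 := prod_shiftedTwisted_mem F x c (ordWord l fun s => (a s : ℕ)) (n := 1)
        (Ideal.pow_le_pow_right (I := augmentation K A) (by
          rw [length_ordWord hl hl', hbd]; omega) (aeval_monomial_mem hy b (1 : K)))
      rw [pow_one, mem_augmentation] at h2
      rw [h2, smul_zero]
    · rw [counit_prod_shiftedTwisted_monomial hy hxy _ _ _
        (by rw [length_ordWord hl hl', hbd, heq]), if_neg, smul_zero]
      intro h
      refine ha (funext fun s => Fin.ext ?_)
      have := h s
      rwa [count_ordWord hl hl', hb] at this
  · intro h
    exact absurd (Finset.mem_univ _) h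

end Independence

/-! ### The basis of a baby Verma module -/

section General

theorem iSupIndep_span_fiber {K V α Q : Type*} [Field K] [AddCommGroup V] [Module K V] {v : α → V}
    (hv : LinearIndependent K v) (deg : α → Q) :
    iSupIndep fun ξ => Submodule.span K (v '' {a | deg a = ξ}) := by
  intro ξ
  refine (hv.disjoint_span_image (s := {a | deg a = ξ}) (t := {a | deg a ≠ ξ})
    (Set.disjoint_left.2 fun a h h' => h' h)).mono_right ?_
  refine iSup₂_le fun η hη => Submodule.span_mono (Set.image_mono ?_)
  rintro a rfl
  exact hη

theorem iSup_span_fiber {K V α Q : Type*} [Field K] [AddCommGroup V] [Module K V] {v : α → V}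
    (hv : Submodule.span K (Set.range v) = ⊤) (deg : α → Q) :
    ⨆ ξ, Submodule.span K (v '' {a | deg a = ξ}) = ⊤ := by
  rw [eq_top_iff, ← hv, Submodule.span_le]
  rintro _ ⟨a, rfl⟩
  exact Submodule.mem_iSup_of_mem (deg a) (Submodule.subset_span ⟨a, rfl, rfl⟩)

theorem sub_algebraMap_pow_char {K U : Type*} [Field K] [Ring U] [Algebra K U] (p : ℕ)
    [Fact p.Prime] [CharP K p] (u : U) (c : K) :
    (u - algebraMap K U c) ^ p = u ^ p - algebraMap K U (c ^ p) := by
  rcases subsingleton_or_nontrivial U with hU | hU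
  · exact Subsingleton.elim _ _
  have : CharP U p := charP_of_injective_algebraMap (algebraMap K U).injective p
  rw [sub_pow_char_of_commute (R := U) p (Algebra.commutes c u).symm, map_pow]

theorem sub_algebraMap_commutator {K U : Type*} [Field K] [Ring U] [Algebra K U] (u v : U)
    (a c : K) : (u - algebraMap K U a) * (v - algebraMap K U c) -
      (v - algebraMap K U c) * (u - algebraMap K U a) = u * v - v * u := by
  have h1 := Algebra.commutes a (v - algebraMap K U c)
  have h2 := Algebra.commutes c u
  rw [sub_mul, mul_sub, mul_sub (v - _) u, ← h1, sub_mul, h2]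
  abel

/-- With weight 1 on each letter, this preorder only remembers whether a word is nonempty. It serves
to show that straightening a nonempty word produces no constant term. -/
theorem span_range_le_shortWords {K σ U : Type*} [Field K] [Ring U] [Algebra K U] (x : σ → U) {n k : ℕ}
    (hn : 1 < n) : Submodule.span K (Set.range x) ≤
      shortWords K x (fun _ => (1 : ℕ)) (fun a b => b ≠ 0 → a ≠ 0) n k := by
  refine Submodule.span_mono ?_
  rintro _ ⟨s, rfl⟩
  exact ⟨[s], by simpa using hn, by simp, by simp⟩

end General

/-! ### Commutators and p-th powers in a triangular decomposition. -/

namespace ClosedTorus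

namespace TriangularData

variable {K : Type*} [Field K] {A : Type*} [CommRing A] [HopfAlgebra K A]
  {X : Type*} [AddCommGroup X] {T : ClosedTorus K A X}
  {ι Y : Type*} [AddCommGroup Y] {P : RootDatum ι X Y}
  {p : ℕ} [Fact p.Prime] [CharP K p] {b : P.Base} {D : ℕ} (d : T.TriangularData p b D)
  {Q : Type*} [AddCommGroup Q] (q : X →+ Q)

/-- The order on weights: same degree and greater height. -/
def weightLe (μ ν : X) : Prop := q μ = q ν ∧ d.ht ν ≤ d.ht μ

theorem isAddPreorder_weightLe : IsAddPreorder (d.weightLe q) where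
  refl a := ⟨rfl, le_rfl⟩
  trans a b c h h' := ⟨h.1.trans h'.1, h'.2.trans h.2⟩
  add_left a b c h := by
    refine ⟨?_, ?_⟩
    · rw [map_add, map_add, h.1]
    · rw [map_add, map_add]
      exact add_le_add_right h.2 _

/-- The weight of `f_j`. -/
def wt (j : Fin D) : X := -P.root (d.γ j)

theorem f_mem_wt (j : Fin D) : d.f j ∈ T.weightSpace (d.wt j) := d.f_mem j

theorem ht_wt_neg (j : Fin D) : d.ht (d.wt j) < 0 := by
  rw [wt, map_neg, neg_lt_zero]
  exact d.ht_pos j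

/-- `ψ` vanishes on `𝔟`, and on the `f_j` whose degree is nonzero. -/
structure Compatible (ψ : Module.Dual K (Lie K A)) : Prop where
  cartan : ∀ h ∈ T.lie, ψ h = 0
  pos : ∀ j, ψ (d.e j) = 0
  neg : ∀ j, ψ (d.f j) ≠ 0 → q (P.root (d.γ j)) = 0

theorem span_range : ⊤ ≤ Submodule.span K (Set.range
    (Sum.elim d.f (Sum.elim (fun k => (d.h k : Lie K A)) d.e))) := by
  rw [← d.iSup_weightSpace]
  refine iSup_le fun ν x hx => ?_
  rcases d.mem_weightSpace ν x hx with rfl | ⟨-, hx⟩ | ⟨j, -, c, rfl⟩ | ⟨j, -, c, rfl⟩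
  · exact Submodule.zero_mem _
  · have h1 : (⟨x, hx⟩ : T.lie) ∈ Submodule.span K (Set.range d.h) := by
      rw [d.h.span_eq]; trivial
    have h2 := Submodule.mem_map_of_mem (f := T.lie.subtype) h1
    rw [Submodule.map_span] at h2
    refine Submodule.span_mono ?_ h2
    rintro _ ⟨_, ⟨k, rfl⟩, rfl⟩
    exact ⟨Sum.inr (Sum.inl k), rfl⟩
  · exact Submodule.smul_mem _ _ (Submodule.subset_span ⟨Sum.inr (Sum.inr j), rfl⟩)
  · exact Submodule.smul_mem _ _ (Submodule.subset_span ⟨Sum.inl j, rfl⟩)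

/-- The basis of `𝔤` formed by the `f_j`, a basis of `𝔱` and the `e_j`. -/
def basis : Module.Basis (Fin D ⊕ (Fin d.r ⊕ Fin D)) K (Lie K A) :=
  Module.Basis.mk d.linearIndependent d.span_range

theorem basis_apply (s) :
    d.basis s = Sum.elim d.f (Sum.elim (fun k => (d.h k : Lie K A)) d.e) s := by
  rw [basis, Module.Basis.mk_apply]

/-- The weight of the bracket has negative height, which excludes 𝔱 and the positive root spaces. -/
theorem bracket_f (i j : Fin D) [IsAlgClosed K] [Module.Free ℤ X] : ⁅d.f i, d.f j⁆ = 0 ∨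
    ∃ k, d.wt k = d.wt i + d.wt j ∧ ∃ c : K, ⁅d.f i, d.f j⁆ = c • d.f k := by
  have h1 := T.lie_mem_weightSpace (d.f_mem_wt i) (d.f_mem_wt j)
  have hlt : d.ht (d.wt i + d.wt j) < 0 := by
    rw [map_add]
    exact add_neg (d.ht_wt_neg i) (d.ht_wt_neg j)
  rcases d.mem_weightSpace _ _ h1 with h | ⟨h, -⟩ | ⟨k, h, -⟩ | ⟨k, h, c, h'⟩
  · exact Or.inl h
  · rw [h, map_zero] at hlt
    exact absurd hlt (lt_irrefl _)
  · rw [h] at hlt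
    exact absurd hlt (d.ht_pos k).not_gt
  · exact Or.inr ⟨k, h.symm, c, h'⟩

theorem bracket_e (i j : Fin D) [IsAlgClosed K] [Module.Free ℤ X] :
    ∃ k, ∃ c : K, ⁅d.e i, d.e j⁆ = c • d.e k := by
  have h1 := T.lie_mem_weightSpace (d.e_mem i) (d.e_mem j)
  have hlt : 0 < d.ht (P.root (d.γ i) + P.root (d.γ j)) := by
    rw [map_add]
    exact add_pos (d.ht_pos i) (d.ht_pos j)
  rcases d.mem_weightSpace _ _ h1 with h | ⟨h, -⟩ | ⟨k, -, c, h⟩ | ⟨k, h, -⟩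
  · exact ⟨i, 0, by rw [h, zero_smul]⟩
  · rw [h, map_zero] at hlt
    exact absurd hlt (lt_irrefl _)
  · exact ⟨k, c, h⟩
  · rw [h] at hlt
    exact absurd hlt (d.ht_wt_neg k).not_gt

theorem eq_smul_e_of_isPos {i : ι} (hi : b.IsPos i) {x : Lie K A}
    (hx : x ∈ T.weightSpace (P.root i)) : ∃ j, ∃ c : K, x = c • d.e j := by
  set j := d.γ.symm ⟨i, hi⟩ with hj
  have hij : P.root i = P.root (d.γ j) := by rw [hj, Equiv.apply_symm_apply]
  have hlt : 0 < d.ht (P.root i) := hij ▸ d.ht_pos j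
  rcases d.mem_weightSpace _ _ hx with h | ⟨h, -⟩ | ⟨k, -, c, h⟩ | ⟨k, h, -⟩
  · exact ⟨j, 0, by rw [h, zero_smul]⟩
  · rw [h, map_zero] at hlt
    exact absurd hlt (lt_irrefl _)
  · exact ⟨k, c, h⟩
  · rw [h] at hlt
    exact absurd hlt (d.ht_wt_neg k).not_gt

variable {q} {ψ : Module.Dual K (Lie K A)}

theorem toRedEnv_bracket (x y : Lie K A) : toRedEnv p ψ x * toRedEnv p ψ y -
    toRedEnv p ψ y * toRedEnv p ψ x = toRedEnv p ψ ⁅x, y⁆ := by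
  rw [LieHom.map_lie, LieRing.of_associative_ring_bracket]

/-- The generators `h - dν(h)` and `e_j` of the left ideal defining `Z_ψ(ν)`. -/
def borelLetter (ψ : Module.Dual K (Lie K A)) (ν : X) : Fin d.r ⊕ Fin D → RedEnv p ψ :=
  Sum.elim (fun k => toRedEnv p ψ (d.h k : Lie K A) - algebraMap K _ (T.differential ν (d.h k)))
    (fun j => toRedEnv p ψ (d.e j))

theorem borelLetter_inl (ν : X) (k : Fin d.r) : d.borelLetter ψ ν (Sum.inl k) =
    toRedEnv p ψ (d.h k : Lie K A) - algebraMap K _ (T.differential ν (d.h k)) := rfl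

theorem borelLetter_inr (ν : X) (j : Fin D) :
    d.borelLetter ψ ν (Sum.inr j) = toRedEnv p ψ (d.e j) := rfl

variable (ψ) in
theorem cartan_mem_span_borelLetter (ν : X) (h : T.lie) :
    toRedEnv p ψ (h : Lie K A) - algebraMap K _ (T.differential ν h) ∈
      Submodule.span K (Set.range (d.borelLetter ψ ν)) := by
  let L : T.lie →ₗ[K] RedEnv p ψ := (toRedEnv p ψ : Lie K A →ₗ[K] RedEnv p ψ) ∘ₗ T.lie.subtype -
    Algebra.linearMap K _ ∘ₗ T.differential ν
  have h1 : h ∈ Submodule.span K (Set.range d.h) := by rw [d.h.span_eq]; trivial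
  have h2 := Submodule.mem_map_of_mem (f := L) h1
  rw [Submodule.map_span] at h2
  refine Submodule.span_mono ?_ h2
  rintro _ ⟨_, ⟨k, rfl⟩, rfl⟩
  exact ⟨Sum.inl k, rfl⟩

variable [IsAlgClosed K] [Module.Free ℤ X]

/-- Commutators of the f_j preserve weights exactly. The power f_j^p is the scalar ψ(f_j)^p, and
deleting it raises the height; when the scalar is nonzero the degree is unchanged by `Compatible`.
So straightening moves down `weightLe` even though weights in X are not preserved. -/
theorem prod_f_mem_restrictedMonomials (hψ : d.Compatible q ψ) (w : List (Fin D)) :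
    (w.map fun j => toRedEnv p ψ (d.f j)).prod ∈ restrictedMonomials K
      (fun j => toRedEnv p ψ (d.f j)) d.wt (d.weightLe q) Finset.univ.toList p
        (w.map d.wt).sum := by
  refine prod_mem_restrictedMonomials (d.isAddPreorder_weightLe q) (Finset.nodup_toList _)
    (fun s => Finset.mem_toList.2 (Finset.mem_univ s)) ?_ ?_ w
  · intro i j
    rw [toRedEnv_bracket]
    rcases d.bracket_f i j with h | ⟨k, hk, c, h⟩
    · rw [h, map_zero]
      exact Submodule.zero_mem _
    · rw [h, map_smul]
      refine Submodule.smul_mem _ _ (Submodule.subset_span ⟨[k], by simp, ?_, by simp⟩)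
      simpa [hk] using (d.isAddPreorder_weightLe q).refl _
  · intro j
    rw [toRedEnv_pow, d.pPow_f, map_zero, zero_add]
    by_cases h0 : ψ (d.f j) = 0
    · rw [h0, zero_pow (Fact.out : p.Prime).ne_zero, map_zero]
      exact Submodule.zero_mem _
    · rw [Algebra.algebraMap_eq_smul_one]
      refine Submodule.smul_mem _ _
        (Submodule.subset_span ⟨[], (Fact.out : p.Prime).pos, ⟨?_, ?_⟩, by simp⟩)
      · rw [List.map_nil, List.sum_nil, map_zero, map_nsmul, wt, map_neg, hψ.neg j h0, neg_zero,
          smul_zero]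
      · rw [List.map_nil, List.sum_nil, map_zero, map_nsmul]
        exact smul_nonpos_of_nonneg_of_nonpos (Nat.zero_le p) (d.ht_wt_neg j).le

/-- Subtracting scalars does not affect commutators, and commutators in 𝔟 lie in 𝔫⁺. Hence no
element of 𝔱, whose rewriting would leave a constant, appears. -/
theorem borelLetter_commutator_mem (ν : X) (s t : Fin d.r ⊕ Fin D) :
    d.borelLetter ψ ν s * d.borelLetter ψ ν t - d.borelLetter ψ ν t * d.borelLetter ψ ν s ∈
      Submodule.span K (Set.range (d.borelLetter ψ ν)) := by
  have he : ∀ j, toRedEnv p ψ (d.e j) ∈ Submodule.span K (Set.range (d.borelLetter ψ ν)) :=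
    fun j => Submodule.subset_span ⟨Sum.inr j, rfl⟩
  rcases s with k | i <;> rcases t with k' | j
  · rw [borelLetter_inl, borelLetter_inl, sub_algebraMap_commutator, toRedEnv_bracket,
      T.cartan_lie _ (T.lie_le_weightSpace_zero (d.h k').2),
      ← differentialHom_apply, map_zero, LinearMap.zero_apply, zero_smul, map_zero]
    exact Submodule.zero_mem _
  · have := sub_algebraMap_commutator (toRedEnv p ψ (d.h k : Lie K A)) (toRedEnv p ψ (d.e j))
      (T.differential ν (d.h k)) 0
    rw [map_zero, sub_zero] at this
    rw [borelLetter_inl, borelLetter_inr, this, toRedEnv_bracket, T.cartan_lie _ (d.e_mem j),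
      map_smul]
    exact Submodule.smul_mem _ _ (he j)
  · have := sub_algebraMap_commutator (toRedEnv p ψ (d.e i)) (toRedEnv p ψ (d.h k' : Lie K A)) 0
      (T.differential ν (d.h k'))
    rw [map_zero, sub_zero] at this
    rw [borelLetter_inl, borelLetter_inr, this, toRedEnv_bracket, ← lie_skew,
      T.cartan_lie _ (d.e_mem i), map_neg, map_smul]
    exact Submodule.neg_mem _ (Submodule.smul_mem _ _ (he i))
  · obtain ⟨k, c, h⟩ := d.bracket_e i j
    rw [borelLetter_inr, borelLetter_inr, toRedEnv_bracket, h, map_smul]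
    exact Submodule.smul_mem _ _ (he k)

/-- Since ψ vanishes on 𝔱 and dν(h)^p = dν(h^[p]), the p-th power of h - dν(h) is h^[p] - dν(h^[p]),
again without a constant term. -/
theorem borelLetter_pow_mem (hψ : d.Compatible q ψ) (ν : X) (s : Fin d.r ⊕ Fin D) :
    d.borelLetter ψ ν s ^ p ∈ Submodule.span K (Set.range (d.borelLetter ψ ν)) := by
  have hp := (Fact.out : p.Prime)
  rcases s with k | j
  · rw [borelLetter_inl, sub_algebraMap_pow_char, toRedEnv_pow,
      hψ.cartan _ (d.h k).2, zero_pow hp.ne_zero, map_zero, add_zero,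
      ← T.differential_pPow p (d.h k) ν]
    exact d.cartan_mem_span_borelLetter ψ ν ⟨_, T.pPow_mem_lie p (d.h k).2⟩
  · rw [borelLetter_inr, toRedEnv_pow, d.pPow_e, hψ.pos, zero_pow hp.ne_zero, map_zero, map_zero,
      add_zero]
    exact Submodule.zero_mem _

/-- Nonempty words in the letters `h - dν(h)` and `e_j` are combinations of nonconstant restricted
ordered monomials in these. -/
theorem prod_borelLetter_mem_restrictedMonomials (hψ : d.Compatible q ψ) (ν : X)
    (w : List (Fin d.r ⊕ Fin D)) :
    (w.map (d.borelLetter ψ ν)).prod ∈ restrictedMonomials K (d.borelLetter ψ ν)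
      (fun _ => (1 : ℕ)) (fun a b => b ≠ 0 → a ≠ 0) Finset.univ.toList p
        (w.map fun _ => (1 : ℕ)).sum := by
  have hle : IsAddPreorder (fun a b : ℕ => b ≠ 0 → a ≠ 0) :=
    ⟨fun a h => h, fun a b c h h' h'' => h (h' h''), fun a b c h h' => by omega⟩
  refine prod_mem_restrictedMonomials hle (Finset.nodup_toList _)
    (fun s => Finset.mem_toList.2 (Finset.mem_univ s)) (fun s t => ?_) (fun s => ?_) w
  · exact span_range_le_shortWords _ one_lt_two (d.borelLetter_commutator_mem ν s t)
  · exact span_range_le_shortWords _ (Fact.out : p.Prime).one_lt (d.borelLetter_pow_mem hψ ν s)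

end TriangularData

end ClosedTorus

/-! ### The generator of a baby Verma module and spanning by monomials. -/

section BabyVerma

variable {K : Type*} [Field K] {A : Type*} [CommRing A] [HopfAlgebra K A]
  (p : ℕ) [Fact p.Prime] [CharP K p]
  {X : Type*} [AddCommGroup X] (T : ClosedTorus K A X)
  {ι Y : Type*} [AddCommGroup Y] {P : RootDatum ι X Y} (b : P.Base)
  (ψ : Module.Dual K (Lie K A)) (ν : X)

/-- The generator `1 ⊗ 1` of `Z_ψ(ν)`. -/
def highestVector : BabyVerma p T b ψ ν := (babyVermaIdeal p T b ψ ν).mkQ 1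

theorem mkQ_eq_smul (u : RedEnv p ψ) :
    (babyVermaIdeal p T b ψ ν).mkQ u = u • highestVector p T b ψ ν := by
  rw [highestVector]
  exact (congrArg _ (mul_one u).symm).trans (map_smul (babyVermaIdeal p T b ψ ν).mkQ u 1)

theorem exists_eq_smul_highestVector (z : BabyVerma p T b ψ ν) :
    ∃ u : RedEnv p ψ, z = u • highestVector p T b ψ ν := by
  obtain ⟨u, rfl⟩ := Submodule.mkQ_surjective (babyVermaIdeal p T b ψ ν) z
  exact ⟨u, mkQ_eq_smul p T b ψ ν u⟩

theorem smul_highestVector_eq_zero {u : RedEnv p ψ} (hu : u ∈ babyVermaIdeal p T b ψ ν) :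
    u • highestVector p T b ψ ν = 0 := by
  rw [← mkQ_eq_smul]
  exact (Submodule.Quotient.mk_eq_zero _).2 hu

theorem rootVector_smul_highestVector {i : ι} (hi : b.IsPos i) {x : Lie K A}
    (hx : x ∈ T.weightSpace (P.root i)) : toRedEnv p ψ x • highestVector p T b ψ ν = 0 :=
  smul_highestVector_eq_zero _ _ _ _ _ (Ideal.subset_span (Or.inl ⟨i, hi, x, hx, rfl⟩))

theorem cartan_smul_highestVector (h : T.lie) :
    toRedEnv p ψ (h : Lie K A) • highestVector p T b ψ ν =
      T.differential ν h • highestVector p T b ψ ν := by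
  rw [← sub_eq_zero, ← algebraMap_smul (RedEnv p ψ) (T.differential ν h), ← sub_smul]
  exact smul_highestVector_eq_zero _ _ _ _ _ (Ideal.subset_span (Or.inr ⟨h, rfl⟩))

theorem bracket_eq_smul (x : Lie K A) (z : BabyVerma p T b ψ ν) : ⁅x, z⁆ = toRedEnv p ψ x • z := rfl

end BabyVerma

namespace ClosedTorus

namespace TriangularData

variable {K : Type*} [Field K] {A : Type*} [CommRing A] [HopfAlgebra K A]
  {X : Type*} [AddCommGroup X] {T : ClosedTorus K A X}
  {ι Y : Type*} [AddCommGroup Y] {P : RootDatum ι X Y}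
  {p : ℕ} [Fact p.Prime] [CharP K p] {b : P.Base} {D : ℕ} (d : T.TriangularData p b D)
  {Q : Type*} [AddCommGroup Q] (q : X →+ Q) (ψ : Module.Dual K (Lie K A)) (ν : X)

/-- The product in `U_ψ(𝔤)` of a word in the letters `f_j`. -/
def fProd (w : List (Fin D)) : RedEnv p ψ := (w.map fun j => toRedEnv p ψ (d.f j)).prod

theorem fProd_cons (j : Fin D) (w : List (Fin D)) :
    d.fProd ψ (j :: w) = toRedEnv p ψ (d.f j) * d.fProd ψ w := by
  rw [fProd, fProd, List.map_cons, List.prod_cons]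

/-- The restricted ordered monomial `f ^ a ⊗ 1` in `Z_ψ(ν)`. -/
def monomial (a : Fin D → Fin p) : BabyVerma p T b ψ ν :=
  d.fProd ψ (ordWord Finset.univ.toList fun j => (a j : ℕ)) • highestVector p T b ψ ν

/-- The weight of `f ^ a ⊗ 1` in `Z_ψ(ν)`. -/
def monomialWeight (a : Fin D → Fin p) : X := ν + ∑ j, (a j : ℕ) • d.wt j

theorem sum_map_wt_ordWord (a : Fin D → ℕ) :
    ((ordWord Finset.univ.toList a).map d.wt).sum = ∑ j, a j • d.wt j :=
  sum_map_ordWord (Finset.nodup_toList _) (fun s => Finset.mem_toList.2 (Finset.mem_univ s)) _ _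

/-- The span in `Z_ψ(ν)` of the words in the `f_j` of weight at least `κ` and of the degree
of `κ`. -/
def weightFiltration (κ : X) : Submodule K (BabyVerma p T b ψ ν) :=
  Submodule.span K {z | ∃ w : List (Fin D), d.weightLe q (ν + (w.map d.wt).sum) κ ∧
    z = d.fProd ψ w • highestVector p T b ψ ν}

theorem weightFiltration_mono {κ κ' : X} (h : d.weightLe q κ κ') :
    d.weightFiltration q ψ ν κ ≤ d.weightFiltration q ψ ν κ' :=
  Submodule.span_mono fun _ ⟨w, h1, h2⟩ => ⟨w, (d.isAddPreorder_weightLe q).trans _ _ _ h1 h, h2⟩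

theorem highestVector_mem_weightFiltration :
    highestVector p T b ψ ν ∈ d.weightFiltration q ψ ν ν :=
  Submodule.subset_span ⟨[], by simpa using (d.isAddPreorder_weightLe q).refl ν, by simp [fProd]⟩

theorem f_smul_mem_weightFiltration (j : Fin D) {κ : X} {z : BabyVerma p T b ψ ν}
    (hz : z ∈ d.weightFiltration q ψ ν κ) :
    toRedEnv p ψ (d.f j) • z ∈ d.weightFiltration q ψ ν (κ + d.wt j) := by
  induction hz using Submodule.span_induction with
  | mem z hz =>
    obtain ⟨w, h1, rfl⟩ := hz
    refine Submodule.subset_span ⟨j :: w, ?_, ?_⟩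
    · have := (d.isAddPreorder_weightLe q).add_left _ _ (d.wt j) h1
      rwa [add_left_comm, add_comm _ κ] at this
    · rw [fProd_cons, mul_smul]
  | zero => rw [smul_zero]; exact Submodule.zero_mem _
  | add z z' _ _ h h' => rw [smul_add]; exact Submodule.add_mem _ h h'
  | smul c z _ h => rw [smul_algebra_smul_comm]; exact Submodule.smul_mem _ _ h

theorem smul_smul_eq_add (x y : Lie K A) (z : BabyVerma p T b ψ ν) :
    toRedEnv p ψ x • toRedEnv p ψ y • z =
      toRedEnv p ψ y • toRedEnv p ψ x • z + toRedEnv p ψ ⁅x, y⁆ • z := by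
  rw [← toRedEnv_bracket, sub_smul, mul_smul, mul_smul, add_sub_cancel]

variable [IsAlgClosed K] [Module.Free ℤ X]

/-- Move x to the right past each f_j. The correction [x, f_j] is again a weight vector, so the
induction runs over all weights at once; at the end x meets 1 ⊗ 1. -/
theorem smul_fProd_mem_weightFiltration (w : List (Fin D)) {μ : X} {x : Lie K A}
    (hx : x ∈ T.weightSpace μ) : toRedEnv p ψ x • d.fProd ψ w • highestVector p T b ψ ν ∈
      d.weightFiltration q ψ ν (ν + (w.map d.wt).sum + μ) := by
  induction w generalizing x μ with
  | nil =>
    simp only [fProd, List.map_nil, List.prod_nil, List.sum_nil, add_zero, one_smul]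
    rcases d.mem_weightSpace μ x hx with rfl | ⟨rfl, h⟩ | ⟨j, rfl, c, rfl⟩ | ⟨j, rfl, c, rfl⟩
    · rw [map_zero, zero_smul]
      exact Submodule.zero_mem _
    · rw [cartan_smul_highestVector p T b ψ ν ⟨x, h⟩, add_zero]
      exact Submodule.smul_mem _ _ (d.highestVector_mem_weightFiltration q ψ ν)
    · rw [rootVector_smul_highestVector p T b ψ ν (d.γ j).2 hx]
      exact Submodule.zero_mem _
    · rw [map_smul, smul_assoc]
      exact Submodule.smul_mem _ _ (d.f_smul_mem_weightFiltration q ψ ν j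
        (d.highestVector_mem_weightFiltration q ψ ν))
  | cons j w ih =>
    rw [fProd_cons, mul_smul, smul_smul_eq_add]
    refine Submodule.add_mem _ ?_ ?_
    · have := d.f_smul_mem_weightFiltration q ψ ν j (ih hx)
      rwa [show ν + (w.map d.wt).sum + μ + d.wt j = ν + ((j :: w).map d.wt).sum + μ by
        rw [List.map_cons, List.sum_cons]; abel] at this
    · have := ih (T.lie_mem_weightSpace hx (d.f_mem_wt j))
      rwa [show ν + (w.map d.wt).sum + (μ + d.wt j) = ν + ((j :: w).map d.wt).sum + μ by
        rw [List.map_cons, List.sum_cons]; abel] at this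

theorem smul_mem_weightFiltration {κ μ : X} {x : Lie K A} (hx : x ∈ T.weightSpace μ)
    {z : BabyVerma p T b ψ ν} (hz : z ∈ d.weightFiltration q ψ ν κ) :
    toRedEnv p ψ x • z ∈ d.weightFiltration q ψ ν (κ + μ) := by
  induction hz using Submodule.span_induction with
  | mem z hz =>
    obtain ⟨w, h1, rfl⟩ := hz
    refine d.weightFiltration_mono q ψ ν ?_ (d.smul_fProd_mem_weightFiltration q ψ ν w hx)
    rw [add_comm _ μ, add_comm κ]
    exact (d.isAddPreorder_weightLe q).add_left _ _ _ h1
  | zero => rw [smul_zero]; exact Submodule.zero_mem _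
  | add z z' _ _ h h' => rw [smul_add]; exact Submodule.add_mem _ h h'
  | smul c z _ h => rw [smul_algebra_smul_comm]; exact Submodule.smul_mem _ _ h

/-- `f ^ a ⊗ 1` is a weight vector for `𝔱`. -/
theorem cartan_smul_fProd (h : T.lie) (w : List (Fin D)) :
    toRedEnv p ψ (h : Lie K A) • d.fProd ψ w • highestVector p T b ψ ν =
      T.differential (ν + (w.map d.wt).sum) h • d.fProd ψ w • highestVector p T b ψ ν := by
  induction w with
  | nil => simpa [fProd] using cartan_smul_highestVector p T b ψ ν h
  | cons j w ih =>
    rw [fProd_cons, mul_smul, smul_smul_eq_add, ih, T.cartan_lie h (d.f_mem_wt j), map_smul,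
      smul_assoc, smul_algebra_smul_comm, ← add_smul]
    congr 1
    rw [List.map_cons, List.sum_cons, add_left_comm, add_comm (d.wt j), T.differential_add (_ + _)]
    rfl

theorem cartan_smul_monomial (h : T.lie) (a : Fin D → Fin p) :
    toRedEnv p ψ (h : Lie K A) • d.monomial ψ ν a =
      T.differential (d.monomialWeight ν a) h • d.monomial ψ ν a := by
  rw [monomial, cartan_smul_fProd, sum_map_wt_ordWord, monomialWeight]

variable {ψ} {q}

/-- Straighten each word in the f_j before applying it to 1 ⊗ 1. The resulting bound on the heights
of the monomials is what drives the filtration argument. -/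
theorem weightFiltration_le (hψ : d.Compatible q ψ) (κ : X) :
    d.weightFiltration q ψ ν κ ≤ Submodule.span K
      (d.monomial ψ ν '' {a | d.weightLe q (d.monomialWeight ν a) κ}) := by
  refine Submodule.span_le.2 ?_
  rintro _ ⟨w, h1, rfl⟩
  have h2 := d.prod_f_mem_restrictedMonomials hψ w
  let L : RedEnv p ψ →ₗ[K] BabyVerma p T b ψ ν :=
    (LinearMap.toSpanSingleton (RedEnv p ψ) _ (highestVector p T b ψ ν)).restrictScalars K
  have h3 := Submodule.mem_map_of_mem (f := L) h2
  rw [restrictedMonomials, Submodule.map_span] at h3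
  refine Submodule.span_mono ?_ h3
  rintro _ ⟨_, ⟨a, ha, h4, rfl⟩, rfl⟩
  refine ⟨fun j => ⟨a j, ha j⟩, ?_, rfl⟩
  refine (d.isAddPreorder_weightLe q).trans _ _ _ ?_ h1
  rw [sum_map_wt_ordWord] at h4
  exact (d.isAddPreorder_weightLe q).add_left _ _ _ h4

omit [IsAlgClosed K] [Module.Free ℤ X] in
theorem monomial_mem_weightFiltration (a : Fin D → Fin p) :
    d.monomial ψ ν a ∈ d.weightFiltration q ψ ν (d.monomialWeight ν a) := by
  refine Submodule.subset_span ⟨_, ?_, rfl⟩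
  rw [sum_map_wt_ordWord]
  exact (d.isAddPreorder_weightLe q).refl _

omit [IsAlgClosed K] [Module.Free ℤ X] in
/-- A subspace of `Z_ψ(ν)` which is stable under `𝔤` and contains `1 ⊗ 1` is everything. -/
theorem eq_top_of_smul_mem (N : Submodule K (BabyVerma p T b ψ ν))
    (h1 : highestVector p T b ψ ν ∈ N) (h : ∀ x : Lie K A, ∀ z ∈ N, toRedEnv p ψ x • z ∈ N) :
    N = ⊤ := by
  rw [eq_top_iff]
  intro z _
  obtain ⟨u, rfl⟩ := exists_eq_smul_highestVector p T b ψ ν z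
  exact smul_mem_of_toRedEnv p N h u h1

theorem span_monomial (hψ : d.Compatible q ψ) :
    Submodule.span K (Set.range (d.monomial ψ ν)) = ⊤ := by
  have hV : ∀ κ, d.weightFiltration q ψ ν κ ≤ Submodule.span K (Set.range (d.monomial ψ ν)) :=
    fun κ => (d.weightFiltration_le ν hψ κ).trans (Submodule.span_mono (Set.image_subset_range _ _))
  refine eq_top_of_smul_mem ν _ (hV ν (d.highestVector_mem_weightFiltration q ψ ν)) ?_
  intro x z hz
  have hx : x ∈ ⨆ μ, T.weightSpace μ := by rw [d.iSup_weightSpace]; trivial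
  induction hx using Submodule.iSup_induction' with
  | mem μ x hx =>
    induction hz using Submodule.span_induction with
    | mem z hz =>
      obtain ⟨a, rfl⟩ := hz
      exact hV _ (d.smul_mem_weightFiltration q ψ ν hx (d.monomial_mem_weightFiltration ν a))
    | zero => rw [smul_zero]; exact Submodule.zero_mem _
    | add z z' _ _ h h' => rw [smul_add]; exact Submodule.add_mem _ h h'
    | smul c z _ h => rw [smul_algebra_smul_comm]; exact Submodule.smul_mem _ _ h
  | zero => rw [map_zero, zero_smul]; exact Submodule.zero_mem _
  | add x y _ _ hx hy => rw [map_add, add_smul]; exact Submodule.add_mem _ hx hy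

end TriangularData

end ClosedTorus

/-! ### PBW monomials adapted to 𝔟 and the left ideal of a baby Verma module. -/

namespace ClosedTorus

namespace TriangularData

variable {K : Type*} [Field K] {A : Type*} [CommRing A] [HopfAlgebra K A]
  {X : Type*} [AddCommGroup X] {T : ClosedTorus K A X}
  {ι Y : Type*} [AddCommGroup Y] {P : RootDatum ι X Y}
  {p : ℕ} [Fact p.Prime] [CharP K p] {b : P.Base} {D : ℕ} (d : T.TriangularData p b D)
  (ψ : Module.Dual K (Lie K A)) (ν : X)

/-- The product of a word in the letters `h - dν(h)` and `e_j`. -/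
def borelProd (w : List (Fin d.r ⊕ Fin D)) : RedEnv p ψ := (w.map (d.borelLetter ψ ν)).prod

theorem borelProd_append (w w' : List (Fin d.r ⊕ Fin D)) :
    d.borelProd ψ ν (w ++ w') = d.borelProd ψ ν w * d.borelProd ψ ν w' := by
  rw [borelProd, List.map_append, List.prod_append]
  rfl

/-- The span of the products of a word in the `f_j` with a word in the letters of `𝔟`. -/
def triangularSpan : Submodule K (RedEnv p ψ) :=
  Submodule.span K {u | ∃ w w', u = d.fProd ψ w * d.borelProd ψ ν w'}

theorem f_mul_mem_triangularSpan (j : Fin D) {u : RedEnv p ψ} (hu : u ∈ d.triangularSpan ψ ν) :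
    toRedEnv p ψ (d.f j) * u ∈ d.triangularSpan ψ ν := by
  induction hu using Submodule.span_induction with
  | mem u hu =>
    obtain ⟨w, w', rfl⟩ := hu
    exact Submodule.subset_span ⟨j :: w, w', by rw [fProd_cons, mul_assoc]⟩
  | zero => rw [mul_zero]; exact Submodule.zero_mem _
  | add z z' _ _ h h' => rw [mul_add]; exact Submodule.add_mem _ h h'
  | smul c z _ h => rw [mul_smul_comm]; exact Submodule.smul_mem _ _ h

theorem borelProd_mem_triangularSpan (w : List (Fin d.r ⊕ Fin D)) :
    d.borelProd ψ ν w ∈ d.triangularSpan ψ ν :=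
  Submodule.subset_span ⟨[], w, (one_mul _).symm⟩

theorem span_mul_borelProd_mem_triangularSpan {u : RedEnv p ψ}
    (hu : u ∈ Submodule.span K (Set.range (d.borelLetter ψ ν))) (w : List (Fin d.r ⊕ Fin D)) :
    u * d.borelProd ψ ν w ∈ d.triangularSpan ψ ν := by
  induction hu using Submodule.span_induction with
  | mem u hu =>
    obtain ⟨t, rfl⟩ := hu
    have h1 : d.borelLetter ψ ν t * d.borelProd ψ ν w = d.borelProd ψ ν (t :: w) := by
      rw [borelProd, borelProd, List.map_cons, List.prod_cons]
    rw [h1]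
    exact d.borelProd_mem_triangularSpan ψ ν _
  | zero => rw [zero_mul]; exact Submodule.zero_mem _
  | add z z' _ _ h h' => rw [add_mul]; exact Submodule.add_mem _ h h'
  | smul c z _ h => rw [smul_mul_assoc]; exact Submodule.smul_mem _ _ h

variable [IsAlgClosed K] [Module.Free ℤ X]

/-- After x is moved past the f_j, it is absorbed by one of the two words, up to a multiple of the
word in 𝔟 when x lies in 𝔱. -/
theorem mul_fProd_mem_triangularSpan (w : List (Fin D)) (w' : List (Fin d.r ⊕ Fin D)) {μ : X}
    {x : Lie K A} (hx : x ∈ T.weightSpace μ) :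
    toRedEnv p ψ x * (d.fProd ψ w * d.borelProd ψ ν w') ∈ d.triangularSpan ψ ν := by
  induction w generalizing x μ with
  | nil =>
    have h0 : d.fProd ψ [] * d.borelProd ψ ν w' = d.borelProd ψ ν w' := one_mul _
    rw [h0]
    have hw := d.borelProd_mem_triangularSpan ψ ν w'
    rcases d.mem_weightSpace μ x hx with rfl | ⟨rfl, h⟩ | ⟨j, rfl, c, rfl⟩ | ⟨j, rfl, c, rfl⟩
    · rw [map_zero, zero_mul]
      exact Submodule.zero_mem _
    · have h1 := d.span_mul_borelProd_mem_triangularSpan ψ ν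
        (d.cartan_mem_span_borelLetter ψ ν ⟨x, h⟩) w'
      rw [sub_mul] at h1
      refine (Submodule.sub_mem_iff_left _ ?_).1 h1
      rw [← Algebra.smul_def]
      exact Submodule.smul_mem _ _ hw
    · rw [map_smul, smul_mul_assoc]
      exact Submodule.smul_mem _ _ (d.span_mul_borelProd_mem_triangularSpan ψ ν
        (Submodule.subset_span ⟨Sum.inr j, rfl⟩) w')
    · rw [map_smul, smul_mul_assoc]
      exact Submodule.smul_mem _ _ (d.f_mul_mem_triangularSpan ψ ν j hw)
  | cons j w ih =>
    have h1 : toRedEnv p ψ x * (d.fProd ψ (j :: w) * d.borelProd ψ ν w') =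
        toRedEnv p ψ (d.f j) * (toRedEnv p ψ x * (d.fProd ψ w * d.borelProd ψ ν w')) +
          toRedEnv p ψ ⁅x, d.f j⁆ * (d.fProd ψ w * d.borelProd ψ ν w') := by
      rw [fProd_cons, ← toRedEnv_bracket, sub_mul, mul_assoc, mul_assoc, mul_assoc,
        add_sub_cancel]
    rw [h1]
    exact Submodule.add_mem _ (d.f_mul_mem_triangularSpan ψ ν j (ih hx))
      (ih (T.lie_mem_weightSpace hx (d.f_mem_wt j)))

theorem triangularSpan_eq_top : d.triangularSpan ψ ν = ⊤ := by
  rw [eq_top_iff]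
  intro u _
  rw [← mul_one u]
  refine smul_mem_of_toRedEnv p (d.triangularSpan ψ ν) (fun x m hm => ?_) u
    (d.borelProd_mem_triangularSpan ψ ν [])
  have hx : x ∈ ⨆ μ, T.weightSpace μ := by rw [d.iSup_weightSpace]; trivial
  rw [smul_eq_mul]
  induction hx using Submodule.iSup_induction' with
  | mem μ x hx =>
    induction hm using Submodule.span_induction with
    | mem m hm =>
      obtain ⟨w, w', rfl⟩ := hm
      exact d.mul_fProd_mem_triangularSpan ψ ν w w' hx
    | zero => rw [mul_zero]; exact Submodule.zero_mem _
    | add z z' _ _ h h' => rw [mul_add]; exact Submodule.add_mem _ h h'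
    | smul c z _ h => rw [mul_smul_comm]; exact Submodule.smul_mem _ _ h
  | zero => rw [map_zero, zero_mul]; exact Submodule.zero_mem _
  | add x y _ _ hx hy => rw [map_add, add_mul]; exact Submodule.add_mem _ hx hy

/-- The restricted ordered monomials of `U_ψ(𝔤)` adapted to the weight `ν`. -/
def pbw (a : Fin D ⊕ (Fin d.r ⊕ Fin D) → Fin p) : RedEnv p ψ :=
  d.fProd ψ (ordWord Finset.univ.toList fun j => (a (Sum.inl j) : ℕ)) *
    d.borelProd ψ ν (ordWord Finset.univ.toList fun t => (a (Sum.inr t) : ℕ))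

-- The PBW theorem is applied with the ordering in which the f_j precede the letters of 𝔟, and with
-- shifts dν(h_k) on the basis of 𝔱 and 0 elsewhere.
omit [IsAlgClosed K] [Module.Free ℤ X] in
theorem linearIndependent_pbw : LinearIndependent K (d.pbw ψ ν) := by
  let l : List (Fin D ⊕ (Fin d.r ⊕ Fin D)) :=
    Finset.univ.toList.map Sum.inl ++ Finset.univ.toList.map Sum.inr
  have hl : l.Nodup := by
    refine List.Nodup.append ?_ ?_ ?_
    · exact (Finset.nodup_toList _).map Sum.inl_injective
    · exact (Finset.nodup_toList _).map Sum.inr_injective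
    · intro s hs hs'
      rw [List.mem_map] at hs hs'
      obtain ⟨_, -, rfl⟩ := hs
      obtain ⟨_, -, h⟩ := hs'
      exact absurd h (by simp)
  have hl' : ∀ s, s ∈ l := by
    rintro (s | s) <;> simp [l]
  have h1 := linearIndependent_monomials p d.basis ψ
    (Sum.elim 0 (Sum.elim (fun k => T.differential ν (d.h k)) 0)) hl hl'
  have h2 : (fun s => toRedEnv p ψ (d.basis s) - algebraMap K _
      ((Sum.elim 0 (Sum.elim (fun k => T.differential ν (d.h k)) 0) : _ → K) s)) =
      Sum.elim (fun j => toRedEnv p ψ (d.f j)) (d.borelLetter ψ ν) := by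
    funext s
    rw [basis_apply]
    rcases s with j | k | j
    · exact (congrArg _ (map_zero _)).trans (sub_zero _)
    · rfl
    · exact (congrArg _ (map_zero _)).trans (sub_zero _)
  rw [h2] at h1
  convert h1 using 2 with a
  rw [ordWord_append, ordWord_map, ordWord_map, List.map_append, List.prod_append, List.map_map,
    List.map_map]
  rfl

variable {ψ} {Q : Type*} [AddCommGroup Q] {q : X →+ Q}

/-- The two words are straightened separately; the nonempty word in 𝔟 keeps only nonconstant
monomials. -/
theorem mul_mem_span_pbw (hψ : d.Compatible q ψ) (w : List (Fin D)) (w' : List (Fin d.r ⊕ Fin D))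
    (hw' : w' ≠ []) : d.fProd ψ w * d.borelProd ψ ν w' ∈ Submodule.span K
      (d.pbw ψ ν '' {a | ∃ t, a (Sum.inr t) ≠ ⟨0, (Fact.out : p.Prime).pos⟩}) := by
  have h1 := d.prod_f_mem_restrictedMonomials hψ w
  have h2 := d.prod_borelLetter_mem_restrictedMonomials hψ ν w'
  have h3 := Submodule.mul_mem_mul h1 h2
  rw [restrictedMonomials, restrictedMonomials, Submodule.span_mul_span] at h3
  refine Submodule.span_mono ?_ h3
  rintro _ ⟨_, ⟨a, ha, -, rfl⟩, _, ⟨a', ha', h4, rfl⟩, rfl⟩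
  refine ⟨Sum.elim (fun j => ⟨a j, ha j⟩) (fun t => ⟨a' t, ha' t⟩), ?_, rfl⟩
  by_contra hne
  simp only [Set.mem_ofPred_eq, Sum.elim_inr, not_exists, not_not, Fin.mk.injEq] at hne
  refine h4 ?_ ?_
  · rw [List.map_const', List.sum_replicate, smul_eq_mul, mul_one]
    exact fun h => hw' (List.eq_nil_of_length_eq_zero h)
  · have : a' = fun _ => 0 := funext hne
    rw [this]
    simp [ordWord]

theorem mul_span_mem_span_pbw (hψ : d.Compatible q ψ) (u : RedEnv p ψ) {z : RedEnv p ψ}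
    (hz : z ∈ Submodule.span K (Set.range (d.borelLetter ψ ν))) : u * z ∈ Submodule.span K
      (d.pbw ψ ν '' {a | ∃ t, a (Sum.inr t) ≠ ⟨0, (Fact.out : p.Prime).pos⟩}) := by
  have hu : u ∈ d.triangularSpan ψ ν := by rw [triangularSpan_eq_top]; trivial
  have h3 := Submodule.mul_mem_mul hu hz
  rw [triangularSpan, Submodule.span_mul_span] at h3
  refine Submodule.span_le.2 ?_ h3
  rintro _ ⟨_, ⟨w, w', rfl⟩, _, ⟨t, rfl⟩, rfl⟩
  have h4 := d.mul_mem_span_pbw ν hψ w (w' ++ [t]) (by simp)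
  rw [borelProd_append, ← mul_assoc] at h4
  simpa [borelProd] using h4

/-- The ideal consists of sums of products ending in a combination of letters of 𝔟, so only PBW
monomials with nontrivial 𝔟-part occur. By independence it meets the span of the pure monomials in
the f_j in 0. -/
theorem babyVermaIdeal_le (hψ : d.Compatible q ψ) {u : RedEnv p ψ}
    (hu : u ∈ babyVermaIdeal p T b ψ ν) : u ∈ Submodule.span K
      (d.pbw ψ ν '' {a | ∃ t, a (Sum.inr t) ≠ ⟨0, (Fact.out : p.Prime).pos⟩}) := by
  suffices h : ∀ v : RedEnv p ψ, v * u ∈ Submodule.span K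
      (d.pbw ψ ν '' {a | ∃ t, a (Sum.inr t) ≠ ⟨0, (Fact.out : p.Prime).pos⟩}) by
    have := h 1
    rwa [one_mul] at this
  induction hu using Submodule.span_induction with
  | mem u hu =>
    intro v
    refine d.mul_span_mem_span_pbw ν hψ v ?_
    rcases hu with ⟨i, hi, x, hx, rfl⟩ | ⟨h, rfl⟩
    · obtain ⟨j, c, rfl⟩ := d.eq_smul_e_of_isPos hi hx
      rw [map_smul]
      exact Submodule.smul_mem _ _ (Submodule.subset_span ⟨Sum.inr j, rfl⟩)
    · exact d.cartan_mem_span_borelLetter ψ ν h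
  | zero => intro v; rw [mul_zero]; exact Submodule.zero_mem _
  | add z z' _ _ h h' => intro v; rw [mul_add]; exact Submodule.add_mem _ (h v) (h' v)
  | smul c z _ h => intro v; rw [smul_eq_mul, ← mul_assoc]; exact h _

/-- The `f ^ a ⊗ 1` are linearly independent in `Z_ψ(ν)`. -/
theorem linearIndependent_monomial (hψ : d.Compatible q ψ) :
    LinearIndependent K (d.monomial ψ ν) := by
  set z : Fin p := ⟨0, (Fact.out : p.Prime).pos⟩ with hz
  let E : (Fin D → Fin p) → (Fin D ⊕ (Fin d.r ⊕ Fin D) → Fin p) := fun a => Sum.elim a fun _ => z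
  have hE : Function.Injective E := fun a a' h => funext fun j => congrFun h (Sum.inl j)
  have h1 := (d.linearIndependent_pbw ψ ν).comp E hE
  have h2 : ∀ a, d.pbw ψ ν (E a) = d.fProd ψ (ordWord Finset.univ.toList fun j => (a j : ℕ)) := by
    intro a
    have : (ordWord Finset.univ.toList fun t => (E a (Sum.inr t) : ℕ)) = [] := by
      simp [ordWord, E, hz]
    rw [pbw, this]
    exact mul_one _
  let L : RedEnv p ψ →ₗ[K] BabyVerma p T b ψ ν :=
    ((babyVermaIdeal p T b ψ ν).mkQ).restrictScalars K
  have h3 : LinearIndependent K (L ∘ (d.pbw ψ ν ∘ E)) := by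
    refine h1.map ?_
    have h4 := (d.linearIndependent_pbw ψ ν).disjoint_span_image (s := Set.range E)
      (t := {a | ∃ t, a (Sum.inr t) ≠ z}) (Set.disjoint_left.2 (by
        rintro _ ⟨a, rfl⟩ ⟨t, ht⟩
        exact ht rfl))
    rw [Set.range_comp]
    refine h4.mono_right fun u hu => ?_
    exact d.babyVermaIdeal_le ν hψ ((Submodule.Quotient.mk_eq_zero _).1 hu)
  have h5 : d.monomial ψ ν = L ∘ (d.pbw ψ ν ∘ E) := funext fun a => by
    rw [Function.comp_apply, Function.comp_apply, h2]
    exact (mkQ_eq_smul p T b ψ ν _).symm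
  rw [h5]
  exact h3

/-- The basis of `Z_ψ(ν)` formed by the `f ^ a ⊗ 1`. -/
def monomialBasis (hψ : d.Compatible q ψ) :
    Module.Basis (Fin D → Fin p) K (BabyVerma p T b ψ ν) :=
  Module.Basis.mk (d.linearIndependent_monomial ν hψ) (d.span_monomial ν hψ).ge

theorem monomialBasis_apply (hψ : d.Compatible q ψ) (a : Fin D → Fin p) :
    d.monomialBasis ν hψ a = d.monomial ψ ν a := by
  rw [monomialBasis, Module.Basis.mk_apply]

end TriangularData

end ClosedTorus

/-! ### Gradings of tensor products and coarsened gradings in terms of spanning vectors. -/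

section TensorDegree

variable {K : Type*} [Field K] {Q : Type*} [AddCommGroup Q] {M N : Type*} [AddCommGroup M]
  [Module K M] [AddCommGroup N] [Module K N]

theorem range_map_subtype (V : Submodule K M) (W : Submodule K N) :
    LinearMap.range (TensorProduct.map V.subtype W.subtype) =
      Submodule.map₂ (TensorProduct.mk K M N) V W := by
  rw [TensorProduct.range_map_eq_span_tmul, Submodule.map₂_eq_span_image2]
  congr 1
  ext t
  simp only [Set.mem_image2, Subtype.exists, Submodule.subtype_apply, Set.mem_ofPred_eq,
    TensorProduct.mk_apply]
  constructor
  · rintro ⟨m, hm, n, hn, h⟩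
    exact ⟨m, hm, n, hn, h⟩
  · rintro ⟨m, hm, n, hn, h⟩
    exact ⟨m, hm, n, hn, h⟩

theorem tmul_mem_tensorDegree {degM : Q → Submodule K M} {degN : Q → Submodule K N} {m : M} {n : N}
    {η η' : Q} (hm : m ∈ degM η) (hn : n ∈ degN η') :
    m ⊗ₜ[K] n ∈ tensorDegree degM degN (η + η') := by
  refine Submodule.mem_iSup_of_mem η ?_
  rw [range_map_subtype, add_sub_cancel_left]
  exact Submodule.apply_mem_map₂ _ hm hn

theorem tensorDegree_span_fiber {α β : Type*} (v : α → M) (w : β → N) (deg : α → Q) (deg' : β → Q)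
    (ξ : Q) : tensorDegree (fun ξ => Submodule.span K (v '' {a | deg a = ξ}))
      (fun ξ => Submodule.span K (w '' {a | deg' a = ξ})) ξ =
        Submodule.span K ((fun a : α × β => v a.1 ⊗ₜ[K] w a.2) ''
          {a | deg a.1 + deg' a.2 = ξ}) := by
  refine le_antisymm (iSup_le fun η => ?_) (Submodule.span_le.2 ?_)
  · rw [range_map_subtype, Submodule.map₂_span_span]
    refine Submodule.span_mono ?_
    rintro _ ⟨_, ⟨a, rfl, rfl⟩, _, ⟨a', h, rfl⟩, rfl⟩
    exact ⟨(a, a'), (congrArg (deg a + ·) h).trans (add_sub_cancel _ _), rfl⟩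
  · rintro _ ⟨⟨a, a'⟩, rfl, rfl⟩
    exact tmul_mem_tensorDegree (Submodule.subset_span ⟨a, rfl, rfl⟩)
      (Submodule.subset_span ⟨a', rfl, rfl⟩)

theorem coarsen_span_fiber {α : Type*} {R : Type*} [AddCommGroup R] (q : R →+ Q) (v : α → M)
    (deg : α → R) (ξ : Q) :
    coarsen q (fun ξ => Submodule.span K (v '' {a | deg a = ξ})) ξ =
      Submodule.span K (v '' {a | q (deg a) = ξ}) := by
  refine le_antisymm (iSup_le fun η => Submodule.span_mono (Set.image_mono ?_))
    (Submodule.span_le.2 ?_)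
  · intro a ha
    exact (congrArg q ha).trans η.2
  · rintro _ ⟨a, ha, rfl⟩
    exact Submodule.mem_iSup_of_mem ⟨deg a, ha⟩ (Submodule.subset_span ⟨a, rfl, rfl⟩)

end TensorDegree

/-! ### The p-th power of the action on a tensor product. -/

section TensorPower

variable {K : Type*} [Field K] {M N : Type*} [AddCommGroup M] [Module K M] [AddCommGroup N]
  [Module K N] {L : Type*} [LieRing L] [LieAlgebra K L] [LieRingModule L M] [LieModule K L M]
  [LieRingModule L N] [LieModule K L N]

theorem toEnd_tensorProduct (x : L) : LieModule.toEnd K L (M ⊗[K] N) x =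
    (LieModule.toEnd K L M x).rTensor N + (LieModule.toEnd K L N x).lTensor M := by
  refine TensorProduct.ext' fun m n => ?_
  rw [LieModule.toEnd_apply_apply, TensorProduct.LieModule.lie_tmul_right, LinearMap.add_apply,
    LinearMap.rTensor_tmul, LinearMap.lTensor_tmul, LieModule.toEnd_apply_apply,
    LieModule.toEnd_apply_apply]

/-- The operators x ⊗ 1 and 1 ⊗ x commute, so in characteristic p the p-th power of their sum is the
sum of their p-th powers. -/
theorem toEnd_tensorProduct_pow_char (p : ℕ) [Fact p.Prime] [CharP K p] (x : L) (m : M) (n : N) :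
    (LieModule.toEnd K L (M ⊗[K] N) x ^ p) (m ⊗ₜ n) =
      (LieModule.toEnd K L M x ^ p) m ⊗ₜ n + m ⊗ₜ (LieModule.toEnd K L N x ^ p) n := by
  rcases subsingleton_or_nontrivial (M ⊗[K] N) with h | h
  · exact Subsingleton.elim _ _
  have : CharP (Module.End K (M ⊗[K] N)) p :=
    charP_of_injective_algebraMap (algebraMap K _).injective p
  have hc : Commute ((LieModule.toEnd K L M x).rTensor N) ((LieModule.toEnd K L N x).lTensor M) := by
    refine TensorProduct.ext' fun m n => ?_
    simp
  rw [toEnd_tensorProduct, add_pow_char_of_commute (R := Module.End K (M ⊗[K] N)) p hc,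
    LinearMap.rTensor_pow, LinearMap.lTensor_pow, LinearMap.add_apply, LinearMap.rTensor_tmul,
    LinearMap.lTensor_tmul]

end TensorPower

/-! ### The grading of a baby Verma module. -/

section BabyVerma

variable {K : Type*} [Field K] {A : Type*} [CommRing A] [HopfAlgebra K A]
  (p : ℕ) [Fact p.Prime] [CharP K p]
  {X : Type*} [AddCommGroup X] (T : ClosedTorus K A X)
  {ι Y : Type*} [AddCommGroup Y] {P : RootDatum ι X Y} (b : P.Base)
  (ψ : Module.Dual K (Lie K A)) (ν : X) {Q : Type*} [AddCommGroup Q] (q : X →+ Q)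

theorem toEnd_pow_apply (x : Lie K A) (z : BabyVerma p T b ψ ν) (n : ℕ) :
    (LieModule.toEnd K (Lie K A) (BabyVerma p T b ψ ν) x ^ n) z = toRedEnv p ψ x ^ n • z := by
  induction n with
  | zero => rw [pow_zero, pow_zero, one_smul, Module.End.one_apply]
  | succ n ih => rw [pow_succ', pow_succ', Module.End.mul_apply, ih, mul_smul]; rfl

/-- `x ^ p - x^[p]` acts on `Z_ψ(ν)` as `ψ(x) ^ p`. -/
theorem toEnd_pow_char_babyVerma (x : Lie K A) (z : BabyVerma p T b ψ ν) :
    (LieModule.toEnd K (Lie K A) (BabyVerma p T b ψ ν) x ^ p) z =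
      ⁅pPow p x, z⁆ + ψ x ^ p • z := by
  rw [toEnd_pow_apply, toRedEnv_pow, add_smul, algebraMap_smul]
  rfl

theorem lie_mem_babyVermaDegree {κ : X} {ξ : Q} {x : Lie K A} (hx : x ∈ T.weightSpace κ)
    {z : BabyVerma p T b ψ ν} (hz : z ∈ babyVermaDegree p T b q ψ ν ξ) :
    ⁅x, z⁆ ∈ babyVermaDegree p T b q ψ ν (q κ + ξ) := by
  obtain ⟨u, hu, rfl⟩ := hz
  rw [bracket_eq_smul]
  change _ • (babyVermaIdeal p T b ψ ν).mkQ u ∈ _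
  refine ⟨toRedEnv p ψ x * u, ?_, ?_⟩
  · rw [add_sub_assoc]
    induction hu using Submodule.span_induction with
    | mem u hu =>
      obtain ⟨l, hl, h, rfl⟩ := hu
      refine Submodule.subset_span ⟨(x, κ) :: l, ?_, ?_, ?_⟩
      · rintro y (_ | ⟨_, hy⟩)
        · exact hx
        · exact hl y hy
      · rw [List.map_cons, List.sum_cons, map_add, h]
      · rw [List.map_cons, List.prod_cons]
    | zero => rw [mul_zero]; exact Submodule.zero_mem _
    | add z z' _ _ h h' => rw [mul_add]; exact Submodule.add_mem _ h h'
    | smul c z _ h => rw [mul_smul_comm]; exact Submodule.smul_mem _ _ h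
  · exact map_smul (babyVermaIdeal p T b ψ ν).mkQ (toRedEnv p ψ x) u

end BabyVerma

namespace ClosedTorus

namespace TriangularData

variable {K : Type*} [Field K] {A : Type*} [CommRing A] [HopfAlgebra K A]
  {X : Type*} [AddCommGroup X] {T : ClosedTorus K A X}
  {ι Y : Type*} [AddCommGroup Y] {P : RootDatum ι X Y}
  {p : ℕ} [Fact p.Prime] [CharP K p] {b : P.Base} {D : ℕ} (d : T.TriangularData p b D)
  (ψ : Module.Dual K (Lie K A)) (ν : X) {Q : Type*} [AddCommGroup Q] {q : X →+ Q}
  [IsAlgClosed K] [Module.Free ℤ X]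

variable (q) in
theorem prod_smul_highestVector_mem (l : List (Lie K A × X))
    (hl : ∀ y ∈ l, y.1 ∈ T.weightSpace y.2) :
    (l.map fun y => toRedEnv p ψ y.1).prod • highestVector p T b ψ ν ∈
      d.weightFiltration q ψ ν (ν + (l.map Prod.snd).sum) := by
  induction l with
  | nil => simpa using d.highestVector_mem_weightFiltration q ψ ν
  | cons y l ih =>
    have h1 : ((y :: l).map fun y => toRedEnv p ψ y.1).prod =
        toRedEnv p ψ y.1 * (l.map fun y => toRedEnv p ψ y.1).prod := List.prod_cons
    rw [h1, mul_smul, List.map_cons, List.sum_cons, add_comm y.2, ← add_assoc]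
    exact d.smul_mem_weightFiltration q ψ ν (hl y List.mem_cons_self)
      (ih fun y hy => hl y (List.mem_cons_of_mem _ hy))

variable {ψ}

/-- The components of the grading of `Z_ψ(ν)` are spanned by the `f ^ a ⊗ 1` they contain. -/
theorem babyVermaDegree_eq (hψ : d.Compatible q ψ) (ξ : Q) : babyVermaDegree p T b q ψ ν ξ =
    Submodule.span K (d.monomial ψ ν '' {a | q (d.monomialWeight ν a) = ξ}) := by
  let L : RedEnv p ψ →ₗ[K] BabyVerma p T b ψ ν :=
    ((babyVermaIdeal p T b ψ ν).mkQ).restrictScalars K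
  have hL : babyVermaDegree p T b q ψ ν ξ = (redEnvDegree p T q ψ (ξ - q ν)).map L := rfl
  rw [hL, redEnvDegree, Submodule.map_span]
  refine le_antisymm (Submodule.span_le.2 ?_) (Submodule.span_mono ?_)
  · rintro _ ⟨_, ⟨l, hl, h, rfl⟩, rfl⟩
    have h1 := d.weightFiltration_le ν hψ _ (d.prod_smul_highestVector_mem ψ ν q l hl)
    change (babyVermaIdeal p T b ψ ν).mkQ _ ∈ _
    rw [mkQ_eq_smul]
    refine Submodule.span_mono (Set.image_mono ?_) h1
    -- Only the degree half of `weightLe` matters for the grading; the height is discarded.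
    rintro a ⟨ha, -⟩
    rw [Set.mem_ofPred_eq, ha, map_add, h, add_sub_cancel]
  · rintro _ ⟨a, rfl, rfl⟩
    refine ⟨_, ⟨(ordWord Finset.univ.toList fun j => (a j : ℕ)).map fun j => (d.f j, d.wt j),
      ?_, ?_, rfl⟩, ?_⟩
    · intro y hy
      obtain ⟨j, -, rfl⟩ := List.mem_map.1 hy
      exact d.f_mem_wt j
    · rw [List.map_map, monomialWeight, map_add, add_sub_cancel_left]
      exact congrArg q (d.sum_map_wt_ordWord fun j => (a j : ℕ))
    · change (babyVermaIdeal p T b ψ ν).mkQ _ = _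
      rw [mkQ_eq_smul, List.map_map]
      rfl

theorem babyVermaDegree_eq_fun (hψ : d.Compatible q ψ) : babyVermaDegree p T b q ψ ν =
    fun ξ => Submodule.span K (d.monomial ψ ν '' {a | q (d.monomialWeight ν a) = ξ}) :=
  funext (d.babyVermaDegree_eq ν hψ)

end TriangularData

end ClosedTorus

/-! ### Homomorphisms out of a baby Verma module. -/

section Universal

variable {K : Type*} [Field K] {A : Type*} [CommRing A] [HopfAlgebra K A]
  (p : ℕ) [Fact p.Prime] [CharP K p]
  {X : Type*} [AddCommGroup X] (T : ClosedTorus K A X)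
  {ι Y : Type*} [AddCommGroup Y] {P : RootDatum ι X Y} (b : P.Base)
  {ψ : Module.Dual K (Lie K A)} (ν : X)
  {M : Type*} [AddCommGroup M] [Module K M] [LieRingModule (Lie K A) M] [LieModule K (Lie K A) M]

/-- The action of `U_ψ(𝔤)` on a `𝔤`-module on which `x ^ p - x^[p]` acts as `ψ(x) ^ p`. -/
def redEnvAction (hM : ∀ (x : Lie K A) (m : M),
    ((LieModule.toEnd K (Lie K A) M x) ^ p) m = ⁅pPow p x, m⁆ + ψ x ^ p • m) :
    RedEnv p ψ →ₐ[K] Module.End K M :=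
  liftRedEnv p ψ (LieModule.toEnd K (Lie K A) M) fun x => LinearMap.ext (hM x)

theorem redEnvAction_toRedEnv (hM : ∀ (x : Lie K A) (m : M),
    ((LieModule.toEnd K (Lie K A) M x) ^ p) m = ⁅pPow p x, m⁆ + ψ x ^ p • m) (x : Lie K A) (m : M) :
    redEnvAction p hM (toRedEnv p ψ x) m = ⁅x, m⁆ := by
  rw [redEnvAction, liftRedEnv_toRedEnv, LieModule.toEnd_apply_apply]

theorem redEnvAction_eq_zero (hM : ∀ (x : Lie K A) (m : M),
    ((LieModule.toEnd K (Lie K A) M x) ^ p) m = ⁅pPow p x, m⁆ + ψ x ^ p • m) {m : M}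
    (hpos : ∀ i, b.IsPos i → ∀ x ∈ T.weightSpace (P.root i), ⁅x, m⁆ = 0)
    (hcar : m ∈ cartanWeightSpace T M ν) {u : RedEnv p ψ} (hu : u ∈ babyVermaIdeal p T b ψ ν) :
    redEnvAction p hM u m = 0 := by
  induction hu using Submodule.span_induction with
  | mem u hu =>
    rcases hu with ⟨i, hi, x, hx, rfl⟩ | ⟨h, rfl⟩
    · rw [redEnvAction_toRedEnv, hpos i hi x hx]
    · rw [map_sub, LinearMap.sub_apply, redEnvAction_toRedEnv, hcar h, AlgHom.commutes,
        Module.algebraMap_end_apply, sub_self]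
  | zero => rw [map_zero, LinearMap.zero_apply]
  | add u v _ _ h h' => rw [map_add, LinearMap.add_apply, h, h', add_zero]
  | smul c u _ h => rw [smul_eq_mul, map_mul, Module.End.mul_apply, h, map_zero]

/-- The universal property of baby Verma modules. -/
theorem exists_lieModuleHom (hM : ∀ (x : Lie K A) (m : M),
    ((LieModule.toEnd K (Lie K A) M x) ^ p) m = ⁅pPow p x, m⁆ + ψ x ^ p • m) {m : M}
    (hpos : ∀ i, b.IsPos i → ∀ x ∈ T.weightSpace (P.root i), ⁅x, m⁆ = 0)
    (hcar : m ∈ cartanWeightSpace T M ν) :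
    ∃ f : BabyVerma p T b ψ ν →ₗ⁅K, Lie K A⁆ M, f (highestVector p T b ψ ν) = m := by
  let ev : RedEnv p ψ →ₗ[K] M := (LinearMap.applyₗ m).comp (redEnvAction p hM).toLinearMap
  let f : BabyVerma p T b ψ ν →ₗ[K] M :=
    ((babyVermaIdeal p T b ψ ν).restrictScalars K).liftQ ev
      fun u hu => redEnvAction_eq_zero p T b ν hM hpos hcar hu
  have hf : ∀ u : RedEnv p ψ, f (u • highestVector p T b ψ ν) = redEnvAction p hM u m := by
    intro u
    rw [← mkQ_eq_smul]
    exact ((babyVermaIdeal p T b ψ ν).restrictScalars K).liftQ_apply ev u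
  refine ⟨{ f with map_lie' := fun {x z} => ?_ }, ?_⟩
  · obtain ⟨u, rfl⟩ := exists_eq_smul_highestVector p T b ψ ν z
    change f (toRedEnv p ψ x • u • highestVector p T b ψ ν) = ⁅x, f (u • highestVector p T b ψ ν)⁆
    rw [smul_smul, hf, hf, map_mul, Module.End.mul_apply, redEnvAction_toRedEnv]
  · change f (highestVector p T b ψ ν) = m
    have := hf 1
    rwa [one_smul, map_one, Module.End.one_apply] at this

variable {Q : Type*} [AddCommGroup Q] (q : X →+ Q)

-- The module is generated by 1 ⊗ 1 and weight vectors shift degrees in the same way on both sides,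
-- so the degree of the image of 1 ⊗ 1 decides.
omit [LieModule K (Lie K A) M] in
theorem map_babyVermaDegree_le (f : BabyVerma p T b ψ ν →ₗ⁅K, Lie K A⁆ M) {deg : Q → Submodule K M}
    (hdeg : ∀ (κ : X) (ξ : Q), ∀ x ∈ T.weightSpace κ, ∀ m ∈ deg ξ, ⁅x, m⁆ ∈ deg (q κ + ξ))
    (h : f (highestVector p T b ψ ν) ∈ deg (q ν)) (ξ : Q) :
    (babyVermaDegree p T b q ψ ν ξ).map (f : BabyVerma p T b ψ ν →ₗ[K] M) ≤ deg ξ := by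
  let L : RedEnv p ψ →ₗ[K] BabyVerma p T b ψ ν :=
    ((babyVermaIdeal p T b ψ ν).mkQ).restrictScalars K
  have hL : babyVermaDegree p T b q ψ ν ξ = (redEnvDegree p T q ψ (ξ - q ν)).map L := rfl
  rw [hL, redEnvDegree, Submodule.map_span, Submodule.map_span, Submodule.span_le]
  rintro _ ⟨_, ⟨_, ⟨l, hl, h1, rfl⟩, rfl⟩, rfl⟩
  change f ((babyVermaIdeal p T b ψ ν).mkQ _) ∈ deg ξ
  rw [mkQ_eq_smul]
  rw [eq_sub_iff_add_eq] at h1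
  clear hL
  subst h1
  induction l with
  | nil => simpa using h
  | cons y l ih =>
    have h1 : ((y :: l).map fun y => toRedEnv p ψ y.1).prod =
        toRedEnv p ψ y.1 * (l.map fun y => toRedEnv p ψ y.1).prod := List.prod_cons
    rw [h1, mul_smul, ← bracket_eq_smul, LieModuleHom.map_lie, List.map_cons, List.sum_cons,
      map_add, add_assoc]
    exact hdeg _ _ _ (hl y List.mem_cons_self) _ (ih fun y hy => hl y (List.mem_cons_of_mem _ hy))

end Universal

/-! ### Graded submodules, subquotients and isomorphisms. -/

section Graded

variable {K : Type*} [Field K] {L : Type*} [LieRing L] [LieAlgebra K L]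
  {M N : Type*} [AddCommGroup M] [Module K M] [LieRingModule L M] [LieModule K L M]
  [AddCommGroup N] [Module K N] [LieRingModule L N] [LieModule K L N]

theorem toEnd_pow_map (f : M →ₗ⁅K, L⁆ N) (x : L) (n : ℕ) (m : M) :
    (LieModule.toEnd K L N x ^ n) (f m) = f ((LieModule.toEnd K L M x ^ n) m) := by
  induction n with
  | zero => rfl
  | succ n ih =>
    rw [pow_succ', pow_succ', Module.End.mul_apply, Module.End.mul_apply, ih,
      LieModule.toEnd_apply_apply, LieModule.toEnd_apply_apply, LieModuleHom.map_lie]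

/-- Decompose an element of s ξ along t. The part outside ξ lies in s ξ as well as in the sum of the
other s η, so it vanishes. -/
theorem eq_of_le_of_iSupIndep {R Q V : Type*} [Ring R] [AddCommGroup V] [Module R V]
    {s t : Q → Submodule R V} (hs : iSupIndep s) (hst : ∀ ξ, t ξ ≤ s ξ) (ht : ⨆ ξ, t ξ = ⊤)
    (ξ : Q) : t ξ = s ξ := by
  refine le_antisymm (hst ξ) ?_
  intro x hx
  have h1 : x ∈ ⨆ ξ, t ξ := by rw [ht]; trivial
  rw [iSup_split_single _ ξ] at h1
  obtain ⟨y, hy, z, hz, rfl⟩ := Submodule.mem_sup.1 h1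
  have hz' : z ∈ ⨆ (η) (_ : η ≠ ξ), s η := (iSup₂_mono fun η _ => hst η) hz
  have hz'' : z ∈ s ξ := (Submodule.add_mem_iff_right _ (hst ξ hy)).1 hx
  rw [(Submodule.mem_bot R).1 ((hs ξ).le_bot ⟨hz'', hz'⟩), add_zero]
  exact hy

end Graded

section Subquotient

variable {K : Type*} [Field K] {A : Type*} [CommRing A] [HopfAlgebra K A]
  {X : Type*} [AddCommGroup X] {T : ClosedTorus K A X} {Q : Type*} [AddCommGroup Q] {q : X →+ Q}
  {M : Type*} [AddCommGroup M] [Module K M] [LieRingModule (Lie K A) M] [LieModule K (Lie K A) M]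
  {deg : Q → Submodule K M}

-- Two representatives of a common class, one of degree ξ and one from the other degrees, differ by
-- an element of N. Since N is graded, the ξ-component of that difference lies in N too, and up to
-- sign it is the first representative.
omit [AddCommGroup Q] in
theorem iSupIndep_subquotientDegree (hdeg : iSupIndep deg) {N : LieSubmodule K (Lie K A) M}
    (hN : IsGradedSubmodule deg N) (N' : LieSubmodule K (Lie K A) M) :
    iSupIndep (subquotientDegree deg N N') := by
  intro ξ
  rw [Submodule.disjoint_def]
  rintro _ ⟨m, hm, rfl⟩ hy
  simp only [subquotientDegree, ← Submodule.map_iSup] at hy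
  obtain ⟨m', hm', h1⟩ := hy
  have h2 : (m' : M) ∈ ⨆ (η) (_ : η ≠ ξ), deg η := by
    have h3 : (⨆ (η) (_ : η ≠ ξ), (deg η).comap (N'.incl : ↥N' →ₗ[K] M)) ≤
        (⨆ (η) (_ : η ≠ ξ), deg η).comap (N'.incl : ↥N' →ₗ[K] M) :=
      iSup₂_le fun η hη => Submodule.comap_mono (le_iSup₂_of_le η hη le_rfl)
    exact h3 hm'
  have h3 : ((m' - m : ↥N') : M) ∈ (N : Submodule K M) :=
    (LieSubmodule.Quotient.mk_eq_zero (N := N.comap N'.incl) (m := m' - m)).1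
      ((map_sub (LieSubmodule.Quotient.mk' (N.comap N'.incl)) m' m).trans (sub_eq_zero.2 h1))
  have h4 := h3
  rw [hN, iSup_split_single _ ξ] at h4
  obtain ⟨g, hg, g', hg', h5⟩ := Submodule.mem_sup.1 h4
  have h6 : (m : M) + g = m' - g' := by
    rw [← add_right_inj (m : M), ← add_assoc] at h5
    rw [eq_sub_iff_add_eq, h5]
    exact add_sub_cancel (m : M) (m' : M)
  have h7 : (m : M) + g = 0 := by
    refine (Submodule.mem_bot K).1 ((hdeg ξ).le_bot ⟨Submodule.add_mem _ hm hg.2, ?_⟩)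
    rw [h6]
    have h8 : (⨆ (η) (_ : η ≠ ξ), (N : Submodule K M) ⊓ deg η) ≤ ⨆ (η) (_ : η ≠ ξ), deg η :=
      iSup₂_mono fun η _ => inf_le_right
    exact Submodule.sub_mem _ h2 (h8 hg')
  refine (LieSubmodule.Quotient.mk_eq_zero' (N := N.comap N'.incl) (m := m)).2 ?_
  change (m : M) ∈ N
  rw [eq_neg_of_add_eq_zero_left h7]
  exact Submodule.neg_mem _ hg.1

theorem lie_mem_subquotientDegree (N N' : LieSubmodule K (Lie K A) M)
    (hdeg : ∀ (κ : X) (ξ : Q), ∀ x ∈ T.weightSpace κ, ∀ m ∈ deg ξ, ⁅x, m⁆ ∈ deg (q κ + ξ))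
    (κ : X) (ξ : Q) (x : Lie K A) (hx : x ∈ T.weightSpace κ) (y : Subquotient N N')
    (hy : y ∈ subquotientDegree deg N N' ξ) :
    ⁅x, y⁆ ∈ subquotientDegree deg N N' (q κ + ξ) := by
  obtain ⟨m, hm, rfl⟩ := hy
  exact ⟨⁅x, m⁆, hdeg κ ξ x hx _ hm, LieModuleHom.map_lie _ x m⟩

-- The sum of the homogeneous parts of the span is stable under weight vectors, hence under 𝔤, and
-- it contains the generators.
omit [LieModule K (Lie K A) M] in
theorem isGradedSubmodule_lieSpan (hT : ⨆ κ, T.weightSpace κ = ⊤)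
    (hdeg : ∀ (κ : X) (ξ : Q), ∀ x ∈ T.weightSpace κ, ∀ m ∈ deg ξ, ⁅x, m⁆ ∈ deg (q κ + ξ))
    {S : Set M} (hS : ∀ m ∈ S, ∃ ξ, m ∈ deg ξ) :
    IsGradedSubmodule deg (LieSubmodule.lieSpan K (Lie K A) S) := by
  set N := LieSubmodule.lieSpan K (Lie K A) S with hN
  refine le_antisymm ?_ (iSup_le fun ξ => inf_le_left)
  let N' : LieSubmodule K (Lie K A) M :=
    { (⨆ ξ, (N : Submodule K M) ⊓ deg ξ : Submodule K M) with
      lie_mem := fun {x m} hm => by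
        change m ∈ (⨆ ξ, (N : Submodule K M) ⊓ deg ξ : Submodule K M) at hm
        change ⁅x, m⁆ ∈ (⨆ ξ, (N : Submodule K M) ⊓ deg ξ : Submodule K M)
        have hx : x ∈ ⨆ κ, T.weightSpace κ := by rw [hT]; trivial
        induction hx using Submodule.iSup_induction' with
        | mem κ x hx =>
          induction hm using Submodule.iSup_induction' with
          | mem ξ m hm =>
            exact Submodule.mem_iSup_of_mem (q κ + ξ)
              ⟨N.lie_mem hm.1, hdeg κ ξ x hx m hm.2⟩
          | zero => rw [lie_zero]; exact Submodule.zero_mem _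
          | add m m' _ _ h h' => rw [lie_add]; exact Submodule.add_mem _ h h'
        | zero => rw [zero_lie]; exact Submodule.zero_mem _
        | add x y _ _ h h' => rw [add_lie]; exact Submodule.add_mem _ h h' }
  have : N ≤ N' := LieSubmodule.lieSpan_le.2 fun m hm => by
    obtain ⟨ξ, h⟩ := hS m hm
    exact Submodule.mem_iSup_of_mem ξ ⟨LieSubmodule.subset_lieSpan hm, h⟩
  exact this

omit [AddCommGroup Q] in
/-- A bijective homomorphism onto a graded module which preserves the grading gives an isomorphism
of graded modules. -/
theorem gradedIso_of_bijective {M N : Type*} [AddCommGroup M] [Module K M]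
    [LieRingModule (Lie K A) M] [AddCommGroup N] [Module K N] [LieRingModule (Lie K A) N]
    {degM : Q → Submodule K M} {degN : Q → Submodule K N} (f : N →ₗ⁅K, Lie K A⁆ M)
    (hf : Function.Bijective f) (hM : iSupIndep degM) (hN : ⨆ ξ, degN ξ = ⊤)
    (h : ∀ ξ, (degN ξ).map (f : N →ₗ[K] M) ≤ degM ξ) : GradedIso (A := A) degM degN := by
  have h1 : ∀ ξ, (degN ξ).map (f : N →ₗ[K] M) = degM ξ := by
    refine eq_of_le_of_iSupIndep hM h ?_
    rw [← Submodule.map_iSup, hN, Submodule.map_top]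
    exact LinearMap.range_eq_top.2 hf.2
  let E : N ≃ₗ⁅K, Lie K A⁆ M :=
    { f with
      invFun := (Equiv.ofBijective f hf).symm
      left_inv := (Equiv.ofBijective f hf).left_inv
      right_inv := (Equiv.ofBijective f hf).right_inv }
  have hE : ∀ n, E n = f n := fun n => rfl
  refine ⟨E.symm, fun ξ => ?_⟩
  rw [← h1 ξ]
  ext n
  simp only [Submodule.mem_map]
  constructor
  · rintro ⟨_, ⟨n', hn', rfl⟩, rfl⟩
    have : E.symm (f n') = n' := E.symm_apply_apply n'
    exact this.symm ▸ hn'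
  · intro hn
    exact ⟨f n, ⟨n, hn, rfl⟩, E.symm_apply_apply n⟩

end Subquotient

/-! ### The graded module structure on a tensor product of baby Verma modules. -/

namespace ClosedTorus

namespace TriangularData

variable {K : Type*} [Field K] {A : Type*} [CommRing A] [HopfAlgebra K A]
  {X : Type*} [AddCommGroup X] {T : ClosedTorus K A X}
  {ι Y : Type*} [AddCommGroup Y] {P : RootDatum ι X Y}
  {p : ℕ} [Fact p.Prime] [CharP K p] {b : P.Base} {D : ℕ} (d : T.TriangularData p b D)

section Compatible

/-- If χ is nonzero on f_j then γ_j belongs to I, so its class modulo ℤI is 0. -/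
theorem compatible_of_isWeakStandardLevi {e : ι → Lie K A}
    (hd : ∀ j, ∃ i, P.root i = -P.root (d.γ j) ∧ d.f j = e i) {I : Set ι}
    {χ : Module.Dual K (Lie K A)} (hχ : T.IsWeakStandardLevi b e I χ) :
    d.Compatible (toDegree P I) χ where
  cartan := hχ.cartan
  pos j := hχ.pos _ (d.γ j).2 _ (d.e_mem j)
  neg j hj := by
    obtain ⟨i, hi, h⟩ := hd j
    rw [h] at hj
    have hI : (d.γ j : ι) ∈ I := by
      by_contra hI
      exact hj (hχ.neg_of_notMem _ _ (d.γ j).2 hI hi)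
    exact (QuotientAddGroup.eq_zero_iff _).2
      (AddSubgroup.subset_closure (Set.mem_image_of_mem _ hI))

variable {Q : Type*} [AddCommGroup Q] {q : X →+ Q} {d}

theorem Compatible.neg_dual {ψ : Module.Dual K (Lie K A)} (hψ : d.Compatible q ψ) :
    d.Compatible q (-ψ) where
  cartan h hh := by rw [LinearMap.neg_apply, hψ.cartan h hh, neg_zero]
  pos j := by rw [LinearMap.neg_apply, hψ.pos j, neg_zero]
  neg j hj := hψ.neg j fun h => hj (by rw [LinearMap.neg_apply, h, neg_zero])

variable (d q) in
theorem compatible_zero : d.Compatible q 0 where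
  cartan _ _ := rfl
  pos _ := rfl
  neg _ h := absurd rfl h

end Compatible

variable [IsAlgClosed K] [Module.Free ℤ X] {Q : Type*} [AddCommGroup Q] {q : X →+ Q}
  {ψ ψ' : Module.Dual K (Lie K A)} (ν μ : X)

/-- The basis vectors `f ^ a ⊗ f ^ b` of `Z_ψ(ν) ⊗ Z_ψ'(μ)`. -/
def tensorMonomial (ψ ψ' : Module.Dual K (Lie K A)) (a : (Fin D → Fin p) × (Fin D → Fin p)) :
    BabyVerma p T b ψ ν ⊗[K] BabyVerma p T b ψ' μ :=
  d.monomial ψ ν a.1 ⊗ₜ[K] d.monomial ψ' μ a.2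

theorem tensorBasis_apply (hψ : d.Compatible q ψ) (hψ' : d.Compatible q ψ') :
    ((d.monomialBasis ν hψ).tensorProduct (d.monomialBasis μ hψ') : _ → _) =
      d.tensorMonomial ν μ ψ ψ' := by
  funext a
  rw [Module.Basis.tensorProduct_apply', monomialBasis_apply, monomialBasis_apply]
  rfl

theorem tensorDegree_eq (hψ : d.Compatible q ψ) (hψ' : d.Compatible q ψ') :
    tensorDegree (babyVermaDegree p T b q ψ ν) (babyVermaDegree p T b q ψ' μ) =
      fun ξ => Submodule.span K (d.tensorMonomial ν μ ψ ψ'  ''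
        {a | q (d.monomialWeight ν a.1) + q (d.monomialWeight μ a.2) = ξ}) := by
  funext ξ
  rw [d.babyVermaDegree_eq_fun ν hψ, d.babyVermaDegree_eq_fun μ hψ']
  exact tensorDegree_span_fiber (Q := Q) _ _ (fun a => q (d.monomialWeight ν a))
    (fun a => q (d.monomialWeight μ a)) ξ

omit [IsAlgClosed K] [Module.Free ℤ X] in
variable (T b) in
theorem lie_mem_tensorDegree (κ : X) (ξ : Q) (x : Lie K A) (hx : x ∈ T.weightSpace κ)
    (m : BabyVerma p T b ψ ν ⊗[K] BabyVerma p T b ψ' μ)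
    (hm : m ∈ tensorDegree (babyVermaDegree p T b q ψ ν) (babyVermaDegree p T b q ψ' μ) ξ) :
    ⁅x, m⁆ ∈ tensorDegree (babyVermaDegree p T b q ψ ν) (babyVermaDegree p T b q ψ' μ)
      (q κ + ξ) := by
  rw [tensorDegree] at hm
  induction hm using Submodule.iSup_induction' with
  | mem η m hm =>
    rw [range_map_subtype, Submodule.map₂_eq_span_image2] at hm
    induction hm using Submodule.span_induction with
    | mem m hm =>
      obtain ⟨y, hy, z, hz, rfl⟩ := hm
      change ⁅x, y ⊗ₜ[K] z⁆ ∈ _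
      rw [TensorProduct.LieModule.lie_tmul_right]
      refine Submodule.add_mem _ ?_ ?_
      · have := tmul_mem_tensorDegree (lie_mem_babyVermaDegree p T b ψ ν q hx hy) hz
        rwa [show q κ + η + (ξ - η) = q κ + ξ by abel] at this
      · have := tmul_mem_tensorDegree hy (lie_mem_babyVermaDegree p T b ψ' μ q hx hz)
        rwa [show η + (q κ + (ξ - η)) = q κ + ξ by abel] at this
    | zero => rw [lie_zero]; exact Submodule.zero_mem _
    | add m m' _ _ h h' => rw [lie_add]; exact Submodule.add_mem _ h h'
    | smul c m _ h => rw [lie_smul]; exact Submodule.smul_mem _ _ h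
  | zero => rw [lie_zero]; exact Submodule.zero_mem _
  | add m m' _ _ h h' => rw [lie_add]; exact Submodule.add_mem _ h h'

omit [IsAlgClosed K] [Module.Free ℤ X] in
variable (T b) in
theorem toEnd_pow_char_tensor (x : Lie K A)
    (m : BabyVerma p T b ψ ν ⊗[K] BabyVerma p T b ψ' μ) :
    (LieModule.toEnd K (Lie K A) (BabyVerma p T b ψ ν ⊗[K] BabyVerma p T b ψ' μ) x ^ p) m =
      ⁅pPow p x, m⁆ + (ψ + ψ') x ^ p • m := by
  induction m with
  | zero => rw [map_zero, lie_zero, smul_zero, add_zero]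
  | tmul y z =>
    rw [toEnd_tensorProduct_pow_char, toEnd_pow_char_babyVerma, toEnd_pow_char_babyVerma,
      TensorProduct.LieModule.lie_tmul_right, LinearMap.add_apply, add_pow_char, TensorProduct.add_tmul,
      TensorProduct.tmul_add, add_smul, TensorProduct.smul_tmul', TensorProduct.tmul_smul]
    abel
  | add m m' h h' => rw [map_add, h, h', lie_add, smul_add]; abel

theorem cartan_lie_tensor {y : BabyVerma p T b ψ ν} {z : BabyVerma p T b ψ' μ} {κ κ' : X}
    (hy : ∀ h : T.lie, toRedEnv p ψ (h : Lie K A) • y = T.differential κ h • y)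
    (hz : ∀ h : T.lie, toRedEnv p ψ' (h : Lie K A) • z = T.differential κ' h • z) :
    y ⊗ₜ[K] z ∈ cartanWeightSpace T (BabyVerma p T b ψ ν ⊗[K] BabyVerma p T b ψ' μ) (κ + κ') := by
  intro h
  rw [TensorProduct.LieModule.lie_tmul_right, bracket_eq_smul, bracket_eq_smul, hy, hz,
    ← TensorProduct.smul_tmul', TensorProduct.tmul_smul, ← add_smul]
  congr 1
  rw [T.differential_add]
  rfl

/-- The tensor product of two baby Verma modules is a graded module with property (X). -/
theorem isGradedModule_tensor (hψ : d.Compatible q ψ) (hψ' : d.Compatible q ψ') :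
    IsGradedModule p T q (ψ + ψ') (BabyVerma p T b ψ ν ⊗[K] BabyVerma p T b ψ' μ)
      (tensorDegree (babyVermaDegree p T b q ψ ν) (babyVermaDegree p T b q ψ' μ)) where
  pCharacter := toEnd_pow_char_tensor T b ν μ
  independent := by
    rw [d.tensorDegree_eq ν μ hψ hψ']
    refine iSupIndep_span_fiber ?_ _
    rw [← d.tensorBasis_apply ν μ hψ hψ']
    exact Module.Basis.linearIndependent _
  iSup_eq_top := by
    rw [d.tensorDegree_eq ν μ hψ hψ']
    refine iSup_span_fiber ?_ _
    rw [← d.tensorBasis_apply ν μ hψ hψ']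
    exact Module.Basis.span_eq _
  lie_mem := lie_mem_tensorDegree T b ν μ
  propertyX ξ := by
    refine le_antisymm ?_ (iSup_le fun _ => inf_le_left)
    rw [d.tensorDegree_eq ν μ hψ hψ', Submodule.span_le]
    rintro _ ⟨a, ha, rfl⟩
    -- The sum of the two monomial weights already lies over ξ, so no shift by pX is needed and the
    -- witness κ is 0.
    refine Submodule.mem_iSup_of_mem
      ⟨d.monomialWeight ν a.1 + d.monomialWeight μ a.2, 0, ?_⟩
      ⟨Submodule.subset_span ⟨a, ha, rfl⟩, ?_⟩
    · rw [map_add, smul_zero, map_zero, add_zero]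
      exact ha
    · exact cartan_lie_tensor ν μ (fun h => d.cartan_smul_monomial ψ ν h _)
        (fun h => d.cartan_smul_monomial ψ' μ h _)

end TriangularData

end ClosedTorus

/-- A climb from 0 to nN in n steps of size at most N has no slack: bound g from above going up from
0, and from below going down from n. -/
theorem eq_add_of_le_add {n N : ℕ} {g : Fin (n + 1) → ℕ} (h0 : g 0 = 0)
    (hn : g (Fin.last n) = n * N) (h : ∀ i : Fin n, g i.succ ≤ g i.castSucc + N) (i : Fin n) :
    g i.succ = g i.castSucc + N := by
  have h1 : ∀ j : Fin (n + 1), g j ≤ j * N := by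
    intro j
    induction j using Fin.induction with
    | zero => simp [h0]
    | succ j ih =>
      have := h j
      rw [Fin.val_succ, add_mul, one_mul]
      rw [Fin.val_castSucc] at ih
      omega
  have h2 : ∀ j : Fin (n + 1), n * N ≤ g j + (n - j) * N := by
    intro j
    induction j using Fin.reverseInduction with
    | last => simp [hn]
    | cast j ih =>
      have h3 := h j
      have h4 : n - (j.castSucc : ℕ) = n - (j.succ : ℕ) + 1 := by
        rw [Fin.val_castSucc, Fin.val_succ]
        omega
      rw [h4, add_mul, one_mul]
      omega
  have h3 := h1 i.castSucc
  have h4 := h2 i.succ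
  have h5 : n * N = (n - (i.succ : ℕ)) * N + (i.castSucc : ℕ) * N + N := by
    rw [← add_mul, ← Nat.succ_mul]
    congr 1
    rw [Fin.val_castSucc, Fin.val_succ]
    omega
  have := h i
  omega

/-! ### The filtration of the tensor product. -/

namespace ClosedTorus

namespace TriangularData

variable {K : Type*} [Field K] {A : Type*} [CommRing A] [HopfAlgebra K A]
  {X : Type*} [AddCommGroup X] {T : ClosedTorus K A X}
  {ι Y : Type*} [AddCommGroup Y] {P : RootDatum ι X Y}
  {p : ℕ} [Fact p.Prime] [CharP K p] {b : P.Base} {D : ℕ} (d : T.TriangularData p b D)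
  {Q : Type*} [AddCommGroup Q] {q : X →+ Q} (ν μ : X) (ψ ψ' : Module.Dual K (Lie K A))

/-- Sorting by the negative of the height puts the highest monomials first, so raising the height
means moving to the front. -/
theorem exists_enumeration : ∃ a : Fin (p ^ D) ≃ (Fin D → Fin p), ∀ i j, i ≤ j →
    d.ht (d.monomialWeight μ (a j)) ≤ d.ht (d.monomialWeight μ (a i)) := by
  let a := (Fintype.equivFinOfCardEq (α := Fin D → Fin p) (n := p ^ D) (by simp)).symm
  let g : Fin (p ^ D) → ℚ := fun i => -d.ht (d.monomialWeight μ (a i))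
  exact ⟨(Tuple.sort g).trans a, fun i j hij => neg_le_neg_iff.1 (Tuple.monotone_sort g hij)⟩

/-- The vector `(1 ⊗ 1) ⊗ f ^ c` of `Z_ψ(ν) ⊗ Z_ψ'(μ)`. -/
def generator (c : Fin D → Fin p) : BabyVerma p T b ψ ν ⊗[K] BabyVerma p T b ψ' μ :=
  highestVector p T b ψ ν ⊗ₜ[K] d.monomial ψ' μ c

variable {n : ℕ} (a : Fin n ≃ (Fin D → Fin p))

/-- The submodule of `Z_ψ(ν) ⊗ Z_ψ'(μ)` generated by the first `i` of the vectors
`(1 ⊗ 1) ⊗ f ^ c`. -/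
def tensorFiltration (i : Fin (n + 1)) :
    LieSubmodule K (Lie K A) (BabyVerma p T b ψ ν ⊗[K] BabyVerma p T b ψ' μ) :=
  LieSubmodule.lieSpan K (Lie K A) {m | ∃ j : Fin n, j.castSucc < i ∧ m = d.generator ν μ ψ ψ' (a j)}

theorem generator_mem_tensorFiltration {i : Fin (n + 1)} {j : Fin n} (h : j.castSucc < i) :
    d.generator ν μ ψ ψ' (a j) ∈ d.tensorFiltration ν μ ψ ψ' a i :=
  LieSubmodule.subset_lieSpan ⟨j, h, rfl⟩

theorem tensorFiltration_zero : d.tensorFiltration ν μ ψ ψ' a 0 = ⊥ := by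
  rw [tensorFiltration, eq_bot_iff, LieSubmodule.lieSpan_le]
  rintro _ ⟨j, h, -⟩
  exact absurd h (Fin.not_lt_zero _)

theorem monotone_tensorFiltration : Monotone (d.tensorFiltration ν μ ψ ψ' a) := fun _ _ h =>
  LieSubmodule.lieSpan_mono fun _ ⟨j, hj, hm⟩ => ⟨j, hj.trans_le h, hm⟩

variable [IsAlgClosed K] [Module.Free ℤ X]
variable {ψ ψ'}

/-- The y such that y ⊗ z lies in the submodule for all z form a 𝔤-stable subspace, because x y ⊗ z
= x (y ⊗ z) - y ⊗ x z. It contains 1 ⊗ 1, so it is everything. -/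
theorem tensorFiltration_last (hψ' : d.Compatible q ψ') :
    d.tensorFiltration ν μ ψ ψ' a (Fin.last n) = ⊤ := by
  set F := d.tensorFiltration ν μ ψ ψ' a (Fin.last n) with hF
  let N : Submodule K (BabyVerma p T b ψ ν) :=
    { carrier := {y | ∀ z, y ⊗ₜ[K] z ∈ F}
      add_mem' := fun h h' z => by rw [TensorProduct.add_tmul]; exact add_mem (h z) (h' z)
      zero_mem' := fun z => by rw [TensorProduct.zero_tmul]; exact zero_mem _
      smul_mem' := fun c y h z => by
        rw [← TensorProduct.smul_tmul']
        exact F.toSubmodule.smul_mem c (h z) }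
  have hN : N = ⊤ := by
    refine eq_top_of_smul_mem ν N (fun z => ?_) (fun x y hy z => ?_)
    · have hz : z ∈ Submodule.span K (Set.range (d.monomial ψ' μ)) := by
        rw [d.span_monomial μ hψ']; trivial
      induction hz using Submodule.span_induction with
      | mem z hz =>
        obtain ⟨c, rfl⟩ := hz
        have := d.generator_mem_tensorFiltration ν μ ψ ψ' a (Fin.castSucc_lt_last (a.symm c))
        rwa [Equiv.apply_symm_apply] at this
      | zero => rw [TensorProduct.tmul_zero]; exact zero_mem _
      | add z z' _ _ h h' => rw [TensorProduct.tmul_add]; exact add_mem h h'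
      | smul c z _ h =>
        rw [TensorProduct.tmul_smul]
        exact F.toSubmodule.smul_mem c h
    · have h1 := F.lie_mem (x := x) (hy z)
      rw [TensorProduct.LieModule.lie_tmul_right] at h1
      exact (F.toSubmodule.add_mem_iff_left (hy _)).1 h1
  rw [eq_top_iff]
  rintro m -
  induction m with
  | zero => exact zero_mem _
  | tmul y z =>
    have hy : y ∈ N := by rw [hN]; trivial
    exact hy z
  | add m m' h h' => exact add_mem h h'

/-- As x kills 1 ⊗ 1 in the first factor, it acts on the generator through the second factor only.
There it yields monomials of strictly greater height, which precede the given one in the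
enumeration. -/
theorem lie_generator_mem_tensorFiltration (hψ' : d.Compatible q ψ')
    (ha : ∀ i j, i ≤ j → d.ht (d.monomialWeight μ (a j)) ≤ d.ht (d.monomialWeight μ (a i)))
    (i : Fin n) {k : ι} (hk : b.IsPos k) {x : Lie K A} (hx : x ∈ T.weightSpace (P.root k)) :
    ⁅x, d.generator ν μ ψ ψ' (a i)⁆ ∈ d.tensorFiltration ν μ ψ ψ' a i.castSucc := by
  have hkpos : 0 < d.ht (P.root k) := by
    have := d.ht_pos (d.γ.symm ⟨k, hk⟩)
    rwa [Equiv.apply_symm_apply] at this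
  rw [generator, TensorProduct.LieModule.lie_tmul_right, bracket_eq_smul, bracket_eq_smul,
    rootVector_smul_highestVector p T b ψ ν hk hx, TensorProduct.zero_tmul, zero_add]
  have h1 := d.weightFiltration_le μ hψ' _ (d.smul_mem_weightFiltration q ψ' μ hx
    (d.monomial_mem_weightFiltration μ (a i)))
  generalize toRedEnv p ψ' x • d.monomial ψ' μ (a i) = z at h1
  induction h1 using Submodule.span_induction with
  | mem z hz =>
    obtain ⟨c, ⟨-, hc⟩, rfl⟩ := hz
    -- A monomial in position i or later has at most the height of the i-th one, while x has added
    -- the positive height of its root.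
    have h2 : a.symm c < i := by
      by_contra! h2
      have h3 := ha _ _ h2
      rw [Equiv.apply_symm_apply] at h3
      rw [map_add] at hc
      linarith
    have := d.generator_mem_tensorFiltration ν μ ψ ψ' a (Fin.castSucc_lt_castSucc_iff.2 h2)
    rwa [Equiv.apply_symm_apply] at this
  | zero => rw [TensorProduct.tmul_zero]; exact zero_mem _
  | add z z' _ _ h h' => rw [TensorProduct.tmul_add]; exact add_mem h h'
  | smul c z _ h =>
    rw [TensorProduct.tmul_smul]
    exact (d.tensorFiltration ν μ ψ ψ' a i.castSucc).toSubmodule.smul_mem c h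

theorem generator_mem_tensorDegree (c : Fin D → Fin p) (hψ' : d.Compatible q ψ') :
    d.generator ν μ ψ ψ' c ∈ tensorDegree (babyVermaDegree p T b q ψ ν)
      (babyVermaDegree p T b q ψ' μ) (q (ν + d.monomialWeight μ c)) := by
  rw [map_add]
  refine tmul_mem_tensorDegree ?_ ?_
  · refine ⟨1, ?_, rfl⟩
    rw [sub_self]
    exact Submodule.subset_span ⟨[], by simp, by simp, by simp⟩
  · rw [d.babyVermaDegree_eq μ hψ']
    exact Submodule.subset_span ⟨c, rfl, rfl⟩

theorem generator_mem_cartanWeightSpace (c : Fin D → Fin p) :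
    d.generator ν μ ψ ψ' c ∈ cartanWeightSpace T _ (ν + d.monomialWeight μ c) :=
  cartan_lie_tensor ν μ (fun h => cartan_smul_highestVector p T b ψ ν h)
    (fun h => d.cartan_smul_monomial ψ' μ h c)

theorem isGradedSubmodule_tensorFiltration (hψ' : d.Compatible q ψ') (i : Fin (n + 1)) :
    IsGradedSubmodule (tensorDegree (babyVermaDegree p T b q ψ ν) (babyVermaDegree p T b q ψ' μ))
      (d.tensorFiltration ν μ ψ ψ' a i) := by
  refine isGradedSubmodule_lieSpan d.iSup_weightSpace (lie_mem_tensorDegree T b ν μ) ?_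
  rintro _ ⟨j, -, rfl⟩
  exact ⟨_, d.generator_mem_tensorDegree ν μ (a j) hψ'⟩

end TriangularData

end ClosedTorus

/-! ### Dimensions and the layers of the filtration. -/

theorem finrank_subquotient {K : Type*} [Field K] {A : Type*} [CommRing A] [HopfAlgebra K A]
    {M : Type*} [AddCommGroup M] [Module K M] [LieRingModule (Lie K A) M]
    [LieModule K (Lie K A) M] [FiniteDimensional K M] {N N' : LieSubmodule K (Lie K A) M}
    (h : N ≤ N') :
    Module.finrank K N' = Module.finrank K N + Module.finrank K (Subquotient N N') := by
  have h1 := Submodule.finrank_quotient_add_finrank (N.comap N'.incl).toSubmodule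
  have h2 : Module.finrank K (N.comap N'.incl).toSubmodule = Module.finrank K N :=
    (Submodule.comapSubtypeEquivOfLe (p := N.toSubmodule) (q := N'.toSubmodule) h).finrank_eq
  rw [h2, add_comm] at h1
  exact h1.symm

namespace ClosedTorus

namespace TriangularData

variable {K : Type*} [Field K] {A : Type*} [CommRing A] [HopfAlgebra K A]
  {X : Type*} [AddCommGroup X] {T : ClosedTorus K A X}
  {ι Y : Type*} [AddCommGroup Y] {P : RootDatum ι X Y}
  {p : ℕ} [Fact p.Prime] [CharP K p] {b : P.Base} {D : ℕ} (d : T.TriangularData p b D)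
  {Q : Type*} [AddCommGroup Q] {q : X →+ Q} (ν μ : X) {ψ ψ' : Module.Dual K (Lie K A)}
  [IsAlgClosed K] [Module.Free ℤ X]

theorem finrank_babyVerma (hψ : d.Compatible q ψ) :
    Module.finrank K (BabyVerma p T b ψ ν) = p ^ D := by
  rw [Module.finrank_eq_card_basis (d.monomialBasis ν hψ)]
  simp

theorem finiteDimensional_babyVerma (hψ : d.Compatible q ψ) :
    FiniteDimensional K (BabyVerma p T b ψ ν) :=
  (d.monomialBasis ν hψ).finiteDimensional_of_finite

theorem iSup_babyVermaDegree (hψ : d.Compatible q ψ) :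
    ⨆ ξ, babyVermaDegree p T b q ψ ν ξ = ⊤ := by
  rw [d.babyVermaDegree_eq_fun ν hψ]
  exact iSup_span_fiber (d.span_monomial ν hψ) _

/-- The components of both gradings are spanned by the monomials they contain, so only weights of
monomials have to be compared. -/
theorem coarsen_babyVermaDegree (hψ : d.Compatible (AddMonoidHom.id X) ψ)
    (hψ' : d.Compatible q ψ) :
    coarsen q (babyVermaDegree p T b (AddMonoidHom.id X) ψ ν) = babyVermaDegree p T b q ψ ν := by
  funext ξ
  rw [d.babyVermaDegree_eq_fun ν hψ, d.babyVermaDegree_eq_fun ν hψ']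
  exact coarsen_span_fiber q _ (d.monomialWeight ν) ξ

variable {n : ℕ} (a : Fin n ≃ (Fin D → Fin p))

/-- The class of `(1 ⊗ 1) ⊗ f ^ c` in the corresponding layer of the filtration. -/
def layerGenerator (ψ ψ' : Module.Dual K (Lie K A)) (i : Fin n) :
    Subquotient (d.tensorFiltration ν μ ψ ψ' a i.castSucc)
      (d.tensorFiltration ν μ ψ ψ' a i.succ) :=
  LieSubmodule.Quotient.mk' _ ⟨d.generator ν μ ψ ψ' (a i),
    d.generator_mem_tensorFiltration ν μ ψ ψ' a i.castSucc_lt_succ⟩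

/-- In the layer the new generator is killed by the positive root spaces and is a weight vector for
𝔱, and the p-character of the tensor product is ψ + ψ'. The universal property gives the map; it is
onto because all earlier generators vanish in the layer. -/
theorem exists_surjective_layer (hψ' : d.Compatible q ψ')
    (ha : ∀ i j, i ≤ j → d.ht (d.monomialWeight μ (a j)) ≤ d.ht (d.monomialWeight μ (a i)))
    (i : Fin n) : ∃ f : BabyVerma p T b (ψ + ψ') (ν + d.monomialWeight μ (a i)) →ₗ⁅K, Lie K A⁆
      Subquotient (d.tensorFiltration ν μ ψ ψ' a i.castSucc)
        (d.tensorFiltration ν μ ψ ψ' a i.succ),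
      Function.Surjective f ∧
        f (highestVector p T b _ _) = d.layerGenerator ν μ a ψ ψ' i := by
  set N := d.tensorFiltration ν μ ψ ψ' a i.castSucc with hN
  set N' := d.tensorFiltration ν μ ψ ψ' a i.succ with hN'
  have hmk := LieSubmodule.Quotient.surjective_mk' (N.comap N'.incl)
  obtain ⟨f, hf⟩ := exists_lieModuleHom p T b (ψ := ψ + ψ') (ν + d.monomialWeight μ (a i))
    (M := Subquotient N N') (m := d.layerGenerator ν μ a ψ ψ' i)
    (fun x y => by
      obtain ⟨m, rfl⟩ := hmk y
      rw [toEnd_pow_map, ← LieModuleHom.map_lie, ← map_smul, ← map_add]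
      congr 1
      refine Subtype.ext ?_
      have h1 := toEnd_pow_map N'.incl x p m
      have h2 := toEnd_pow_char_tensor T b ν μ x (m : BabyVerma p T b ψ ν ⊗[K] BabyVerma p T b ψ' μ)
      exact h1.symm.trans h2)
    (fun k hk x hx => by
      rw [layerGenerator, ← LieModuleHom.map_lie, LieSubmodule.Quotient.mk_eq_zero]
      exact d.lie_generator_mem_tensorFiltration ν μ a hψ' ha i hk hx)
    (fun h => by
      rw [layerGenerator, ← LieModuleHom.map_lie, ← map_smul]
      congr 1
      exact Subtype.ext (d.generator_mem_cartanWeightSpace ν μ (a i) h))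
  refine ⟨f, ?_, hf⟩
  -- The preimage of the range, viewed in the whole tensor product; it contains every generator of
  -- N', so surjectivity follows.
  let R : LieSubmodule K (Lie K A) (BabyVerma p T b ψ ν ⊗[K] BabyVerma p T b ψ' μ) :=
    (f.range.comap (LieSubmodule.Quotient.mk' (N.comap N'.incl))).map N'.incl
  have hR : N' ≤ R := by
    rw [hN', tensorFiltration, LieSubmodule.lieSpan_le]
    rintro _ ⟨j, hj, rfl⟩
    refine (LieSubmodule.mem_map _).2 ⟨⟨_, d.generator_mem_tensorFiltration ν μ ψ ψ' a hj⟩, ?_, rfl⟩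
    rw [LieSubmodule.mem_comap, LieModuleHom.mem_range]
    rcases eq_or_ne j i with rfl | hne
    · exact ⟨_, hf⟩
    · refine ⟨0, ?_⟩
      rw [map_zero, eq_comm, LieSubmodule.Quotient.mk_eq_zero]
      refine d.generator_mem_tensorFiltration ν μ ψ ψ' a (Fin.castSucc_lt_castSucc_iff.2 ?_)
      exact lt_of_le_of_ne (Fin.castSucc_lt_succ_iff.1 hj) hne
  intro y
  obtain ⟨m, rfl⟩ := hmk y
  obtain ⟨m', h1, h2⟩ := (LieSubmodule.mem_map _).1 (hR m.2)
  rw [← show m' = m from Subtype.ext h2]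
  exact (LieModuleHom.mem_range _ _).1 (LieSubmodule.mem_comap.1 h1)

/-- The layers of the filtration of `Z_ψ(ν) ⊗ Z_ψ'(μ)` are baby Verma modules. -/
theorem gradedIso_layer (hψ : d.Compatible q ψ) (hψ' : d.Compatible q ψ')
    (hadd : d.Compatible q (ψ + ψ'))
    (ha : ∀ i j, i ≤ j → d.ht (d.monomialWeight μ (a j)) ≤ d.ht (d.monomialWeight μ (a i)))
    (i : Fin n) : GradedIso (A := A)
      (subquotientDegree (tensorDegree (babyVermaDegree p T b q ψ ν) (babyVermaDegree p T b q ψ' μ))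
        (d.tensorFiltration ν μ ψ ψ' a i.castSucc) (d.tensorFiltration ν μ ψ ψ' a i.succ))
      (babyVermaDegree p T b q (ψ + ψ') (ν + d.monomialWeight μ (a i))) := by
  have := d.finiteDimensional_babyVerma ν hψ
  have := d.finiteDimensional_babyVerma μ hψ'
  -- The dimensions of the filtration rise by at most p^D at each step and reach p^D · p^D after n =
  -- p^D steps, so each step is exactly p^D.
  have h1 := eq_add_of_le_add (n := n) (N := p ^ D)
    (g := fun i => Module.finrank K (d.tensorFiltration ν μ ψ ψ' a i)) (by
      rw [tensorFiltration_zero]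
      exact finrank_bot K _) (by
      rw [d.tensorFiltration_last ν μ a hψ']
      refine finrank_top K (BabyVerma p T b ψ ν ⊗[K] BabyVerma p T b ψ' μ) |>.trans ?_
      rw [Module.finrank_tensorProduct, d.finrank_babyVerma ν hψ, d.finrank_babyVerma μ hψ']
      congr 1
      simpa using (Fintype.card_congr a).symm) (fun i => by
      have := d.finiteDimensional_babyVerma (ν + d.monomialWeight μ (a i)) hadd
      obtain ⟨f, hf, -⟩ := d.exists_surjective_layer (ψ := ψ) ν μ a hψ' ha i
      have h2 := LinearMap.finrank_le_finrank_of_surjective (f := f.toLinearMap) hf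
      rw [d.finrank_babyVerma _ hadd] at h2
      have h3 := finrank_subquotient (d.monotone_tensorFiltration ν μ ψ ψ' a i.castSucc_lt_succ.le)
      omega) i
  have := d.finiteDimensional_babyVerma (ν + d.monomialWeight μ (a i)) hadd
  obtain ⟨f, hf, hf'⟩ := d.exists_surjective_layer (ψ := ψ) ν μ a hψ' ha i
  have h3 := finrank_subquotient (d.monotone_tensorFiltration ν μ ψ ψ' a i.castSucc_lt_succ.le)
  have h4 : Module.finrank K (BabyVerma p T b (ψ + ψ') (ν + d.monomialWeight μ (a i))) =
      Module.finrank K (Subquotient (d.tensorFiltration ν μ ψ ψ' a i.castSucc)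
        (d.tensorFiltration ν μ ψ ψ' a i.succ)) := by
    rw [d.finrank_babyVerma _ hadd]
    omega
  have hinj : Function.Injective f :=
    (LinearMap.injective_iff_surjective_of_finrank_eq_finrank h4
      (f := f.toLinearMap)).2 hf
  refine gradedIso_of_bijective f ⟨hinj, hf⟩ ?_ (d.iSup_babyVermaDegree _ hadd) ?_
  · exact iSupIndep_subquotientDegree (d.isGradedModule_tensor ν μ hψ hψ').independent
      (d.isGradedSubmodule_tensorFiltration ν μ a hψ' _) _
  · refine map_babyVermaDegree_le p T b _ q f
      (lie_mem_subquotientDegree _ _ (lie_mem_tensorDegree T b ν μ)) ?_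
    rw [hf']
    exact ⟨_, d.generator_mem_tensorDegree ν μ (a i) hψ', rfl⟩

end TriangularData

end ClosedTorus

end

end ReducedEnveloping

open ReducedEnveloping in
theorem proposition2 (p : ℕ) [Fact p.Prime]
    {K : Type*} [Field K] [IsAlgClosed K] [CharP K p]
    -- the reductive group `G`, with coordinate ring `A`
    {A : Type*} [CommRing A] [HopfAlgebra K A] (hG : IsReductiveGroup K A)
    -- the maximal torus `T`, with `X = X(T)` and `Y = Y(T)`, and the root datum
    {X : Type*} [AddCommGroup X] [Module.Free ℤ X] [Module.Finite ℤ X]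
    (T : ClosedTorus K A X) (hT : T.IsMaximalTorus)
    {ι Y : Type*} [Finite ι] [AddCommGroup Y] (P : RootDatum ι X Y) (hP : T.IsRootDatum P)
    -- the Borel subgroup `B` and its simple roots
    (B : Subgroup (Points K A)) (b : P.Base) (hb : T.IsBaseOfBorel B b)
    -- the root vectors of a Chevalley basis
    (e : ι → Lie K A) (he : T.IsChevalleySystem P e)
    (hstd : StandardHypotheses K A p b)
    -- an enumeration of the positive roots
    (D : ℕ) (γ : Fin D ≃ {i : ι // b.IsPos i})
    (I : Set ι) (χ : Module.Dual K (Lie K A)) (hχ : T.IsWeakStandardLevi b e I χ)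
    (lam mu : X) :
    IsGradedModule p T (toDegree P I) 0 (BabyVermaTensor p T b χ lam mu)
        (babyVermaTensorDegree p T b I χ lam mu) ∧
      ∃ (n : ℕ) (F : Fin (n + 1) → LieSubmodule K (Lie K A) (BabyVermaTensor p T b χ lam mu))
        (a : Fin n ≃ (Fin D → Fin p)),
        F 0 = ⊥ ∧ F (Fin.last n) = ⊤ ∧ Monotone F ∧
        (∀ i, IsGradedSubmodule (babyVermaTensorDegree p T b I χ lam mu) (F i)) ∧
        ∀ i : Fin n, GradedIso (A := A)
          (subquotientDegree (babyVermaTensorDegree p T b I χ lam mu) (F i.castSucc) (F i.succ))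
          (hatBabyVermaDegree p T b I
            (lam + mu - ∑ j : Fin D, (a i j : ℕ) • P.root (γ j))) := by
  obtain ⟨d, rfl, hd⟩ := T.exists_triangularData p hP b he γ
  have h1 := d.compatible_of_isWeakStandardLevi hd hχ
  have h2 := h1.neg_dual
  have h0 := d.compatible_zero (toDegree P I)
  have hsum : χ + -χ = 0 := add_neg_cancel χ
  have hmod := d.isGradedModule_tensor lam mu h1 h2
  rw [hsum] at hmod
  obtain ⟨a, ha⟩ := d.exists_enumeration mu
  refine ⟨hmod, p ^ D, d.tensorFiltration lam mu χ (-χ) a, a,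
    d.tensorFiltration_zero lam mu χ (-χ) a, d.tensorFiltration_last lam mu a h2,
    d.monotone_tensorFiltration lam mu χ (-χ) a,
    d.isGradedSubmodule_tensorFiltration lam mu a h2, fun i => ?_⟩
  -- The layers carry the p-character χ + (-χ), and compatibility of 0 is transported along `hsum`.
  have hiso := d.gradedIso_layer lam mu a h1 h2 (hsum.symm ▸ h0) ha i
  have hwt : lam + d.monomialWeight mu (a i) =
      lam + mu - ∑ j, (a i j : ℕ) • P.root (d.γ j) := by
    rw [ClosedTorus.TriangularData.monomialWeight, ← add_assoc, sub_eq_add_neg,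
      ← Finset.sum_neg_distrib]
    congr 1
    exact Finset.sum_congr rfl fun j _ => smul_neg _ _
  rw [hsum, hwt] at hiso
  -- The form 0 is compatible even with the finest grading, by X(T) itself, so the coarsened grading
  -- of Z_0 is its direct grading by X(T)/ℤI.
  rw [hatBabyVermaDegree, d.coarsen_babyVermaDegree _ (d.compatible_zero _) h0]
  exact hiso
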